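/- **Setting.** Let $N\ge 2$, $n\ge 0$, $\tau\in\mathbb C$ with $\operatorname{Im}\tau>0$, and let $z_1,\dots,z_n\in\mathbb C$ with $z_s-z_p\notin\mathbb Z+\tau\mathbb Z$ for $s\neq p$. Let $q=e^{2\pi i\tau}$, $(a;q)=\prod_{j\ge0}(1-aq^j)$, $$\theta(x)=\frac{\sin\pi x}{\pi}\,\frac{(qe^{2\pi ix};q)\,(qe^{-2\pi ix};q)}{(q;q)^{2}},\qquad \rho=\frac{\theta'}{\theta},\qquad \sigma(x,w)=\frac{\theta(x+w)}{\theta(x)\theta(w)},\qquad \varphi(x,w)=\partial_x\sigma(w,-x),\qquad \eta=\rho^2+\rho',$$ where $\varphi(x,0)=-\rho'(x)$ and $\eta(0)=\lim_{y\to0}\eta(y)$ are the values at the removable singularities. Let $V_1,\dots,V_n$ be $\mathfrak{sl}_N$-modules, regarded as $\mathfrak{gl}_N$-modules on which the central element $e_{11}+\dots+e_{NN}$ acts by zero, let $V=V_1\otimes\dots\otimes V_n$, let $g^{(k)}$ denote the action of $g$ in the $k$-th tensor factor, and put $e_{jl}=\sum_k e_{jl}^{(k)}$ on $V$ and $V[0]=\{v\in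 V: e_{jj}v=0,\ j=1,\dots,N\}$. Let $\mathrm{Fun}$ be the space of $V[0]$-valued meromorphic functions of $\lambda_1,\dots,\lambda_N$ that depend only on the differences $\lambda_{jl}=\lambda_j-\lambda_l$ (that is, functions on the Cartan subalgebra of $\mathfrak{sl}_N$), a $W$-valued meromorphic function being an element of (scalar meromorphic functions) $\otimes\, W$. **The RST operator.** Let $$L_{jj}(x)=\sum_k\rho(x-z_k)e_{jj}^{(k)}+\sum_{l\ne j}\rho(\lambda_{jl})e_{ll},\qquad L_{jl}(x)=\sum_k\sigma(x-z_k,\lambda_{lj})e_{lj}^{(k)}\quad(j\ne l),$$ and $$\mathcal D=\operatorname{cdet}\bigl(\delta_{jl}\partial_x-\delta_{jl}\partial_{\lambda_j}+L_{jl}(x)\bigr)_{j,l=1}^N=\partial_x^N+\sum_{j=1}^N S_j(x)\,\partial_x^{N-j},$$ where $\operatorname{cdet}X=\sum_{\pi\in S_N}\operatorname{sgn}(\pi)X_{\pi(1),1}\cdots X_{\pi(N),N}$. For $x\notin\bigcup_k(z_k+\mathbb Z+\tau\mathbb Z)$ the $S_j(x)$ are regarded as operators on $\mathrm{Fun}$.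 The *dynamical elliptic Bethe algebra* is the unital algebra of operators on $\mathrm{Fun}$ generated by all $S_j(x)$, $1\le j\le N$, for all such $x$. **The KZB operators.** Let $\Omega_{jl}^{(s,p)}=e_{jl}^{(s)}e_{lj}^{(p)}$ and $\Omega_0^{(s,p)}=\sum_k e_{kk}^{(s)}e_{kk}^{(p)}$. The Felder–Wieczerkowski KZB operators on $\mathrm{Fun}$ are $$H_0=\frac1{4\pi i}\sum_{k=1}^N\partial_{\lambda_k}^2+\frac1{4\pi i}\sum_{s,p=1}^n\Bigl[\tfrac12\eta(z_s-z_p)\,\Omega_0^{(s,p)}-\sum_{j\ne l}\varphi(\lambda_{jl},z_s-z_p)\,\Omega_{jl}^{(s,p)}\Bigr],$$ $$H_s=-\sum_{k=1}^N e_{kk}^{(s)}\partial_{\lambda_k}+\sum_{p\ne s}\Bigl[\rho(z_s-z_p)\,\Omega_0^{(s,p)}+\sum_{j\ne l}\sigma(z_s-z_p,-\lambda_{jl})\,\Omega_{jl}^{(s,p)}\Bigr],\qquad s=1,\dots,n.$$ **Theorem.** (1) For every $x\in\mathbb C$ with $x-z_k\notin\mathbb Z+\tau\mathbb Z$ for all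 $k$, the following identity of operators on $\mathrm{Fun}$ holds: $$S_2(x)=-2\pi i\,H_0-\sum_{s=1}^n\Bigl[H_s\,\rho(x-z_s)+c_2^{(s)}\,\rho'(x-z_s)\Bigr],$$ where $c_2=\sum_{j<l}(e_{jj}e_{ll}-e_{jl}e_{lj}+e_{jj})$. (2) If $N=2$ and every $V_s$ is an irreducible $\mathfrak{sl}_2$-module, then the dynamical elliptic Bethe algebra is the unital algebra of operators on $\mathrm{Fun}$ generated by the KZB operators $H_0,H_1,\dots,H_n$. -/

import Mathlib

open Filter Topology
open scoped UpperHalfPlane TensorProduct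

set_option linter.unusedSectionVars false

-- `gl_N` is the space of `N × N` matrices with the commutator bracket.
attribute [local instance] LieRing.ofAssociativeRing

noncomputable section

namespace EllipticBethe

/-- The infinite product `(a; q) = ∏_{j ≥ 0} (1 - a q ^ j)`, for `|q| < 1`. -/
def qProd (a q : ℂ) : ℂ := ∏' j : ℕ, (1 - a * q ^ j)

/-- `q = exp (2 π i τ)`. -/
def nome (τ : ℍ) : ℂ := Complex.exp (2 * Real.pi * Complex.I * (τ : ℂ))

/-- The lattice `ℤ + τ ℤ`. -/
def lattice (τ : ℍ) : Set ℂ := {w | ∃ k l : ℤ, w = (k : ℂ) + (l : ℂ) * (τ : ℂ)}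

/-- The first Jacobi theta function, normalized by `θ'(0) = 1`:
`θ(x) = (sin (π x) / π) (q e^{2 π i x}; q) (q e^{-2 π i x}; q) (q; q) ^ (-2)`. -/
def theta (τ : ℍ) (x : ℂ) : ℂ :=
  Complex.sin (Real.pi * x) / Real.pi *
    qProd (nome τ * Complex.exp (2 * Real.pi * Complex.I * x)) (nome τ) *
    qProd (nome τ / Complex.exp (2 * Real.pi * Complex.I * x)) (nome τ) /
    qProd (nome τ) (nome τ) ^ 2

/-- `ρ = θ' / θ`. -/
def rho (τ : ℍ) (x : ℂ) : ℂ := deriv (theta τ) x / theta τ x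

/-- `σ(x, w) = θ(x + w) / (θ(x) θ(w))`. -/
def sigma (τ : ℍ) (x w : ℂ) : ℂ := theta τ (x + w) / (theta τ x * theta τ w)

/-- `φ(x, w) = ∂_x σ(w, -x)`; at the removable singularity `w = 0` its value is `-ρ'(x)`. -/
def phi (τ : ℍ) (x w : ℂ) : ℂ :=
  if w = 0 then -deriv (rho τ) x else deriv (fun y => sigma τ w (-y)) x

/-- `η(x) = ρ(x) ^ 2 + ρ'(x)`; at the removable singularity `x = 0` its value is the limit. -/
def eta (τ : ℍ) (x : ℂ) : ℂ :=
  if x = 0 then limUnder (𝓝[≠] (0 : ℂ)) (fun y => rho τ y ^ 2 + deriv (rho τ) y)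
  else rho τ x ^ 2 + deriv (rho τ) x

lemma norm_nome_lt_one (τ : ℍ) : ‖nome τ‖ < 1 := by
  simpa [nome] using UpperHalfPlane.norm_exp_two_pi_I_lt_one τ

lemma qProd_differentiable {q : ℂ} (hq : ‖q‖ < 1) : Differentiable ℂ (fun a => qProd a q) := by
  have hm : MultipliableLocallyUniformlyOn (fun (n : ℕ) (a : ℂ) => 1 - a * q ^ n)
      (Set.univ : Set ℂ) := by
    refine ⟨fun a => ∏' n : ℕ, (1 - a * q ^ n), ?_⟩
    simp_rw [sub_eq_add_neg]
    apply hasProdLocallyUniformlyOn_of_forall_compact isOpen_univ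
    intro K _ hcK
    obtain ⟨C, hC⟩ := hcK.isBounded.exists_norm_le
    refine ((summable_geometric_of_lt_one (norm_nonneg _) hq).mul_left C).hasProdUniformlyOn_nat_one_add
      hcK (.of_forall fun n x hx => ?_) (fun _ => by fun_prop)
    rw [norm_neg, norm_mul, norm_pow]
    exact mul_le_mul_of_nonneg_right (hC x hx) (by positivity)
  have := hm.hasProdLocallyUniformlyOn.differentiableOn
    (.of_forall fun _ => by simpa [Finset.prod_fn] using
      DifferentiableOn.finsetProd (fun _ _ => by fun_prop)) isOpen_univ
  exact differentiableOn_univ.1 this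

lemma qProd_ne_zero {a q : ℂ} (hq : ‖q‖ < 1) (h : ∀ n : ℕ, 1 - a * q ^ n ≠ 0) :
    qProd a q ≠ 0 := by
  have := tprod_one_add_ne_zero_of_summable (f := fun n : ℕ => -(a * q ^ n))
    (fun n => by simpa [sub_eq_add_neg] using h n)
    (by simpa using (summable_geometric_of_lt_one (norm_nonneg _) hq).mul_left ‖a‖)
  simpa [qProd, sub_eq_add_neg] using this

lemma theta_analyticAt (τ : ℍ) (x : ℂ) : AnalyticAt ℂ (theta τ) x := by
  have hd := qProd_differentiable (norm_nome_lt_one τ)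
  have h1 : Differentiable ℂ (fun x : ℂ =>
      qProd (nome τ * Complex.exp (2 * Real.pi * Complex.I * x)) (nome τ)) :=
    hd.comp (f := fun x : ℂ => nome τ * Complex.exp (2 * Real.pi * Complex.I * x)) (by fun_prop)
  have h2 : Differentiable ℂ (fun x : ℂ =>
      qProd (nome τ / Complex.exp (2 * Real.pi * Complex.I * x)) (nome τ)) :=
    hd.comp (f := fun x : ℂ => nome τ / Complex.exp (2 * Real.pi * Complex.I * x))
      (by
        refine Differentiable.div (by fun_prop) (by fun_prop) (fun x => Complex.exp_ne_zero _))
  have : Differentiable ℂ (theta τ) := by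
    unfold theta
    fun_prop
  exact this.analyticAt x

lemma theta_ne_zero (τ : ℍ) {x : ℂ} (hx : x ∉ lattice τ) : theta τ x ≠ 0 := by
  have hpi : (Real.pi : ℂ) ≠ 0 := by exact_mod_cast Real.pi_ne_zero
  have hexp : ∀ l : ℤ, ∀ c : ℂ, c = 2 * Real.pi * Complex.I * x ∨ c = -(2 * Real.pi * Complex.I * x) →
      Complex.exp (c + l * (2 * Real.pi * Complex.I * τ)) ≠ 1 := by
    intro l c hc h
    obtain ⟨k, hk⟩ := Complex.exp_eq_one_iff.1 h
    have h2 : (2 * Real.pi * Complex.I : ℂ) ≠ 0 := Complex.two_pi_I_ne_zero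
    rcases hc with rfl | rfl
    · apply hx
      refine ⟨k, -l, ?_⟩
      apply mul_left_cancel₀ h2
      push_cast
      linear_combination hk
    · apply hx
      refine ⟨-k, l, ?_⟩
      apply mul_left_cancel₀ h2
      push_cast
      linear_combination -hk
  have hq := norm_nome_lt_one τ
  have hpow : ∀ n : ℕ, nome τ ^ n = Complex.exp (n * (2 * Real.pi * Complex.I * τ)) := by
    intro n
    rw [nome, ← Complex.exp_nat_mul]
  refine div_ne_zero (mul_ne_zero (mul_ne_zero (div_ne_zero ?_ hpi) ?_) ?_) (pow_ne_zero 2 ?_)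
  · intro h
    obtain ⟨k, hk⟩ := Complex.sin_eq_zero_iff.1 h
    exact hx ⟨k, 0, by
      apply mul_left_cancel₀ hpi
      rw [hk]; push_cast; ring⟩
  · refine qProd_ne_zero hq fun n h => hexp (n + 1) _ (Or.inl rfl) ?_
    rw [mul_right_comm, ← pow_succ', hpow, ← Complex.exp_add] at h
    rw [eq_comm, ← sub_eq_zero, ← h]
    push_cast
    ring_nf
  · refine qProd_ne_zero hq fun n h => hexp (n + 1) _ (Or.inr rfl) ?_
    rw [div_mul_eq_mul_div, ← pow_succ', hpow, ← Complex.exp_sub] at h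
    rw [eq_comm, ← sub_eq_zero, ← h]
    push_cast
    ring_nf
  · refine qProd_ne_zero hq fun n h => ?_
    rw [← pow_succ'] at h
    have h1 : ‖nome τ ^ (n + 1)‖ < 1 := by
      rw [norm_pow]; exact pow_lt_one₀ (norm_nonneg _) hq (by omega)
    rw [sub_eq_zero] at h
    rw [← h] at h1
    simp at h1

lemma half_notMem_lattice (τ : ℍ) : (1 / 2 : ℂ) ∉ lattice τ := by
  rintro ⟨k, l, h⟩
  have him := congrArg Complex.im h
  have hl : (l : ℝ) = 0 := by
    have : (0 : ℝ) = (l : ℝ) * τ.im := by simpa using him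
    rcases mul_eq_zero.1 this.symm with h0 | h0
    · exact h0
    · exact absurd h0 τ.im_pos.ne'
  have hl' : l = 0 := by exact_mod_cast hl
  subst hl'
  have h3 : (1 : ℂ) = ((2 * k : ℤ) : ℂ) := by
    push_cast; linear_combination 2 * h
  have h4 : (1 : ℤ) = 2 * k := by exact_mod_cast h3
  omega

end EllipticBethe

namespace EllipticBethe

section Meromorphic

variable {G F : Type} [NormedAddCommGroup G] [NormedSpace ℂ G]
  [NormedAddCommGroup F] [NormedSpace ℂ F]

/-- `f` is a meromorphic function near the image of `ι : G → F` (an analytic map), with a polar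
divisor that contains no open piece of that image, and `f` is invariant under translations by
multiples of `v`. As usual the values of `f` at the zeros of the local denominators are
irrelevant. For `ι = id` this is a meromorphic function on all of `F`. -/
def IsMer (ι : G → F) (v : F) (f : F → ℂ) : Prop :=
  (∀ p : G, ∃ g h : F → ℂ, AnalyticAt ℂ g (ι p) ∧ AnalyticAt ℂ h (ι p) ∧
      (∃ᶠ q in 𝓝 p, h (ι q) ≠ 0) ∧ ∀ᶠ y in 𝓝 (ι p), h y ≠ 0 → f y = g y / h y) ∧
    ∀ (y : F) (c : ℂ), f (y + c • v) = f y

/-- `f` vanishes near `ι p`, for all `p` in a dense open set. Two meromorphic functions are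
the same when their difference has this property. -/
def IsNull (ι : G → F) (f : F → ℂ) : Prop :=
  Dense (interior {p : G | ∀ᶠ y in 𝓝 (ι p), f y = 0})

lemma isNull_of_two {ι : G → F} {f g k : F → ℂ} (hf : IsNull ι f) (hg : IsNull ι g)
    (h : ∀ p, (∀ᶠ y in 𝓝 (ι p), f y = 0) → (∀ᶠ y in 𝓝 (ι p), g y = 0) →
      ∀ᶠ y in 𝓝 (ι p), k y = 0) : IsNull ι k := by
  refine Dense.mono ?_ (Dense.inter_of_isOpen_left hf hg isOpen_interior)
  rw [← interior_inter]
  exact interior_mono fun p hp => h p hp.1 hp.2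

lemma isNull_of_one {ι : G → F} {f k : F → ℂ} (hf : IsNull ι f)
    (h : ∀ p, (∀ᶠ y in 𝓝 (ι p), f y = 0) → ∀ᶠ y in 𝓝 (ι p), k y = 0) : IsNull ι k :=
  isNull_of_two hf hf fun p h1 _ => h p h1

lemma isNull_zero (ι : G → F) : IsNull ι (fun _ => 0) := by
  simp [IsNull]

/-- Identity theorem: a germ that is not zero stays so at all neighbouring points. -/
lemma frequently_ne_zero_nearby {h : G → ℂ} {p : G} (ha : AnalyticAt ℂ h p)
    (hf : ∃ᶠ q in 𝓝 p, h q ≠ 0) : ∀ᶠ q in 𝓝 p, ∃ᶠ r in 𝓝 q, h r ≠ 0 := by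
  obtain ⟨ε, hε, hb⟩ := Metric.eventually_nhds_iff_ball.1 ha.eventually_analyticAt
  refine Metric.eventually_nhds_iff_ball.2 ⟨ε, hε, fun q hq => ?_⟩
  by_contra hcon
  rw [not_frequently] at hcon
  have hz : Set.EqOn h 0 (Metric.ball p ε) :=
    AnalyticOnNhd.eqOn_zero_of_preconnected_of_eventuallyEq_zero hb
      (convex_ball p ε).isPreconnected hq (hcon.mono fun r hr => by simpa using hr)
  refine hf ?_
  filter_upwards [Metric.ball_mem_nhds p hε] with r hr
  simpa using hz hr

lemma frequently_mul_ne_zero {h k : G → ℂ} {p : G} (ha : AnalyticAt ℂ h p)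
    (hka : AnalyticAt ℂ k p) (hf : ∃ᶠ q in 𝓝 p, h q ≠ 0) (hk : ∃ᶠ q in 𝓝 p, k q ≠ 0) :
    ∃ᶠ q in 𝓝 p, h q * k q ≠ 0 := by
  rw [← frequently_frequently_nhds]
  have h1 := (hf.and_eventually
    (ha.eventually_analyticAt.and (frequently_ne_zero_nearby hka hk)))
  refine h1.mono fun q hq => ?_
  refine (hq.2.2.and_eventually (hq.2.1.continuousAt.eventually_ne hq.1)).mono fun r hr => ?_
  exact mul_ne_zero hr.2 hr.1

variable {ι : G → F} {v : F} {f g : F → ℂ}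

lemma IsMer.of_analytic (ha : ∀ p, AnalyticAt ℂ f (ι p))
    (hv : ∀ (y : F) (c : ℂ), f (y + c • v) = f y) : IsMer ι v f :=
  ⟨fun p => ⟨f, fun _ => 1, ha p, analyticAt_const, by simp, by simp⟩, hv⟩

lemma IsMer.const (c : ℂ) : IsMer ι v (fun _ => c) :=
  IsMer.of_analytic (fun _ => analyticAt_const) (by simp)

lemma IsMer.add (hι : ∀ p, AnalyticAt ℂ ι p) (hf : IsMer ι v f) (hg : IsMer ι v g) :
    IsMer ι v (fun y => f y + g y) := by
  refine ⟨fun p => ?_, fun y c => by simp only [hf.2, hg.2]⟩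
  obtain ⟨g1, h1, hg1, hh1, hn1, he1⟩ := hf.1 p
  obtain ⟨g2, h2, hg2, hh2, hn2, he2⟩ := hg.1 p
  refine ⟨fun y => g1 y * h2 y + h1 y * g2 y, fun y => h1 y * h2 y, by fun_prop, by fun_prop,
    frequently_mul_ne_zero (hh1.comp (hι p)) (hh2.comp (hι p)) hn1 hn2, ?_⟩
  filter_upwards [he1, he2] with y hy1 hy2 hne
  have a1 := left_ne_zero_of_mul hne
  have a2 := right_ne_zero_of_mul hne
  rw [hy1 a1, hy2 a2, div_add_div _ _ a1 a2]

lemma IsMer.mul (hι : ∀ p, AnalyticAt ℂ ι p) (hf : IsMer ι v f) (hg : IsMer ι v g) :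
    IsMer ι v (fun y => f y * g y) := by
  refine ⟨fun p => ?_, fun y c => by simp only [hf.2, hg.2]⟩
  obtain ⟨g1, h1, hg1, hh1, hn1, he1⟩ := hf.1 p
  obtain ⟨g2, h2, hg2, hh2, hn2, he2⟩ := hg.1 p
  refine ⟨fun y => g1 y * g2 y, fun y => h1 y * h2 y, by fun_prop, by fun_prop,
    frequently_mul_ne_zero (hh1.comp (hι p)) (hh2.comp (hι p)) hn1 hn2, ?_⟩
  filter_upwards [he1, he2] with y hy1 hy2 hne
  rw [hy1 (left_ne_zero_of_mul hne), hy2 (right_ne_zero_of_mul hne), div_mul_div_comm]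

/-- The derivative of a meromorphic function in the direction `u` is meromorphic. -/
lemma IsMer.dirDeriv (hι : ∀ p, AnalyticAt ℂ ι p) (hf : IsMer ι v f) (u : F) :
    IsMer ι v (fun y => fderiv ℂ f y u) := by
  refine ⟨fun p => ?_, fun y c => ?_⟩
  · obtain ⟨g, h, hg, hh, hn, he⟩ := hf.1 p
    refine ⟨fun y => fderiv ℂ g y u * h y - g y * fderiv ℂ h y u, fun y => h y * h y, ?_, ?_,
      frequently_mul_ne_zero (hh.comp (hι p)) (hh.comp (hι p)) hn hn, ?_⟩
    · have h1 : AnalyticAt ℂ (fun y => fderiv ℂ g y u) (ι p) :=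
        ((ContinuousLinearMap.apply ℂ ℂ u).analyticAt _).fun_comp hg.fderiv
      have h2 : AnalyticAt ℂ (fun y => fderiv ℂ h y u) (ι p) :=
        ((ContinuousLinearMap.apply ℂ ℂ u).analyticAt _).fun_comp hh.fderiv
      fun_prop
    · fun_prop
    · filter_upwards [he.eventually_nhds, hg.eventually_analyticAt, hh.eventually_analyticAt]
        with y hy hgy hhy hne
      have h0 : h y ≠ 0 := left_ne_zero_of_mul hne
      have heq : f =ᶠ[𝓝 y] fun w => g w / h w := by
        filter_upwards [hy, hhy.continuousAt.eventually_ne h0] with w hw hw0 using hw hw0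
      rw [heq.fderiv_eq]
      have := (hgy.differentiableAt.hasFDerivAt.mul
        ((hasDerivAt_inv h0).comp_hasFDerivAt y hhy.differentiableAt.hasFDerivAt)).fderiv
      simp only [div_eq_mul_inv]
      refine (congrArg (fun L => L u) this).trans ?_
      simp
      field_simp
      ring
  · have : (fun w => f (w + c • v)) = f := funext fun w => hf.2 w c
    change fderiv ℂ f (y + c • v) u = fderiv ℂ f y u
    rw [← fderiv_comp_add_right, this]

lemma IsMer.dense_differentiable (hι : ∀ p, AnalyticAt ℂ ι p) (hf : IsMer ι v f) :
    Dense (interior {p : G | ∀ᶠ y in 𝓝 (ι p), DifferentiableAt ℂ f y}) := by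
  rw [dense_iff_closure_eq, Set.eq_univ_iff_forall]
  intro p
  obtain ⟨g, h, hg, hh, hn, he⟩ := hf.1 p
  rw [mem_closure_iff_frequently]
  have hc := (hι p).continuousAt
  have e1 := hc.eventually he.eventually_nhds
  have e2 := hc.eventually hg.eventually_analyticAt
  have e3 := hc.eventually hh.eventually_analyticAt
  refine (hn.and_eventually (e1.and (e2.and e3))).mono
    fun q hq => ?_
  obtain ⟨h0, hq1, hq2, hq3⟩ := hq
  have hfa : AnalyticAt ℂ f (ι q) := by
    refine (hq2.div hq3 h0).congr ?_
    filter_upwards [hq1, hq3.continuousAt.eventually_ne h0] with w hw hw0 using (hw hw0).symm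
  rw [mem_interior_iff_mem_nhds]
  have := (hι q).continuousAt.eventually hfa.eventually_analyticAt
  filter_upwards [this] with r hr
  exact hr.eventually_analyticAt.mono fun y hy => hy.differentiableAt

variable (ι v)

/-- The space of functions satisfying `IsMer`, before identification. -/
def merPre (hι : ∀ p, AnalyticAt ℂ ι p) : Submodule ℂ (F → ℂ) where
  carrier := {f | IsMer ι v f}
  zero_mem' := IsMer.const (v := v) 0
  add_mem' hf hg := IsMer.add hι hf hg
  smul_mem' c _ hf := (IsMer.const (v := v) c).mul hι hf

/-- Functions that are to be identified with zero. -/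
def merNull (hι : ∀ p, AnalyticAt ℂ ι p) : Submodule ℂ (merPre ι v hι) where
  carrier := {f | IsNull ι f.1}
  zero_mem' := isNull_zero ι
  add_mem' {f g} hf hg := isNull_of_two (k := fun y => f.1 y + g.1 y) hf hg fun p h1 h2 => by
    filter_upwards [h1, h2] with y h1 h2
    simp [h1, h2]
  smul_mem' c f hf := isNull_of_one (k := fun y => c * f.1 y) hf fun p h1 => by
    filter_upwards [h1] with y h1
    simp [h1]

/-- Meromorphic functions near `ι(G)` that are invariant under translations along `v`. -/
def Mer (hι : ∀ p, AnalyticAt ℂ ι p) : Type := merPre ι v hι ⧸ merNull ι v hι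

instance (hι : ∀ p, AnalyticAt ℂ ι p) : AddCommGroup (Mer ι v hι) :=
  Submodule.Quotient.addCommGroup (merNull ι v hι)

instance (hι : ∀ p, AnalyticAt ℂ ι p) : Module ℂ (Mer ι v hι) :=
  Submodule.Quotient.module (merNull ι v hι)

variable {ι v}

/-- The meromorphic function given by `f`. -/
def Mer.mk (hι : ∀ p, AnalyticAt ℂ ι p) : merPre ι v hι →ₗ[ℂ] Mer ι v hι :=
  (merNull ι v hι).mkQ

lemma Mer.mk_surjective (hι : ∀ p, AnalyticAt ℂ ι p) :
    Function.Surjective (Mer.mk (v := v) hι) :=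
  (merNull ι v hι).mkQ_surjective

lemma Mer.mk_eq_mk (hι : ∀ p, AnalyticAt ℂ ι p) (f g : merPre ι v hι) :
    Mer.mk hι f = Mer.mk hι g ↔ IsNull ι (f.1 - g.1) :=
  Submodule.Quotient.eq (merNull ι v hι)

/-- Linear maps from spaces of meromorphic functions, defined on representatives. -/
def Mer.lift (hι : ∀ p, AnalyticAt ℂ ι p) {M : Type*} [AddCommGroup M] [Module ℂ M]
    (Φ : merPre ι v hι →ₗ[ℂ] M) (h : ∀ f : merPre ι v hι, IsNull ι f.1 → Φ f = 0) :
    Mer ι v hι →ₗ[ℂ] M :=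
  (merNull ι v hι).liftQ Φ h

lemma Mer.lift_mk (hι : ∀ p, AnalyticAt ℂ ι p) {M : Type*} [AddCommGroup M] [Module ℂ M]
    (Φ : merPre ι v hι →ₗ[ℂ] M) (h : ∀ f : merPre ι v hι, IsNull ι f.1 → Φ f = 0)
    (f : merPre ι v hι) : Mer.lift hι Φ h (Mer.mk hι f) = Φ f :=
  rfl

lemma Mer.mk_eq_zero (hι : ∀ p, AnalyticAt ℂ ι p) {f : merPre ι v hι} (h : IsNull ι f.1) :
    Mer.mk hι f = 0 :=
  (Submodule.Quotient.mk_eq_zero (merNull ι v hι)).2 h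

/-- Multiplication by a meromorphic function. -/
def Mer.mulOp (hι : ∀ p, AnalyticAt ℂ ι p) (f : F → ℂ) (hf : IsMer ι v f) :
    Module.End ℂ (Mer ι v hι) :=
  Mer.lift hι
    { toFun := fun g => Mer.mk hι
        ⟨fun y => f y * g.1 y, hf.mul hι (show IsMer ι v g.1 from g.2)⟩
      map_add' := fun g h => by
        rw [← map_add]
        exact congrArg _ (Subtype.ext (funext fun y => mul_add _ _ _))
      map_smul' := fun c g => by
        rw [← map_smul]
        exact congrArg _ (Subtype.ext (funext fun y => mul_left_comm _ _ _)) }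
    (fun g hg => Mer.mk_eq_zero hι (isNull_of_one (k := fun y => f y * g.1 y) hg fun p h1 => by
      filter_upwards [h1] with y h1
      simp [h1]))

/-- The derivative in the direction `u`. -/
def Mer.derivOp (hι : ∀ p, AnalyticAt ℂ ι p) (u : F) : Module.End ℂ (Mer ι v hι) :=
  Mer.lift hι
    { toFun := fun g => Mer.mk hι
        ⟨fun y => fderiv ℂ g.1 y u, IsMer.dirDeriv hι (show IsMer ι v g.1 from g.2) u⟩
      map_add' := fun g h => by
        rw [← map_add, Mer.mk_eq_mk]
        have hg := IsMer.dense_differentiable hι (show IsMer ι v g.1 from g.2)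
        have hh := IsMer.dense_differentiable hι (show IsMer ι v h.1 from h.2)
        refine Dense.mono ?_ (Dense.inter_of_isOpen_left hg hh isOpen_interior)
        rw [← interior_inter]
        refine interior_mono fun p hp => ?_
        filter_upwards [hp.1, hp.2] with y h1 h2
        change fderiv ℂ (g.1 + h.1) y u - (fderiv ℂ g.1 y u + fderiv ℂ h.1 y u) = 0
        rw [fderiv_add h1 h2]
        simp
      map_smul' := fun c g => by
        rw [← map_smul]
        refine congrArg _ (Subtype.ext (funext fun y => ?_))
        change fderiv ℂ (c • g.1) y u = c * fderiv ℂ g.1 y u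
        rw [fderiv_const_smul_field]
        simp }
    (fun g hg => Mer.mk_eq_zero hι (by
      refine isNull_of_one (k := fun y => fderiv ℂ g.1 y u) hg fun p h1 => ?_
      filter_upwards [h1.eventually_nhds] with y h1
      have : g.1 =ᶠ[𝓝 y] fun _ => 0 := h1
      rw [this.fderiv_eq]
      simp))

end Meromorphic

end EllipticBethe

namespace EllipticBethe

/-- The space with coordinates `λ_1, …, λ_N`. -/
abbrev Cartan (N : ℕ) : Type := Fin N → ℂ

lemma id_analytic (N : ℕ) (p : Cartan N) : AnalyticAt ℂ (id : Cartan N → Cartan N) p :=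
  analyticAt_id

/-- The slice `{x} × ℂ^N` of the space with coordinates `x, λ_1, …, λ_N`. -/
def slice (N : ℕ) (x : ℂ) (p : Cartan N) : ℂ × Cartan N := (x, p)

lemma slice_analytic (N : ℕ) (x : ℂ) (p : Cartan N) : AnalyticAt ℂ (slice N x) p :=
  analyticAt_const.prod analyticAt_id

/-- Meromorphic functions of `λ_1, …, λ_N` that depend only on the differences
`λ_j - λ_l`, i.e. meromorphic functions on the Cartan subalgebra of `sl_N`. -/
abbrev MerLam (N : ℕ) : Type := Mer (id : Cartan N → Cartan N) (fun _ => 1) (id_analytic N)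

/-- Meromorphic functions of `x', λ_1, …, λ_N`, for `x'` near `x`, that can be restricted to
`x' = x` and depend on `λ` only through the differences `λ_j - λ_l`. -/
abbrev MerX (N : ℕ) (x : ℂ) : Type :=
  Mer (slice N x) ((0 : ℂ), fun _ => (1 : ℂ)) (slice_analytic N x)

/-- Restriction of a function of `x', λ` to `x' = x`. -/
def evalX (N : ℕ) (x : ℂ) : MerX N x →ₗ[ℂ] MerLam N :=
  Mer.lift (slice_analytic N x)
    { toFun := fun f => Mer.mk (id_analytic N) ⟨fun p => f.1 (slice N x p), by
        refine ⟨fun p => ?_, fun y c => ?_⟩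
        · obtain ⟨g, h, hg, hh, hn, he⟩ := f.2.1 p
          exact ⟨fun q => g (slice N x q), fun q => h (slice N x q),
            hg.comp (slice_analytic N x p), hh.comp (slice_analytic N x p), hn,
            (slice_analytic N x p).continuousAt.eventually he⟩
        · have := f.2.2 (slice N x y) c
          simpa [slice] using this⟩
      map_add' := fun _ _ => rfl
      map_smul' := fun _ _ => rfl }
    (fun f hf => Mer.mk_eq_zero _ (Dense.mono (interior_mono fun p hp =>
      (slice_analytic N x p).continuousAt.eventually (p := fun y => f.1 y = 0) hp) hf))

/-- A function of `λ`, seen as a function of `x', λ`. -/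
def constX (N : ℕ) (x : ℂ) : MerLam N →ₗ[ℂ] MerX N x :=
  Mer.lift (id_analytic N)
    { toFun := fun f => Mer.mk (slice_analytic N x) ⟨fun y => f.1 y.2, by
        refine ⟨fun p => ?_, fun y c => f.2.2 y.2 c⟩
        obtain ⟨g, h, hg, hh, hn, he⟩ := f.2.1 p
        have hs : AnalyticAt ℂ (fun y : ℂ × Cartan N => y.2) (slice N x p) := analyticAt_snd
        exact ⟨fun y => g y.2, fun y => h y.2, AnalyticAt.fun_comp hg hs,
          AnalyticAt.fun_comp hh hs, hn, hs.continuousAt.eventually he⟩⟩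
      map_add' := fun _ _ => rfl
      map_smul' := fun _ _ => rfl }
    (fun f hf => Mer.mk_eq_zero _ (Dense.mono (interior_mono fun p hp =>
      (continuousAt_snd (p := slice N x p)).eventually (p := fun y => f.1 y = 0) hp) hf))

/-! ### The coefficient functions are meromorphic -/

section Coefficients

variable {G F : Type} [NormedAddCommGroup G] [NormedSpace ℂ G]
  [NormedAddCommGroup F] [NormedSpace ℂ F]

lemma IsMer.comp_meromorphic {ι : G → F} {v : F} {l : F → ℂ} {r : ℂ → ℂ}
    (hr : ∀ w, MeromorphicAt r w) (hl : ∀ p, AnalyticAt ℂ l (ι p))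
    (hv : ∀ (y : F) (c : ℂ), l (y + c • v) = l y)
    (hn : ∀ p, ∃ᶠ q in 𝓝 p, l (ι q) ≠ l (ι p)) : IsMer ι v (fun y => r (l y)) := by
  refine ⟨fun p => ?_, fun y c => by simp only [hv]⟩
  obtain ⟨n, hna⟩ := hr (l (ι p))
  refine ⟨fun y => (l y - l (ι p)) ^ n * r (l y), fun y => (l y - l (ι p)) ^ n, ?_, ?_, ?_, ?_⟩
  · exact AnalyticAt.fun_comp (g := fun w => (w - l (ι p)) ^ n • r w) hna (hl p)
  · exact ((hl p).sub analyticAt_const).pow n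
  · exact (hn p).mono fun q hq => pow_ne_zero _ (sub_ne_zero.2 hq)
  · filter_upwards with y hy
    rw [mul_div_cancel_left₀ _ hy]

end Coefficients

lemma IsMer.comp_lam {N : ℕ} {r : ℂ → ℂ} (hr : ∀ w, MeromorphicAt r w) (j l : Fin N) :
    IsMer (id : Cartan N → Cartan N) (fun _ => 1) (fun p => r (p j - p l)) := by
  by_cases h : j = l
  · subst h
    simpa using IsMer.const (r 0)
  · refine IsMer.comp_meromorphic (l := fun p : Cartan N => p j - p l) hr (fun p => ?_)
      (fun y c => by simp) (fun p => ?_)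
    · have h1 : ∀ i, AnalyticAt ℂ (fun y : Cartan N => y i) (id p) := fun i =>
        (ContinuousLinearMap.proj (R := ℂ) (φ := fun _ : Fin N => ℂ) i).analyticAt _
      exact (h1 j).sub (h1 l)
    · have hc : Tendsto (fun t : ℂ => p + t • Pi.single j (1 : ℂ)) (𝓝[≠] 0) (𝓝 p) := by
        have : Continuous (fun t : ℂ => p + t • Pi.single j (1 : ℂ)) := by fun_prop
        simpa using (this.tendsto 0).mono_left nhdsWithin_le_nhds
      refine hc.frequently (Eventually.frequently ?_)
      filter_upwards [self_mem_nhdsWithin] with t ht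
      simpa [h, Ne.symm h] using ht

lemma IsMer.comp_lamX {N : ℕ} (x : ℂ) {r : ℂ → ℂ} (hr : ∀ w, MeromorphicAt r w) (j l : Fin N) :
    IsMer (slice N x) ((0 : ℂ), fun _ => (1 : ℂ)) (fun y => r (y.2 j - y.2 l)) := by
  refine ⟨fun p => ?_, fun y c => by simp⟩
  obtain ⟨g, h, hg, hh, hn, he⟩ := (IsMer.comp_lam (N := N) hr j l).1 p
  have hs : AnalyticAt ℂ (fun y : ℂ × Cartan N => y.2) (slice N x p) := analyticAt_snd
  exact ⟨fun y => g y.2, fun y => h y.2, AnalyticAt.fun_comp hg hs, AnalyticAt.fun_comp hh hs, hn,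
    hs.continuousAt.eventually he⟩

lemma theta_mer (τ : ℍ) (w : ℂ) : MeromorphicAt (theta τ) w := (theta_analyticAt τ w).meromorphicAt

lemma rho_mer (τ : ℍ) (w : ℂ) : MeromorphicAt (rho τ) w :=
  (theta_analyticAt τ w).deriv.meromorphicAt.div (theta_mer τ w)

lemma sigma_mer (τ : ℍ) (a w : ℂ) : MeromorphicAt (fun y => sigma τ a y) w := by
  have h1 : MeromorphicAt (fun y => theta τ (a + y)) w :=
    (AnalyticAt.fun_comp (theta_analyticAt τ (a + w)) (by fun_prop)).meromorphicAt
  exact h1.div ((MeromorphicAt.const _ _).mul (theta_mer τ w))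

lemma sigma_neg_mer (τ : ℍ) (a w : ℂ) : MeromorphicAt (fun y => sigma τ a (-y)) w := by
  have h1 : MeromorphicAt (fun y => theta τ (a + -y)) w :=
    (AnalyticAt.fun_comp (f := fun y : ℂ => a + -y) (theta_analyticAt τ (a + -w))
      (by fun_prop)).meromorphicAt
  have h2 : MeromorphicAt (fun y => theta τ (-y)) w :=
    (AnalyticAt.fun_comp (theta_analyticAt τ (-w)) (by fun_prop)).meromorphicAt
  exact h1.div ((MeromorphicAt.const _ _).mul h2)

lemma phi_mer (τ : ℍ) (w y : ℂ) : MeromorphicAt (fun t => phi τ t w) y := by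
  unfold phi
  split_ifs
  · exact (rho_mer τ y).deriv.neg
  · exact (sigma_neg_mer τ w y).deriv

/-- `λ ↦ σ(a, -λ_{jl})`. -/
lemma sigma_lam (N : ℕ) (τ : ℍ) (a : ℂ) (j l : Fin N) :
    IsMer (id : Cartan N → Cartan N) (fun _ => 1) (fun p => sigma τ a (-(p j - p l))) :=
  IsMer.comp_lam (sigma_neg_mer τ a) j l

/-- `λ ↦ φ(λ_{jl}, a)`. -/
lemma phi_lam (N : ℕ) (τ : ℍ) (a : ℂ) (j l : Fin N) :
    IsMer (id : Cartan N → Cartan N) (fun _ => 1) (fun p => phi τ (p j - p l) a) :=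
  IsMer.comp_lam (fun w => phi_mer τ a w) j l

/-- The points of `ℂ` outside of all `z_k + ℤ + τ ℤ`. -/
abbrev Reg {n : ℕ} (τ : ℍ) (z : Fin n → ℂ) : Type := {x : ℂ // ∀ k, x - z k ∉ lattice τ}

/-- `(x, λ) ↦ ρ(x - a)`. -/
lemma rho_x (N : ℕ) (τ : ℍ) {x a : ℂ} (hx : x - a ∉ lattice τ) :
    IsMer (slice N x) ((0 : ℂ), fun _ => (1 : ℂ)) (fun y => rho τ (y.1 - a)) := by
  refine IsMer.of_analytic (fun p => ?_) (fun y c => by simp)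
  have hs : AnalyticAt ℂ (fun y : ℂ × Cartan N => y.1 - a) (slice N x p) :=
    analyticAt_fst.sub analyticAt_const
  have h : AnalyticAt ℂ (rho τ) (x - a) :=
    (theta_analyticAt τ _).deriv.div (theta_analyticAt τ _) (theta_ne_zero τ hx)
  exact AnalyticAt.fun_comp h hs

/-- `(x, λ) ↦ ρ(λ_{jl})`. -/
lemma rho_lamX (N : ℕ) (τ : ℍ) (x : ℂ) (j l : Fin N) :
    IsMer (slice N x) ((0 : ℂ), fun _ => (1 : ℂ)) (fun y => rho τ (y.2 j - y.2 l)) :=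
  IsMer.comp_lamX x (rho_mer τ) j l

/-- `(x, λ) ↦ σ(x - a, λ_{jl})`. -/
lemma sigma_x (N : ℕ) (τ : ℍ) {x a : ℂ} (hx : x - a ∉ lattice τ) (j l : Fin N) :
    IsMer (slice N x) ((0 : ℂ), fun _ => (1 : ℂ))
      (fun y => sigma τ (y.1 - a) (y.2 j - y.2 l)) := by
  have hs : ∀ p, AnalyticAt ℂ (fun y : ℂ × Cartan N => y.1 - a) (slice N x p) := fun p =>
    analyticAt_fst.sub analyticAt_const
  have h1 : IsMer (slice N x) ((0 : ℂ), fun _ => (1 : ℂ))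
      (fun y => theta τ (y.1 - a + (y.2 j - y.2 l))) := by
    refine IsMer.of_analytic (fun p => ?_) (fun y c => by simp)
    have h3 : ∀ i, AnalyticAt ℂ (fun y : ℂ × Cartan N => y.2 i) (slice N x p) := fun i =>
      AnalyticAt.fun_comp (g := fun y : Cartan N => y i)
        ((ContinuousLinearMap.proj (R := ℂ) (φ := fun _ : Fin N => ℂ) i).analyticAt _)
        analyticAt_snd
    exact AnalyticAt.fun_comp (theta_analyticAt τ _) ((hs p).add ((h3 j).sub (h3 l)))
  have h2 : IsMer (slice N x) ((0 : ℂ), fun _ => (1 : ℂ)) (fun y => (theta τ (y.1 - a))⁻¹) := by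
    refine IsMer.of_analytic (fun p => ?_) (fun y c => by simp)
    exact (AnalyticAt.fun_comp (theta_analyticAt τ _) (hs p)).inv (theta_ne_zero τ hx)
  have h3 : IsMer (slice N x) ((0 : ℂ), fun _ => (1 : ℂ))
      (fun y => (theta τ (y.2 j - y.2 l))⁻¹) :=
    IsMer.comp_lamX x (r := fun w => (theta τ w)⁻¹) (fun w => (theta_mer τ w).inv) j l
  have := (h1.mul (slice_analytic N x) h2).mul (slice_analytic N x) h3
  simpa only [sigma, div_eq_mul_inv, mul_inv, mul_assoc] using this

/-- `(x', λ) ↦ (x' - x) ^ k / k!`. -/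
lemma monomial_x (N : ℕ) (x : ℂ) (k : ℕ) :
    IsMer (slice N x) ((0 : ℂ), fun _ => (1 : ℂ))
      (fun y => (y.1 - x) ^ k / (k.factorial : ℂ)) := by
  refine IsMer.of_analytic (fun p => ?_) (fun y c => by simp)
  have h : AnalyticAt ℂ (fun y : ℂ × Cartan N => (y.1 - x) ^ k) (slice N x p) :=
    (analyticAt_fst.sub analyticAt_const).pow k
  exact h.div analyticAt_const (Nat.cast_ne_zero.2 k.factorial_ne_zero)

end EllipticBethe

namespace EllipticBethe

section Operators

universe u

variable {N n : ℕ} (V : Fin n → Type u) [∀ s, AddCommGroup (V s)] [∀ s, Module ℂ (V s)]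

/-- The operator `A^{(k)} = 1 ⊗ ⋯ ⊗ A ⊗ ⋯ ⊗ 1`, with `A` in the `k`-th factor. -/
def site (k : Fin n) (A : Module.End ℂ (V k)) : Module.End ℂ (⨂[ℂ] s, V s) :=
  PiTensorProduct.map (Function.update (fun s => (1 : Module.End ℂ (V s))) k A)

lemma site_mul_same (k : Fin n) (A B : Module.End ℂ (V k)) :
    site V k A * site V k B = site V k (A * B) := by
  unfold site
  rw [← PiTensorProduct.map_mul]
  congr 1
  funext s
  by_cases h : s = k
  · subst h; simp
  · simp [h]

lemma site_comm {k m : Fin n} (hkm : k ≠ m) (A : Module.End ℂ (V k)) (B : Module.End ℂ (V m)) :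
    site V k A * site V m B = site V m B * site V k A := by
  unfold site
  rw [← PiTensorProduct.map_mul, ← PiTensorProduct.map_mul]
  congr 1
  funext s
  by_cases h : s = k
  · subst h; simp [hkm]
  · simp [h]

lemma site_add (k : Fin n) (A B : Module.End ℂ (V k)) :
    site V k (A + B) = site V k A + site V k B :=
  PiTensorProduct.map_update_add _ _ _ _

lemma site_smul (k : Fin n) (c : ℂ) (A : Module.End ℂ (V k)) :
    site V k (c • A) = c • site V k A :=
  PiTensorProduct.map_update_smul _ _ _ _

variable [∀ s, LieRingModule (Matrix (Fin N) (Fin N) ℂ) (V s)]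
  [∀ s, LieModule ℂ (Matrix (Fin N) (Fin N) ℂ) (V s)]

/-- The action of the basis element `e_{jl}` of `gl_N` on the module `V_k`. -/
def gl (j l : Fin N) (k : Fin n) : Module.End ℂ (V k) :=
  LieModule.toEnd ℂ (Matrix (Fin N) (Fin N) ℂ) (V k) (Matrix.single j l 1)

/-- `e_{jl}^{(k)}`, acting on `V = V_1 ⊗ ⋯ ⊗ V_n`. -/
def e (j l : Fin N) (k : Fin n) : Module.End ℂ (⨂[ℂ] s, V s) := site V k (gl V j l k)

/-- The action of `e_{jj}` on `V`, i.e. `e_{jj}^{(1)} + ⋯ + e_{jj}^{(n)}`. -/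
def eTot (j : Fin N) : Module.End ℂ (⨂[ℂ] s, V s) := ∑ k, e V j j k

/-- `c_2^{(k)}`, for the quadratic central element
`c_2 = ∑_{j < l} (e_{jj} e_{ll} - e_{jl} e_{lj} + e_{jj})`. -/
def casimir (N : ℕ) {n : ℕ} (V : Fin n → Type u) [∀ s, AddCommGroup (V s)] [∀ s, Module ℂ (V s)]
    [∀ s, LieRingModule (Matrix (Fin N) (Fin N) ℂ) (V s)]
    [∀ s, LieModule ℂ (Matrix (Fin N) (Fin N) ℂ) (V s)] (k : Fin n) :
    Module.End ℂ (⨂[ℂ] s, V s) :=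
  site V k (∑ j : Fin N, ∑ l ∈ Finset.univ.filter (fun l => j < l),
    (gl V j j k * gl V l l k - gl V j l k * gl V l j k + gl V j j k))

/-- `Ω_{jl}^{(s,p)} = e_{jl}^{(s)} e_{lj}^{(p)}`; for `s = p` this is `(e_{jl} e_{lj})^{(s)}`. -/
def Om (j l : Fin N) (s p : Fin n) : Module.End ℂ (⨂[ℂ] s, V s) := e V j l s * e V l j p

/-- `Ω_0^{(s,p)} = ∑_k e_{kk}^{(s)} e_{kk}^{(p)}`. -/
def Om0 (N : ℕ) {n : ℕ} (V : Fin n → Type u) [∀ s, AddCommGroup (V s)] [∀ s, Module ℂ (V s)]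
    [∀ s, LieRingModule (Matrix (Fin N) (Fin N) ℂ) (V s)]
    [∀ s, LieModule ℂ (Matrix (Fin N) (Fin N) ℂ) (V s)] (s p : Fin n) :
    Module.End ℂ (⨂[ℂ] s, V s) :=
  ∑ k : Fin N, Om V k k s p

/-! ### The RST operator -/

/-- The entries `L_{jl}` of the matrix `L(x)`, acting on `V`-valued functions of `x, λ`:
`L_{jj} = ∑_k ρ(x - z_k) e_{jj}^{(k)} + ∑_{l ≠ j} ρ(λ_{jl}) e_{ll}`, and, for `j ≠ l`,
`L_{jl} = ∑_k σ(x - z_k, λ_{lj}) e_{lj}^{(k)}`. -/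
def Lmat (τ : ℍ) (z : Fin n → ℂ) (x : Reg τ z) (j l : Fin N) :
    Module.End ℂ (MerX N x.1 ⊗[ℂ] (⨂[ℂ] s, V s)) :=
  if j = l then
    (∑ k, TensorProduct.map (Mer.mulOp _ _ (rho_x N τ (x.2 k))) (e V j j k)) +
      ∑ m ∈ Finset.univ.filter (fun m => m ≠ j),
        TensorProduct.map (Mer.mulOp _ _ (rho_lamX N τ x.1 j m)) (eTot V m)
  else ∑ k, TensorProduct.map (Mer.mulOp _ _ (sigma_x N τ (x.2 k) l j)) (e V l j k)

/-- The entries `δ_{jl} ∂_x - δ_{jl} ∂_{λ_j} + L_{jl}`. -/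
def Xmat (τ : ℍ) (z : Fin n → ℂ) (x : Reg τ z) (j l : Fin N) :
    Module.End ℂ (MerX N x.1 ⊗[ℂ] (⨂[ℂ] s, V s)) :=
  (if j = l then
    (Mer.derivOp (slice_analytic N x.1) ((1 : ℂ), (0 : Cartan N)) -
      Mer.derivOp (slice_analytic N x.1) ((0 : ℂ), (Pi.single j 1 : Cartan N))).rTensor
        (⨂[ℂ] s, V s)
  else 0) + Lmat V τ z x j l

/-- The column determinant `∑_σ sign(σ) X_{σ(1),1} X_{σ(2),2} ⋯ X_{σ(N),N}`. -/
def cdet {R : Type*} [Ring R] (X : Fin N → Fin N → R) : R :=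
  ∑ π : Equiv.Perm (Fin N),
    (Equiv.Perm.sign π : ℤ) • ((List.finRange N).map fun m => X (π m) m).prod

/-- The RST operator `D`, acting on `V`-valued functions of `x', λ`, for `x'` near `x`. -/
def rst (τ : ℍ) (z : Fin n → ℂ) (x : Reg τ z) :
    Module.End ℂ (MerX N x.1 ⊗[ℂ] (⨂[ℂ] s, V s)) :=
  cdet (Xmat V τ z x)

/-- The value at `x` of the coefficient of `∂_x ^ k` in the differential operator `D`. It is
obtained from `D = ∑_i A_i(x') ∂_{x'} ^ i` as the value at `x' = x` of
`D ((x' - x) ^ k / k! · ψ)`, with `ψ` a function of `λ` only. -/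
def rstCoeffAux (τ : ℍ) (z : Fin n → ℂ) (x : Reg τ z) (k : ℕ) :
    Module.End ℂ (MerLam N ⊗[ℂ] (⨂[ℂ] s, V s)) :=
  (evalX N x.1).rTensor _ ∘ₗ rst V τ z x ∘ₗ
    (Mer.mulOp _ _ (monomial_x N x.1 k)).rTensor _ ∘ₗ (constX N x.1).rTensor _

/-! ### The KZB operators -/

/-- `H_0 = (1 / 4πi) ∑_k ∂_{λ_k}^2 + (1 / 4πi) ∑_{s,p} [(1/2) η(z_s - z_p) Ω_0^{(s,p)}
- ∑_{j ≠ l} φ(λ_{jl}, z_s - z_p) Ω_{jl}^{(s,p)}]`. -/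
def kzbZeroAux (τ : ℍ) (z : Fin n → ℂ) :
    Module.End ℂ (MerLam N ⊗[ℂ] (⨂[ℂ] s, V s)) :=
  (1 / (4 * Real.pi * Complex.I) : ℂ) •
      (∑ k : Fin N, (Mer.derivOp (id_analytic N) (Pi.single k 1 : Cartan N) ^ 2).rTensor _) +
    (1 / (4 * Real.pi * Complex.I) : ℂ) • ∑ s, ∑ p,
      ((1 / 2 * eta τ (z s - z p)) • (Om0 N V s p).lTensor _ -
        ∑ j : Fin N, ∑ l ∈ Finset.univ.filter (fun l => l ≠ j),
          TensorProduct.map (Mer.mulOp _ _ (phi_lam N τ (z s - z p) j l)) (Om V j l s p))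

/-- `H_s = -∑_k e_{kk}^{(s)} ∂_{λ_k} + ∑_{p ≠ s} [ρ(z_s - z_p) Ω_0^{(s,p)}
+ ∑_{j ≠ l} σ(z_s - z_p, -λ_{jl}) Ω_{jl}^{(s,p)}]`, for `s = 1, …, n`. -/
def kzbAux (τ : ℍ) (z : Fin n → ℂ) (s : Fin n) :
    Module.End ℂ (MerLam N ⊗[ℂ] (⨂[ℂ] s, V s)) :=
  -(∑ k : Fin N, TensorProduct.map
      (Mer.derivOp (id_analytic N) (Pi.single k 1 : Cartan N)) (e V k k s)) +
    ∑ p ∈ Finset.univ.filter (fun p => p ≠ s),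
      (rho τ (z s - z p) • (Om0 N V s p).lTensor _ +
        ∑ j : Fin N, ∑ l ∈ Finset.univ.filter (fun l => l ≠ j),
          TensorProduct.map (Mer.mulOp _ _ (sigma_lam N τ (z s - z p) j l)) (Om V j l s p))

/-! ### The zero weight subspace is preserved -/

/-- `V[0]`-valued meromorphic functions on the Cartan subalgebra of `sl_N`: the functions with
values in `V` that are annihilated by all `e_{jj}`. Here the space of `V`-valued meromorphic
functions is `MerLam N ⊗ V`, with `f ⊗ v` standing for the function `λ ↦ f(λ) v`. -/
def FunZero (N : ℕ) {n : ℕ} (V : Fin n → Type u) [∀ s, AddCommGroup (V s)]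
    [∀ s, Module ℂ (V s)] [∀ s, LieRingModule (Matrix (Fin N) (Fin N) ℂ) (V s)]
    [∀ s, LieModule ℂ (Matrix (Fin N) (Fin N) ℂ) (V s)] :
    Submodule ℂ (MerLam N ⊗[ℂ] (⨂[ℂ] s, V s)) :=
  ⨅ j : Fin N, LinearMap.ker ((eTot V j).lTensor (MerLam N))

/-- `T` has weight `w`: `[e_{ii}, T] = w_i T` for all `i`. -/
def HasWt {M : Type} [AddCommGroup M] [Module ℂ M] (w : Fin N → ℂ)
    (T : Module.End ℂ (M ⊗[ℂ] (⨂[ℂ] s, V s))) : Prop :=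
  ∀ i, (eTot V i).lTensor M * T = T * (eTot V i).lTensor M + w i • T

section Weights

variable {V} {M : Type} [AddCommGroup M] [Module ℂ M] {w w' : Fin N → ℂ}
  {S T : Module.End ℂ (M ⊗[ℂ] (⨂[ℂ] s, V s))}

lemma HasWt.add (hS : HasWt V w S) (hT : HasWt V w T) : HasWt V w (S + T) := fun i => by
  rw [mul_add, hS i, hT i, add_mul, smul_add]; abel

lemma HasWt.zero : HasWt V w (0 : Module.End ℂ (M ⊗[ℂ] (⨂[ℂ] s, V s))) := fun i => by simp

lemma HasWt.smul (c : ℂ) (hT : HasWt V w T) : HasWt V w (c • T) := fun i => by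
  rw [mul_smul_comm, hT i, smul_mul_assoc, smul_add, smul_comm c]

lemma HasWt.neg (hT : HasWt V w T) : HasWt V w (-T) := by
  have h : -T = (-1 : ℂ) • T := LinearMap.ext fun y => (neg_one_smul ℂ (T y)).symm
  rw [h]
  exact hT.smul (-1)

lemma HasWt.sub (hS : HasWt V w S) (hT : HasWt V w T) : HasWt V w (S - T) := by
  rw [sub_eq_add_neg]; exact hS.add hT.neg

lemma HasWt.sum {ι : Type*} (s : Finset ι) {f : ι → Module.End ℂ (M ⊗[ℂ] (⨂[ℂ] s, V s))}
    (h : ∀ i ∈ s, HasWt V w (f i)) : HasWt V w (∑ i ∈ s, f i) :=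
  Finset.sum_induction f (HasWt V w) (fun _ _ => HasWt.add) HasWt.zero h

lemma HasWt.mul (hS : HasWt V w S) (hT : HasWt V w' T) : HasWt V (w + w') (S * T) := fun i => by
  rw [← mul_assoc, hS i, add_mul, mul_assoc, hT i, mul_add, smul_mul_assoc, mul_smul_comm,
    Pi.add_apply, add_smul, mul_assoc]
  abel

lemma HasWt.one : HasWt V (0 : Fin N → ℂ) (1 : Module.End ℂ (M ⊗[ℂ] (⨂[ℂ] s, V s))) := fun i => by simp

lemma HasWt.of_map (f : Module.End ℂ M) {A : Module.End ℂ (⨂[ℂ] s, V s)}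
    (hA : ∀ i, eTot V i * A = A * eTot V i + w i • A) : HasWt V w (TensorProduct.map f A) := by
  intro i
  change (TensorProduct.map LinearMap.id (eTot V i)) ∘ₗ TensorProduct.map f A =
    TensorProduct.map f A ∘ₗ (TensorProduct.map LinearMap.id (eTot V i)) + _
  have h : eTot V i ∘ₗ A = A ∘ₗ eTot V i + w i • A := hA i
  rw [← TensorProduct.map_comp, ← TensorProduct.map_comp, ← TensorProduct.map_smul_right, h,
    TensorProduct.map_add_right]
  rfl

lemma HasWt.rTensor (f : Module.End ℂ M) : HasWt V (0 : Fin N → ℂ) (f.rTensor (⨂[ℂ] s, V s)) :=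
  HasWt.of_map (A := LinearMap.id) f fun i => by
    change eTot V i * 1 = 1 * eTot V i + _
    simp

lemma HasWt.lTensor {A : Module.End ℂ (⨂[ℂ] s, V s)}
    (hA : ∀ i, eTot V i * A = A * eTot V i + w i • A) : HasWt V w (A.lTensor M) :=
  HasWt.of_map LinearMap.id hA

variable (V) in
/-- The weight of `e_{jl}`. -/
lemma eTot_mul_e (i j l : Fin N) (k : Fin n) :
    eTot V i * e V j l k = e V j l k * eTot V i +
      ((if i = j then 1 else 0) - (if i = l then 1 else 0) : ℂ) • e V j l k := by
  have hcomm : gl V i i k * gl V j l k = gl V j l k * gl V i i k +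
      ((if i = j then 1 else 0) - (if i = l then 1 else 0) : ℂ) • gl V j l k := by
    have h1 : gl V i i k * gl V j l k - gl V j l k * gl V i i k =
        LieModule.toEnd ℂ (Matrix (Fin N) (Fin N) ℂ) (V k)
          ⁅Matrix.single i i (1 : ℂ), Matrix.single j l (1 : ℂ)⁆ := by
      rw [LieHom.map_lie]; rfl
    have h2 : ⁅Matrix.single i i (1 : ℂ), Matrix.single j l (1 : ℂ)⁆ =
        ((if i = j then 1 else 0) - (if i = l then 1 else 0) : ℂ) • Matrix.single j l (1 : ℂ) := by
      rw [Ring.lie_def, sub_smul]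
      congr 1
      · by_cases h : i = j
        · subst h; simp
        · simp [h]
      · by_cases h : i = l
        · subst h; simp
        · simp [h, Ne.symm h]
    rw [h2, map_smul] at h1
    rw [← sub_eq_iff_eq_add', h1]
    rfl
  have hs : ∀ m, e V i i m * e V j l k = e V j l k * e V i i m +
      (if m = k then ((if i = j then 1 else 0) - (if i = l then 1 else 0) : ℂ) • e V j l k
        else 0) := by
    intro m
    by_cases h : m = k
    · subst h
      rw [if_pos rfl]
      unfold e
      rw [site_mul_same, hcomm, site_add, site_smul, site_mul_same]
    · rw [if_neg h, add_zero]
      exact site_comm V h _ _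
  unfold eTot
  rw [Finset.sum_mul, Finset.sum_congr rfl fun m _ => hs m, Finset.sum_add_distrib,
    ← Finset.mul_sum]
  simp

lemma eTot_mul_wtZero {A : Module.End ℂ (⨂[ℂ] s, V s)} {i : Fin N}
    (h : eTot V i * A = A * eTot V i) :
    eTot V i * A = A * eTot V i + (0 : Fin N → ℂ) i • A := by simp [h]

variable (V) in
lemma eTot_comm_e (i j : Fin N) (k : Fin n) : eTot V i * e V j j k = e V j j k * eTot V i := by
  have := eTot_mul_e V i j j k
  simpa using this

variable (V) in
lemma eTot_comm_eTot (i j : Fin N) : eTot V i * eTot V j = eTot V j * eTot V i := by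
  conv_lhs => rw [eTot.eq_1 V j]
  conv_rhs => rw [eTot.eq_1 V j]
  rw [Finset.mul_sum, Finset.sum_mul]
  exact Finset.sum_congr rfl fun k _ => eTot_comm_e V i j k

variable (V) in
lemma eTot_comm_Om (i j l : Fin N) (s p : Fin n) :
    eTot V i * Om V j l s p = Om V j l s p * eTot V i := by
  unfold Om
  rw [← mul_assoc, eTot_mul_e, add_mul, mul_assoc, eTot_mul_e, mul_add, mul_assoc,
    smul_mul_assoc, mul_smul_comm, add_assoc, ← add_smul]
  simp

variable (V) in
lemma eTot_comm_Om0 (i : Fin N) (s p : Fin n) :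
    eTot V i * Om0 N V s p = Om0 N V s p * eTot V i := by
  unfold Om0
  rw [Finset.mul_sum, Finset.sum_mul]
  exact Finset.sum_congr rfl fun k _ => eTot_comm_Om V i k k s p

lemma HasWt.mapsTo {T : Module.End ℂ (MerLam N ⊗[ℂ] (⨂[ℂ] s, V s))} (hT : HasWt V (0 : Fin N → ℂ) T) :
    ∀ ψ ∈ FunZero N V, T ψ ∈ FunZero N V := by
  intro ψ hψ
  simp only [FunZero, Submodule.mem_iInf, LinearMap.mem_ker] at hψ ⊢
  intro i
  have h := LinearMap.congr_fun (hT i) ψ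
  simpa [hψ i] using h

end Weights

lemma Xmat_wt (τ : ℍ) (z : Fin n → ℂ) (x : Reg τ z) (j l : Fin N) :
    HasWt V (fun i => (if i = l then 1 else 0) - (if i = j then 1 else 0)) (Xmat V τ z x j l) := by
  unfold Xmat Lmat
  by_cases h : j = l
  · subst h
    have h0 : (fun i : Fin N => ((if i = j then 1 else 0) - (if i = j then 1 else 0) : ℂ)) = 0 := by
      funext i; simp
    rw [h0, if_pos rfl, if_pos rfl]
    exact (HasWt.rTensor _).add ((HasWt.sum _ fun k _ => HasWt.of_map _ fun i =>
      eTot_mul_wtZero (eTot_comm_e V i j k)).add (HasWt.sum _ fun m _ => HasWt.of_map _ fun i =>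
        eTot_mul_wtZero (eTot_comm_eTot V i m)))
  · rw [if_neg h, if_neg h, zero_add]
    exact HasWt.sum _ fun k _ => HasWt.of_map _ fun i => eTot_mul_e V i l j k

lemma rst_wt (τ : ℍ) (z : Fin n → ℂ) (x : Reg τ z) : HasWt V (0 : Fin N → ℂ) (rst (N := N) V τ z x) := by
  unfold rst cdet
  refine HasWt.sum _ fun π _ => ?_
  have hlist : ∀ L : List (Fin N), HasWt V
      (L.map fun m => (fun i => ((if i = m then 1 else 0) - (if i = π m then 1 else 0) : ℂ))).sum
      (L.map fun m => Xmat V τ z x (π m) m).prod := by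
    intro L
    induction L with
    | nil => exact HasWt.one
    | cons a L ih => exact (Xmat_wt V τ z x (π a) a).mul ih
  have h := hlist (List.finRange N)
  rw [← Fin.sum_univ_def] at h
  have h0 : (∑ m : Fin N, fun i : Fin N =>
      ((if i = m then 1 else 0) - (if i = π m then 1 else 0) : ℂ)) = 0 := by
    funext i
    rw [Finset.sum_apply, Finset.sum_sub_distrib]
    rw [Equiv.sum_comp π (fun m => if i = m then (1 : ℂ) else 0)]
    simp
  rw [h0] at h
  rcases Int.units_eq_one_or (Equiv.Perm.sign π) with hs | hs
  · rw [hs, Units.val_one, one_smul]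
    exact h
  · rw [hs, Units.val_neg, Units.val_one]
    convert h.neg using 1
    exact neg_one_zsmul _

lemma rstCoeff_mapsTo (τ : ℍ) (z : Fin n → ℂ) (x : Reg τ z) (k : ℕ) :
    ∀ ψ ∈ FunZero N V, rstCoeffAux V τ z x k ψ ∈ FunZero N V := by
  intro ψ hψ
  simp only [FunZero, Submodule.mem_iInf, LinearMap.mem_ker] at hψ ⊢
  intro i
  unfold rstCoeffAux
  set m : Module.End ℂ (MerX N x.1) := Mer.mulOp _ _ (monomial_x N x.1 k)
  have h1 : ∀ y : MerX N x.1 ⊗[ℂ] (⨂[ℂ] s, V s),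
      (eTot V i).lTensor _ ((evalX N x.1).rTensor _ y) =
        (evalX N x.1).rTensor _ ((eTot V i).lTensor _ y) := fun y => by
    rw [← LinearMap.comp_apply, ← LinearMap.comp_apply, LinearMap.lTensor_comp_rTensor,
      LinearMap.rTensor_comp_lTensor]
  have h2 : ∀ y : MerLam N ⊗[ℂ] (⨂[ℂ] s, V s),
      (eTot V i).lTensor _ (((m ∘ₗ constX N x.1)).rTensor _ y) =
        (m ∘ₗ constX N x.1).rTensor _ ((eTot V i).lTensor _ y) := fun y => by
    rw [← LinearMap.comp_apply, ← LinearMap.comp_apply, LinearMap.lTensor_comp_rTensor,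
      LinearMap.rTensor_comp_lTensor]
  have h3 := LinearMap.congr_fun (rst_wt V τ z x i) ((m ∘ₗ constX N x.1).rTensor _ ψ)
  rw [Pi.zero_apply, zero_smul, add_zero, Module.End.mul_apply, Module.End.mul_apply, h2, hψ i,
    map_zero, map_zero] at h3
  rw [← LinearMap.rTensor_comp, LinearMap.comp_apply, LinearMap.comp_apply, h1, h3, map_zero]

lemma kzbZero_mapsTo (τ : ℍ) (z : Fin n → ℂ) :
    ∀ ψ ∈ FunZero N V, kzbZeroAux V τ z ψ ∈ FunZero N V :=
  HasWt.mapsTo (((HasWt.sum _ fun _ _ => HasWt.rTensor _).smul _).add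
    (HasWt.smul _ (HasWt.sum _ fun s _ => HasWt.sum _ fun p _ =>
      ((HasWt.lTensor fun i => eTot_mul_wtZero (eTot_comm_Om0 V i s p)).smul _).sub
        (HasWt.sum _ fun j _ => HasWt.sum _ fun l _ => HasWt.of_map _ fun i =>
          eTot_mul_wtZero (eTot_comm_Om V i j l s p)))))

lemma kzb_mapsTo (τ : ℍ) (z : Fin n → ℂ) (s : Fin n) :
    ∀ ψ ∈ FunZero N V, kzbAux V τ z s ψ ∈ FunZero N V :=
  HasWt.mapsTo ((HasWt.neg (HasWt.sum _ fun k _ => HasWt.of_map _ fun i =>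
      eTot_mul_wtZero (eTot_comm_e V i k s))).add
    (HasWt.sum _ fun p _ =>
      ((HasWt.lTensor fun i => eTot_mul_wtZero (eTot_comm_Om0 V i s p)).smul _).add
        (HasWt.sum _ fun j _ => HasWt.sum _ fun l _ => HasWt.of_map _ fun i =>
          eTot_mul_wtZero (eTot_comm_Om V i j l s p))))

end Operators

end EllipticBethe

namespace EllipticBethe

section Final

universe u

variable (N : ℕ) {n : ℕ} (V : Fin n → Type u) [∀ s, AddCommGroup (V s)] [∀ s, Module ℂ (V s)]
  [∀ s, LieRingModule (Matrix (Fin N) (Fin N) ℂ) (V s)]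
  [∀ s, LieModule ℂ (Matrix (Fin N) (Fin N) ℂ) (V s)]

/-- `c_2^{(k)}` in terms of the operators `e_{jl}^{(k)}`. -/
lemma casimir_eq (k : Fin n) : casimir N V k =
    ∑ j : Fin N, ∑ l ∈ Finset.univ.filter (fun l => j < l),
      (e V j j k * e V l l k - e V j l k * e V l j k + e V j j k) := by
  let f : Module.End ℂ (V k) →ₗ[ℂ] Module.End ℂ (⨂[ℂ] s, V s) :=
    { toFun := site V k, map_add' := site_add V k, map_smul' := site_smul V k }
  change f _ = _
  simp only [map_sum, map_add, map_sub]
  refine Finset.sum_congr rfl fun j _ => Finset.sum_congr rfl fun l _ => ?_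
  unfold e
  rw [site_mul_same, site_mul_same]
  rfl

lemma casimir_mapsTo (s : Fin n) :
    ∀ ψ ∈ FunZero N V, (casimir N V s).lTensor (MerLam N) ψ ∈ FunZero N V := by
  refine HasWt.mapsTo (HasWt.lTensor fun i => eTot_mul_wtZero ?_)
  have h : ∀ j l, Commute (eTot V i) (e V j l s * e V l j s) := fun j l => eTot_comm_Om V i j l s s
  have h' : ∀ j, Commute (eTot V i) (e V j j s) := fun j => eTot_comm_e V i j s
  rw [casimir_eq]
  exact Commute.sum_right _ _ _ fun j _ => Commute.sum_right _ _ _ fun l _ =>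
    ((((h' j).mul_right (h' l)).sub_right (h j l)).add_right (h' j))

/-- The coefficient `S_j(x)` of `∂_x ^ (N - j)` in the RST operator
`D = ∂_x ^ N + ∑_j S_j(x) ∂_x ^ (N - j)`, for `0 ≤ j ≤ N`, as an operator on `V[0]`-valued
functions on the Cartan subalgebra of `sl_N`. -/
def rstCoeff (τ : ℍ) (z : Fin n → ℂ) (j : ℕ) (x : Reg τ z) : Module.End ℂ (FunZero N V) :=
  (rstCoeffAux V τ z x (N - j)).restrict (rstCoeff_mapsTo V τ z x (N - j))

/-- The KZB operator `H_0`. -/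
def kzbZero (τ : ℍ) (z : Fin n → ℂ) : Module.End ℂ (FunZero N V) :=
  (kzbZeroAux V τ z).restrict (kzbZero_mapsTo V τ z)

/-- The KZB operators `H_1, …, H_n`. -/
def kzb (τ : ℍ) (z : Fin n → ℂ) (s : Fin n) : Module.End ℂ (FunZero N V) :=
  (kzbAux V τ z s).restrict (kzb_mapsTo V τ z s)

/-- The operator `c_2^{(s)}` on `V[0]`-valued functions. -/
def casimirOp (s : Fin n) : Module.End ℂ (FunZero N V) :=
  ((casimir N V s).lTensor (MerLam N)).restrict (casimir_mapsTo N V s)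

/-- The dynamical elliptic Bethe algebra, generated by the identity and all `S_j(x)`. -/
def betheAlgebra (τ : ℍ) (z : Fin n → ℂ) : Subalgebra ℂ (Module.End ℂ (FunZero N V)) :=
  Algebra.adjoin ℂ {T | ∃ j ∈ Finset.Icc 1 N, ∃ x : Reg τ z, T = rstCoeff N V τ z j x}

end Final

end EllipticBethe
end

namespace EllipticBethe

/-! ### The theta function -/

/-! The first part is an expansion of one coefficient of a column determinant, followed by elliptic
function identities which make the answer linear in `ρ(x - z_s)`. Moving the divided powers `(x' -
x)^k / k!` through `D` shows that the coefficient of `∂_x^k` at `x` is the coefficient of `t^k` in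
`cdet(X + t)`, with `t` central, applied to functions constant in `x'` and then restricted to `x' =
x` (`rstCoeffAux_eq`). For `k = N - 2` only the identity and transpositions survive, and they give
`∑_{a<b} (X_aa X_bb - X_ba X_ab)`.

On zero-weight functions the terms `ρ(λ_jl) e_ll` vanish. The diagonal products then become `A_a A_b
+ ∑_s ρ'(x - z_s) e_bb^(s)`, where `A_a = -∂_{λ_a} + ∑_s ρ(x - z_s) e_aa^(s)`; the second term is
`∂_x` hitting the right-hand factor. The `A_a` commute, and they sum to zero because functions
depend only on differences of the `λ_j` and the identity matrix acts by zero. Hence `2 ∑_{a<b} A_a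
A_b = -∑_a A_a²`, which contains the Laplacian of `H_0`, the first-order parts of the `H_s`, and
quadratic terms `ρ(x - z_s) ρ(x - z_p) Ω_0`.

The products of `ρ`'s are linearized by `rho_mul_rho`, those of `σ`'s from the off-diagonal entries
by `sigma_mul_sigma` for `s ≠ p` and `sigma_mul_sigma_neg` for `s = p`. Zero weight removes the
remaining quadratic terms, and the terms with `ρ'(x - z_s)` collect into the central element `c_2`.
All three identities descend from `theta_addition`: as functions of `u`, its two sides have the same
multipliers under the lattice, and the left side vanishes at the simple zeros of the right, so by
Liouville their ratio is constant.

For the second part, `S_1 = 0` when `N = 2`, and Schur's lemma turns `c_2^(s)` into scalars. The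
modules may be infinite-dimensional, so Schur's lemma is proved by counting dimensions: an operator
with empty spectrum has uncountably many independent resolvent vectors, while an irreducible module
has countable dimension. Up to scalars, `S_2(x)` is then a combination of `H_0` and the `H_s` with
coefficients proportional to `1` and `ρ(x - z_s)`. These functions are linearly independent because
their poles lie at different points, so the `H`'s can be recovered from the values of `S_2`. -/

lemma qProd_eq_mul {q : ℂ} (hq : ‖q‖ < 1) (a : ℂ) :
    qProd a q = (1 - a) * qProd (a * q) q := by
  have hs : Summable (fun n : ℕ => ‖-(a * q * q ^ n)‖) := by
    simpa using (summable_geometric_of_lt_one (norm_nonneg _) hq).mul_left (‖a‖ * ‖q‖)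
  have hm := multipliable_one_add_of_summable hs
  simp only [← sub_eq_add_neg] at hm
  have h := tprod_eq_zero_mul' (f := fun n : ℕ => 1 - a * q ^ n)
    (by simpa only [pow_succ', ← mul_assoc] using hm)
  unfold qProd
  rw [h]
  simp only [pow_zero, mul_one, pow_succ', ← mul_assoc]

lemma theta_differentiable (τ : ℍ) : Differentiable ℂ (theta τ) := fun x =>
  (theta_analyticAt τ x).differentiableAt

lemma theta_deriv_differentiable (τ : ℍ) : Differentiable ℂ (deriv (theta τ)) := fun x =>
  (theta_analyticAt τ x).deriv.differentiableAt

lemma theta_neg (τ : ℍ) (x : ℂ) : theta τ (-x) = -theta τ x := by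
  unfold theta
  simp only [mul_neg, Complex.sin_neg, Complex.exp_neg, div_inv_eq_mul, ← div_eq_mul_inv]
  ring

lemma qProd_nome_ne_zero (τ : ℍ) : qProd (nome τ) (nome τ) ≠ 0 := by
  refine qProd_ne_zero (norm_nome_lt_one τ) fun n h => ?_
  rw [← pow_succ'] at h
  have h1 : ‖nome τ ^ (n + 1)‖ < 1 := by
    rw [norm_pow]; exact pow_lt_one₀ (norm_nonneg _) (norm_nome_lt_one τ) (by omega)
  rw [sub_eq_zero] at h
  rw [← h] at h1
  simp at h1

/-- The product formula for `θ` with the sine absorbed into the product. -/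
lemma theta_eq_qProd (τ : ℍ) (x : ℂ) :
    theta τ x = Complex.I / (2 * Real.pi) * Complex.exp (-(Real.pi * x * Complex.I)) *
      (qProd (Complex.exp (2 * Real.pi * Complex.I * x)) (nome τ) *
        qProd (nome τ / Complex.exp (2 * Real.pi * Complex.I * x)) (nome τ)) /
      qProd (nome τ) (nome τ) ^ 2 := by
  rw [qProd_eq_mul (norm_nome_lt_one τ) (Complex.exp (2 * Real.pi * Complex.I * x)), theta,
    Complex.sin, mul_comm (nome τ) (Complex.exp _)]
  have h : Complex.exp (2 * Real.pi * Complex.I * x) = Complex.exp (Real.pi * x * Complex.I) *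
      Complex.exp (Real.pi * x * Complex.I) := by
    rw [← Complex.exp_add]; ring_nf
  have h1 : Complex.exp (-(Real.pi * x * Complex.I)) * Complex.exp (Real.pi * x * Complex.I) = 1 := by
    rw [← Complex.exp_add]; simp
  rw [neg_mul]
  generalize qProd (Complex.exp (2 * Real.pi * Complex.I * x) * nome τ) (nome τ) = A
  generalize qProd (nome τ / Complex.exp (2 * Real.pi * Complex.I * x)) (nome τ) = B
  rw [h]
  linear_combination (A * B * Complex.I / (2 * Real.pi) / qProd (nome τ) (nome τ) ^ 2) *
    Complex.exp (Real.pi * x * Complex.I) * h1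

lemma theta_add_one (τ : ℍ) (x : ℂ) : theta τ (x + 1) = -theta τ x := by
  unfold theta
  have h : Complex.exp (2 * Real.pi * Complex.I * (x + 1)) =
      Complex.exp (2 * Real.pi * Complex.I * x) := by
    rw [mul_add, mul_one, Complex.exp_periodic]
  rw [h, mul_add, mul_one, Complex.sin_add_pi]
  ring

/-- Translation by `τ` multiplies `a = e^{2πix}` by `q`, which moves one factor from one infinite
product to the other. In the form `theta_eq_qProd` this exchange costs exactly `-a⁻¹`. -/
lemma theta_add_tau (τ : ℍ) (x : ℂ) : theta τ (x + τ) =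
    -Complex.exp (-(Real.pi * Complex.I * τ)) * Complex.exp (-(2 * Real.pi * Complex.I) * x) *
      theta τ x := by
  rw [theta_eq_qProd, theta_eq_qProd]
  have hq := norm_nome_lt_one τ
  have he : Complex.exp (2 * Real.pi * Complex.I * (x + τ)) =
      nome τ * Complex.exp (2 * Real.pi * Complex.I * x) := by
    rw [nome, ← Complex.exp_add]; ring_nf
  have hE : Complex.exp (-(Real.pi * (x + τ) * Complex.I)) =
      Complex.exp (-(Real.pi * Complex.I * τ)) * Complex.exp (-(Real.pi * x * Complex.I)) := by
    rw [← Complex.exp_add]; ring_nf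
  have hi : Complex.exp (-(2 * Real.pi * Complex.I) * x) =
      (Complex.exp (2 * Real.pi * Complex.I * x))⁻¹ := by
    rw [← Complex.exp_neg]; ring_nf
  have hn : nome τ ≠ 0 := Complex.exp_ne_zero _
  have h0 := Complex.exp_ne_zero (2 * Real.pi * Complex.I * x)
  rw [he, hE, hi, div_mul_cancel_left₀ hn]
  generalize Complex.exp (2 * Real.pi * Complex.I * x) = a at h0
  have key : qProd (nome τ * a) (nome τ) * qProd a⁻¹ (nome τ) =
      -a⁻¹ * (qProd a (nome τ) * qProd (nome τ / a) (nome τ)) := by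
    have h1 := qProd_eq_mul hq a
    have h2 := qProd_eq_mul hq a⁻¹
    rw [mul_comm a] at h1
    rw [inv_mul_eq_div] at h2
    by_cases ha : a = 1
    · subst ha
      simp only [sub_self, zero_mul, inv_one] at h1 h2 ⊢
      rw [h1]; ring
    · have h3 : (1 - a) ≠ 0 := sub_ne_zero.2 (Ne.symm ha)
      rw [h2, h1]
      field_simp
      ring
  rw [key]
  ring

/-- Periods whose multiplier has the form `c e^{dx}`, `c ≠ 0`, form an additive subgroup of `ℂ`; it
contains `1` and `τ`. The precise constants are never needed, only that the multiplier does not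
vanish and has constant logarithmic derivative. -/
lemma theta_add_lattice (τ : ℍ) {w : ℂ} (hw : w ∈ lattice τ) :
    ∃ c d : ℂ, c ≠ 0 ∧ ∀ x, theta τ (x + w) = c * Complex.exp (d * x) * theta τ x := by
  let P : ℂ → Prop := fun w =>
    ∃ c d : ℂ, c ≠ 0 ∧ ∀ x, theta τ (x + w) = c * Complex.exp (d * x) * theta τ x
  have hadd : ∀ a b, P a → P b → P (a + b) := by
    rintro a b ⟨c, d, hc, h⟩ ⟨c', d', hc', h'⟩
    refine ⟨c * c' * Complex.exp (d' * a), d + d', ?_, fun x => ?_⟩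
    · exact mul_ne_zero (mul_ne_zero hc hc') (Complex.exp_ne_zero _)
    · rw [← add_assoc, h', h, mul_add, add_mul, Complex.exp_add, Complex.exp_add]
      ring
  have hneg : ∀ a, P a → P (-a) := by
    rintro a ⟨c, d, hc, h⟩
    refine ⟨c⁻¹ * Complex.exp (d * a), -d, mul_ne_zero (inv_ne_zero hc) (Complex.exp_ne_zero _),
      fun x => ?_⟩
    have h1 := h (x + -a)
    rw [neg_add_cancel_right, mul_add, Complex.exp_add] at h1
    have h2 : Complex.exp (-d * x) * Complex.exp (d * x) = 1 := by
      rw [← Complex.exp_add]; simp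
    have h3 : Complex.exp (d * -a) * Complex.exp (d * a) = 1 := by
      rw [← Complex.exp_add]; simp
    rw [h1]
    calc theta τ (x + -a) = (c⁻¹ * c) * (Complex.exp (-d * x) * Complex.exp (d * x)) *
          (Complex.exp (d * -a) * Complex.exp (d * a)) * theta τ (x + -a) := by
            rw [h2, h3, inv_mul_cancel₀ hc]; ring
      _ = _ := by ring
  have hz : P 0 := ⟨1, 0, one_ne_zero, fun x => by simp⟩
  let S : AddSubgroup ℂ :=
    { carrier := {w | P w}
      add_mem' := fun {a b} => hadd a b
      zero_mem' := hz
      neg_mem' := fun {a} => hneg a }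
  have h1 : (1 : ℂ) ∈ S := ⟨-1, 0, by simp, fun x => by rw [theta_add_one]; simp⟩
  have hτ : (τ : ℂ) ∈ S := ⟨_, _, neg_ne_zero.2 (Complex.exp_ne_zero _), theta_add_tau τ⟩
  obtain ⟨k, l, rfl⟩ := hw
  have : (k : ℂ) + (l : ℂ) * τ ∈ S := by
    have := S.add_mem (S.zsmul_mem h1 k) (S.zsmul_mem hτ l)
    simpa using this
  exact this

lemma theta_zero (τ : ℍ) : theta τ 0 = 0 := by simp [theta]

lemma theta_deriv_zero (τ : ℍ) : deriv (theta τ) 0 = 1 := by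
  have hd := qProd_differentiable (norm_nome_lt_one τ)
  let G : ℂ → ℂ := fun x => qProd (nome τ * Complex.exp (2 * Real.pi * Complex.I * x)) (nome τ) *
    qProd (nome τ / Complex.exp (2 * Real.pi * Complex.I * x)) (nome τ) /
    qProd (nome τ) (nome τ) ^ 2
  have hG : Differentiable ℂ G := by
    have h1 : Differentiable ℂ (fun x : ℂ =>
        qProd (nome τ * Complex.exp (2 * Real.pi * Complex.I * x)) (nome τ)) :=
      hd.comp (f := fun x : ℂ => nome τ * Complex.exp (2 * Real.pi * Complex.I * x)) (by fun_prop)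
    have h2 : Differentiable ℂ (fun x : ℂ =>
        qProd (nome τ / Complex.exp (2 * Real.pi * Complex.I * x)) (nome τ)) :=
      hd.comp (f := fun x : ℂ => nome τ / Complex.exp (2 * Real.pi * Complex.I * x))
        (by refine Differentiable.div (by fun_prop) (by fun_prop) (fun x => Complex.exp_ne_zero _))
    fun_prop
  have hpi : (Real.pi : ℂ) ≠ 0 := by exact_mod_cast Real.pi_ne_zero
  have hG0 : G 0 = 1 := by
    have := qProd_nome_ne_zero τ
    simp only [G, mul_zero, Complex.exp_zero, mul_one, div_one]
    field_simp
  have heq : theta τ = fun x => Complex.sin (Real.pi * x) / Real.pi * G x := by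
    funext x; simp only [theta, G]; ring
  have hs : HasDerivAt (fun x : ℂ => Complex.sin (Real.pi * x) / Real.pi) 1 0 := by
    have := ((Complex.hasDerivAt_sin (Real.pi * 0)).comp (0 : ℂ)
      ((hasDerivAt_id (0 : ℂ)).const_mul (Real.pi : ℂ))).div_const (Real.pi : ℂ)
    simpa [hpi] using this
  rw [heq, (hs.fun_mul (hG 0).hasDerivAt).deriv, hG0]
  simp

lemma theta_eq_zero_iff (τ : ℍ) (w : ℂ) : theta τ w = 0 ↔ w ∈ lattice τ := by
  refine ⟨fun h => by_contra fun hw => theta_ne_zero τ hw h, fun hw => ?_⟩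
  obtain ⟨c, d, -, h⟩ := theta_add_lattice τ hw
  simpa [theta_zero] using h 0

/-- The simple zero at `0` is carried to every other zero by quasi-periodicity, because the
multiplier does not vanish. -/
lemma theta_deriv_ne_zero (τ : ℍ) {w : ℂ} (hw : theta τ w = 0) : deriv (theta τ) w ≠ 0 := by
  obtain ⟨c, d, hc, h⟩ := theta_add_lattice τ ((theta_eq_zero_iff τ w).1 hw)
  have h1 : HasDerivAt (fun x => theta τ (x + w)) (deriv (theta τ) (0 + w)) 0 :=
    HasDerivAt.comp_add_const (0 : ℂ) w (theta_differentiable τ (0 + w)).hasDerivAt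
  have he : HasDerivAt (fun x : ℂ => c * Complex.exp (d * x)) (c * (Complex.exp (d * 0) * (d * 1))) 0 :=
    ((((hasDerivAt_id (0 : ℂ)).const_mul d).cexp).const_mul c)
  have h2 := he.mul (theta_differentiable τ 0).hasDerivAt
  have h3 := h1.unique (h2.congr_of_eventuallyEq (Eventually.of_forall fun x => by simpa using h x))
  rw [zero_add, theta_zero, theta_deriv_zero] at h3
  rw [h3]
  simpa using hc

lemma theta_deriv_neg (τ : ℍ) (x : ℂ) : deriv (theta τ) (-x) = deriv (theta τ) x := by
  have h : (fun y => theta τ (-y)) = fun y => -theta τ y := funext (theta_neg τ)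
  have h1 := congrFun (congrArg deriv h) x
  rw [deriv_comp_neg, deriv.fun_neg] at h1
  exact neg_injective h1

lemma theta_deriv_deriv_neg (τ : ℍ) (x : ℂ) :
    deriv (deriv (theta τ)) (-x) = -deriv (deriv (theta τ)) x := by
  have h : (fun y => deriv (theta τ) (-y)) = fun y => deriv (theta τ) y :=
    funext (theta_deriv_neg τ)
  have h1 := congrFun (congrArg deriv h) x
  rw [deriv_comp_neg] at h1
  exact neg_eq_iff_eq_neg.1 h1

lemma theta_deriv_add_one (τ : ℍ) (x : ℂ) : deriv (theta τ) (x + 1) = -deriv (theta τ) x := by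
  have h : (fun y => theta τ (y + 1)) = fun y => -theta τ y := funext (theta_add_one τ)
  have h1 := congrFun (congrArg deriv h) x
  rwa [deriv_comp_add_const, deriv.fun_neg] at h1

lemma theta_deriv_add_tau (τ : ℍ) (x : ℂ) : deriv (theta τ) (x + τ) =
    -Complex.exp (-(Real.pi * Complex.I * τ)) * Complex.exp (-(2 * Real.pi * Complex.I) * x) *
      (deriv (theta τ) x - 2 * Real.pi * Complex.I * theta τ x) := by
  have h : (fun y => theta τ (y + τ)) = fun y => -Complex.exp (-(Real.pi * Complex.I * τ)) *
      Complex.exp (-(2 * Real.pi * Complex.I) * y) * theta τ y := funext (theta_add_tau τ)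
  have h1 := congrFun (congrArg deriv h) x
  rw [deriv_comp_add_const] at h1
  have he : HasDerivAt (fun y : ℂ => -Complex.exp (-(Real.pi * Complex.I * τ)) *
      Complex.exp (-(2 * Real.pi * Complex.I) * y)) (-Complex.exp (-(Real.pi * Complex.I * τ)) *
      (Complex.exp (-(2 * Real.pi * Complex.I) * x) * (-(2 * Real.pi * Complex.I) * 1))) x :=
    ((((hasDerivAt_id x).const_mul _).cexp).const_mul _)
  rw [h1, (he.fun_mul (theta_differentiable τ x).hasDerivAt).deriv]
  ring

lemma lattice_countable (τ : ℍ) : (lattice τ).Countable := by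
  have : lattice τ = Set.range (fun p : ℤ × ℤ => (p.1 : ℂ) + (p.2 : ℂ) * τ) := by
    ext w
    simp [lattice, eq_comm]
  rw [this]
  exact Set.countable_range _

lemma theta_ne_zero_isOpen (τ : ℍ) : IsOpen {w | theta τ w ≠ 0} :=
  isOpen_ne_fun (theta_differentiable τ).continuous continuous_const

lemma theta_ne_zero_dense (τ : ℍ) : Dense {w | theta τ w ≠ 0} := by
  have h : {w | theta τ w ≠ 0} = (lattice τ)ᶜ := by
    ext w; simp [theta_eq_zero_iff]
  rw [h]
  exact (lattice_countable τ).dense_compl ℝ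

end EllipticBethe
namespace EllipticBethe

/-! ### Elliptic functions without poles -/

/-- Liouville's theorem: every value is already taken on the compact parallelogram spanned by `1`
and `τ`, so `f` is bounded. -/
lemma differentiable_doubly_periodic_const (τ : ℍ) {f : ℂ → ℂ} (hf : Differentiable ℂ f)
    (h1 : Function.Periodic f 1) (h2 : Function.Periodic f τ) (x y : ℂ) : f x = f y := by
  refine hf.apply_eq_apply_of_bounded ?_ x y
  let K : Set ℂ := (fun p : ℝ × ℝ => (p.1 : ℂ) + (p.2 : ℂ) * τ) '' (Set.Icc 0 1 ×ˢ Set.Icc 0 1)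
  have hK : IsCompact K := (isCompact_Icc.prod isCompact_Icc).image (by fun_prop)
  refine (hK.image hf.continuous).isBounded.subset ?_
  rintro _ ⟨w, rfl⟩
  set t : ℝ := w.im / τ.im
  set s : ℝ := (w - t * τ).re
  have hw : w = s + t * τ := by
    apply Complex.ext
    · simp [s]
    · have := τ.im_pos.ne'
      simp [t, this]
  refine ⟨(Int.fract s : ℝ) + (Int.fract t : ℝ) * τ, ⟨(Int.fract s, Int.fract t),
    ⟨⟨Int.fract_nonneg _, (Int.fract_lt_one _).le⟩, ⟨Int.fract_nonneg _, (Int.fract_lt_one _).le⟩⟩,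
    rfl⟩, ?_⟩
  have h3 : w = ((Int.fract s : ℝ) + (Int.fract t : ℝ) * τ) + (⌊t⌋ : ℂ) * τ + (⌊s⌋ : ℂ) * 1 := by
    have hs : (s : ℂ) = (Int.fract s : ℝ) + (⌊s⌋ : ℂ) := by
      exact_mod_cast congrArg (fun r : ℝ => (r : ℂ)) (Int.fract_add_floor s).symm
    have ht : (t : ℂ) = (Int.fract t : ℝ) + (⌊t⌋ : ℂ) := by
      exact_mod_cast congrArg (fun r : ℝ => (r : ℂ)) (Int.fract_add_floor t).symm
    rw [hw]
    linear_combination hs + ht * τ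
  conv_rhs => rw [h3]
  rw [h1.int_mul ⌊s⌋, h2.int_mul ⌊t⌋]

/-- The quotient of two entire functions, extended to the simple zeros of the denominator. -/
lemma exists_entire_quotient {g h : ℂ → ℂ} (hg : Differentiable ℂ g) (hh : Differentiable ℂ h)
    (hz : ∀ w, h w = 0 → g w = 0 ∧ deriv h w ≠ 0) :
    ∃ Q : ℂ → ℂ, Differentiable ℂ Q ∧ ∀ w, g w = Q w * h w := by
  -- At a zero of `h` the value is the one given by l'Hôpital's rule. Near such a point the function
  -- is the quotient of the difference quotients `dslope g w` and `dslope h w`, whose denominator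
  -- does not vanish there.
  refine ⟨fun u => if h u = 0 then deriv g u / deriv h u else g u / h u, fun w => ?_, fun w => ?_⟩
  · by_cases hw : h w = 0
    · have hgs : Differentiable ℂ (dslope g w) := differentiableOn_univ.1
        ((Complex.differentiableOn_dslope univ_mem).2 hg.differentiableOn)
      have hhs : Differentiable ℂ (dslope h w) := differentiableOn_univ.1
        ((Complex.differentiableOn_dslope univ_mem).2 hh.differentiableOn)
      have h0 : dslope h w w ≠ 0 := by rw [dslope_same]; exact (hz w hw).2
      refine ((hgs w).div (hhs w) h0).congr_of_eventuallyEq ?_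
      filter_upwards [(hhs w).continuousAt.eventually_ne h0] with u hu
      by_cases huw : u = w
      · subst huw
        simp [hw]
      · have e1 := sub_smul_dslope_of_zero (hz w hw).1 u
        have e2 := sub_smul_dslope_of_zero hw u
        have hu' : h u ≠ 0 := by
          rw [← e2]; exact smul_ne_zero (sub_ne_zero.2 huw) hu
        rw [if_neg hu', ← e1, ← e2, smul_eq_mul, smul_eq_mul,
          mul_div_mul_left _ _ (sub_ne_zero.2 huw)]
        rfl
    · refine ((hg w).div (hh w) hw).congr_of_eventuallyEq ?_
      filter_upwards [(hh w).continuousAt.eventually_ne hw] with u hu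
      rw [if_neg hu]
      rfl
  · simp only
    split_ifs with hw
    · rw [hw, (hz w hw).1, mul_zero]
    · rw [div_mul_cancel₀ _ hw]

/-- Two entire functions with the same quasi-periods are proportional if the zeros of the second
are simple and are zeros of the first. -/
lemma exists_const_mul_of_quasiperiodic (τ : ℍ) {g h χ ξ : ℂ → ℂ} (hg : Differentiable ℂ g)
    (hh : Differentiable ℂ h) (hz : ∀ w, h w = 0 → g w = 0 ∧ deriv h w ≠ 0)
    (hd : Dense {w | h w ≠ 0}) (hχ : ∀ w, χ w ≠ 0) (hξ : ∀ w, ξ w ≠ 0)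
    (hg1 : ∀ w, g (w + 1) = χ w * g w) (hh1 : ∀ w, h (w + 1) = χ w * h w)
    (hg2 : ∀ w, g (w + τ) = ξ w * g w) (hh2 : ∀ w, h (w + τ) = ξ w * h w) :
    ∃ c, ∀ w, g w = c * h w := by
  obtain ⟨Q, hQ, hQh⟩ := exists_entire_quotient hg hh hz
  have hper : ∀ (a : ℂ) (ζ : ℂ → ℂ), (∀ w, ζ w ≠ 0) → (∀ w, g (w + a) = ζ w * g w) →
      (∀ w, h (w + a) = ζ w * h w) → Function.Periodic Q a := by
    intro a ζ hζ h1 h2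
    -- The common multiplier cancels only where `h` is nonzero; periodicity of `Q` extends from this
    -- dense set by continuity.
    refine congrFun (Continuous.ext_on hd (f := fun w => Q (w + a)) (g := Q)
      (hQ.continuous.comp (by fun_prop)) hQ.continuous fun w hw => ?_)
    have := h1 w
    rw [hQh, hQh, h2] at this
    have h3 : ζ w * h w ≠ 0 := mul_ne_zero (hζ w) hw
    refine mul_right_cancel₀ h3 (this.trans ?_)
    ring
  exact ⟨Q 0, fun w => by rw [hQh, differentiable_doubly_periodic_const τ hQ
    (hper 1 χ hχ hg1 hh1) (hper τ ξ hξ hg2 hh2) w 0]⟩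

/-! ### Addition theorems -/

/-- The zeros of `u ↦ θ(u + l) θ(v - u)` are simple for generic `v`, `l`. -/
lemma theta_mul_theta_simple (τ : ℍ) {v l : ℂ} (hvl : theta τ (v + l) ≠ 0) {u : ℂ}
    (hu : theta τ (u + l) * theta τ (v - u) = 0) :
    deriv (fun u => theta τ (u + l) * theta τ (v - u)) u ≠ 0 := by
  have hd := theta_differentiable τ
  have h1 : HasDerivAt (fun u => theta τ (u + l)) (deriv (theta τ) (u + l)) u :=
    HasDerivAt.comp_add_const u l (hd (u + l)).hasDerivAt
  have h2 : HasDerivAt (fun u => theta τ (v - u)) (-deriv (theta τ) (v - u)) u :=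
    HasDerivAt.comp_const_sub v u (hd (v - u)).hasDerivAt
  rw [(h1.fun_mul h2).deriv]
  rcases mul_eq_zero.1 hu with h | h
  -- If both factors vanished, `v + l = (u + l) + (v - u)` would be a sum of two lattice points,
  -- against the genericity of `v + l`.
  · have h3 : theta τ (v - u) ≠ 0 := by
      intro h'
      obtain ⟨c, d, -, hc⟩ := theta_add_lattice τ ((theta_eq_zero_iff τ _).1 h)
      have := hc (v - u)
      rw [h', mul_zero] at this
      exact hvl (by rw [← this]; ring_nf)
    rw [h, zero_mul, add_zero]
    exact mul_ne_zero (theta_deriv_ne_zero τ h) h3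
  · have h3 : theta τ (u + l) ≠ 0 := by
      intro h'
      obtain ⟨c, d, -, hc⟩ := theta_add_lattice τ ((theta_eq_zero_iff τ _).1 h)
      have := hc (u + l)
      rw [h', mul_zero] at this
      exact hvl (by rw [← this]; ring_nf)
    rw [h, mul_zero, zero_add]
    exact mul_ne_zero h3 (neg_ne_zero.2 (theta_deriv_ne_zero τ h))

lemma theta_sub_one (τ : ℍ) (x : ℂ) : theta τ (x - 1) = -theta τ x := by
  have := theta_add_one τ (x - 1)
  rw [sub_add_cancel] at this
  rw [this, neg_neg]

lemma theta_deriv_sub_one (τ : ℍ) (x : ℂ) : deriv (theta τ) (x - 1) = -deriv (theta τ) x := by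
  have := theta_deriv_add_one τ (x - 1)
  rw [sub_add_cancel] at this
  rw [this, neg_neg]

lemma theta_sub_tau (τ : ℍ) (x : ℂ) : theta τ (x - τ) =
    -Complex.exp (-(Real.pi * Complex.I * τ)) * Complex.exp (2 * Real.pi * Complex.I * x) *
      theta τ x := by
  have := theta_add_tau τ (-x)
  rw [show -x + (τ : ℂ) = -(x - τ) by ring, theta_neg, theta_neg, neg_mul_neg] at this
  rw [← neg_inj, this]
  ring

lemma theta_deriv_sub_tau (τ : ℍ) (x : ℂ) : deriv (theta τ) (x - τ) =
    -Complex.exp (-(Real.pi * Complex.I * τ)) * Complex.exp (2 * Real.pi * Complex.I * x) *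
      (deriv (theta τ) x + 2 * Real.pi * Complex.I * theta τ x) := by
  have := theta_deriv_add_tau τ (-x)
  rw [show -x + (τ : ℂ) = -(x - τ) by ring, theta_deriv_neg, theta_deriv_neg, neg_mul_neg,
    theta_neg] at this
  rw [this]
  ring

lemma theta_deriv_hasDerivAt (τ : ℍ) (x : ℂ) :
    HasDerivAt (deriv (theta τ)) (deriv (deriv (theta τ)) x) x :=
  (theta_deriv_differentiable τ x).hasDerivAt

lemma theta_hasDerivAt (τ : ℍ) (x : ℂ) : HasDerivAt (theta τ) (deriv (theta τ) x) x :=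
  (theta_differentiable τ x).hasDerivAt

lemma theta_ne_zero_dense_comp (τ : ℍ) (e : ℂ ≃ₜ ℂ) : Dense {u | theta τ (e u) ≠ 0} :=
  (theta_ne_zero_dense τ).preimage e.isOpenMap

lemma theta_ne_zero_isOpen_comp (τ : ℍ) (e : ℂ ≃ₜ ℂ) : IsOpen {u | theta τ (e u) ≠ 0} :=
  (theta_ne_zero_isOpen τ).preimage e.continuous

/-- The behaviour of `θ` and `θ'` under translations by the lattice. -/
lemma theta_add_lattice_deriv (τ : ℍ) {w : ℂ} (hw : theta τ w = 0) :
    ∃ d : ℂ, ∀ x, ∃ m : ℂ, theta τ (x + w) = m * theta τ x ∧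
      deriv (theta τ) (x + w) = m * (deriv (theta τ) x + d * theta τ x) := by
  obtain ⟨c, d, -, h⟩ := theta_add_lattice τ ((theta_eq_zero_iff τ w).1 hw)
  refine ⟨d, fun x => ⟨_, h x, ?_⟩⟩
  have h1 : HasDerivAt (fun y => theta τ (y + w)) (deriv (theta τ) (x + w)) x :=
    HasDerivAt.comp_add_const x w (theta_hasDerivAt τ (x + w))
  have he : HasDerivAt (fun y : ℂ => c * Complex.exp (d * y))
      (c * (Complex.exp (d * x) * (d * 1))) x :=
    ((((hasDerivAt_id x).const_mul d).cexp).const_mul c)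
  rw [h1.unique ((he.fun_mul (theta_hasDerivAt τ x)).congr_of_eventuallyEq
    (Eventually.of_forall h))]
  ring

/-- The addition theorem for four arguments `u`, `l`, `-v`, `v - u - l` with sum zero. -/
lemma theta_addition (τ : ℍ) (u v l : ℂ) :
    theta τ l * theta τ v * (deriv (theta τ) u * theta τ (v - u - l) +
        theta τ u * deriv (theta τ) (v - u - l)) +
      theta τ u * theta τ (v - u - l) *
        (deriv (theta τ) l * theta τ v - deriv (theta τ) v * theta τ l) =
    theta τ (v - l) * (theta τ (u + l) * theta τ (v - u)) := by
  have hdt := theta_differentiable τ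
  have hdt' := theta_deriv_differentiable τ
  -- For generic `v` and `l`, both sides are compared as functions of `u`. Genericity of `v + l`
  -- makes the zeros on the right simple, and `θ(v) θ(l) ≠ 0` permits the normalization at `u = 0`.
  have key : ∀ v l, theta τ v ≠ 0 → theta τ l ≠ 0 → theta τ (v + l) ≠ 0 →
    theta τ l * theta τ v * (deriv (theta τ) u * theta τ (v - u - l) +
        theta τ u * deriv (theta τ) (v - u - l)) +
      theta τ u * theta τ (v - u - l) *
        (deriv (theta τ) l * theta τ v - deriv (theta τ) v * theta τ l) =
    theta τ (v - l) * (theta τ (u + l) * theta τ (v - u)) := by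
    intro v l hv hl hvl
    set E := Complex.exp (-(Real.pi * Complex.I * τ))
    have hex : ∃ c, ∀ u, theta τ l * theta τ v * (deriv (theta τ) u * theta τ (v - u - l) +
        theta τ u * deriv (theta τ) (v - u - l)) +
        theta τ u * theta τ (v - u - l) *
        (deriv (theta τ) l * theta τ v - deriv (theta τ) v * theta τ l) =
        c * (theta τ (u + l) * theta τ (v - u)) := by
      refine exists_const_mul_of_quasiperiodic τ
        (h := fun u => theta τ (u + l) * theta τ (v - u)) (χ := fun _ => 1)
        (ξ := fun u => E * E * Complex.exp (-(2 * Real.pi * Complex.I) * (u + l)) *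
          Complex.exp (2 * Real.pi * Complex.I * (v - u)))
        (by fun_prop) (by fun_prop)
        (fun w hw => ⟨?_, theta_mul_theta_simple τ hvl hw⟩) ?_ (fun _ => one_ne_zero)
        (fun w => by simp [E, Complex.exp_ne_zero])
        (fun w => ?_) (fun w => ?_) (fun w => ?_) (fun w => ?_)
      -- At a zero of the right side, either `w` and `-l`, `v` and `v - w - l` differ by the lattice
      -- vector `w + l`, or `v - w - l` and `-l`, `v` and `w` differ by `v - w`. In each case both
      -- translations involve the same constant `d`, so the `d` terms cancel and the left side
      -- vanishes.
      · rcases mul_eq_zero.1 hw with h | h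
        · obtain ⟨d, hd⟩ := theta_add_lattice_deriv τ h
          obtain ⟨a, ha1, ha2⟩ := hd (-l)
          obtain ⟨b, hb1, hb2⟩ := hd (v - w - l)
          rw [show -l + (w + l) = w by ring, theta_neg] at ha1 ha2
          rw [theta_deriv_neg] at ha2
          rw [show v - w - l + (w + l) = v by ring] at hb1 hb2
          rw [ha1, ha2, hb1, hb2]
          ring
        · obtain ⟨d, hd⟩ := theta_add_lattice_deriv τ h
          obtain ⟨a, ha1, ha2⟩ := hd (-l)
          obtain ⟨b, hb1, hb2⟩ := hd w
          rw [show -l + (v - w) = v - w - l by ring, theta_neg] at ha1 ha2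
          rw [theta_deriv_neg] at ha2
          rw [show w + (v - w) = v by ring] at hb1 hb2
          rw [ha1, ha2, hb1, hb2]
          ring
      · have := (theta_ne_zero_dense_comp τ (Homeomorph.addRight l)).inter_of_isOpen_left
          (theta_ne_zero_dense_comp τ (Homeomorph.subLeft v))
          (theta_ne_zero_isOpen_comp τ _)
        exact this.mono fun u hu => mul_ne_zero hu.1 hu.2
      · simp only [show v - (w + 1) - l = v - w - l - 1 by ring, theta_add_one, theta_sub_one,
          theta_deriv_add_one, theta_deriv_sub_one]
        ring
      · simp only [show w + 1 + l = w + l + 1 by ring, show v - (w + 1) = v - w - 1 by ring,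
          theta_add_one, theta_sub_one]
        ring
      · have he : Complex.exp (-(2 * Real.pi * Complex.I) * (w + l)) *
            Complex.exp (2 * Real.pi * Complex.I * (v - w)) =
            Complex.exp (-(2 * Real.pi * Complex.I) * w) *
            Complex.exp (2 * Real.pi * Complex.I * (v - w - l)) := by
          rw [← Complex.exp_add, ← Complex.exp_add]; ring_nf
        rw [mul_assoc (E * E), he]
        simp only [show v - (w + (τ : ℂ)) - l = v - w - l - τ by ring, theta_add_tau, theta_sub_tau,
          theta_deriv_add_tau, theta_deriv_sub_tau]
        ring
      · simp only [show w + (τ : ℂ) + l = w + l + τ by ring,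
          show v - (w + (τ : ℂ)) = v - w - τ by ring, theta_add_tau, theta_sub_tau, E]
        ring
    obtain ⟨c, hc⟩ := hex
    -- The constant is read off at `u = 0`, where `θ = 0` and `θ' = 1` leave `θ(l) θ(v) θ(v - l) = c
    -- θ(l) θ(v)`.
    have h0 := hc 0
    simp only [theta_zero, theta_deriv_zero, sub_zero, zero_add, zero_mul, add_zero,
      one_mul] at h0
    have h1 : c = theta τ (v - l) := by
      have h2 : theta τ l * theta τ v ≠ 0 := mul_ne_zero hl hv
      apply mul_left_cancel₀ h2
      rw [h0]; ring
    rw [← h1]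
    exact hc u
  have hcont := hdt.continuous
  have hcont' := hdt'.continuous
  -- The genericity conditions are removed by continuity, first in `v` for fixed `l`, then in `l`.
  have key2 : ∀ l, theta τ l ≠ 0 → ∀ v,
    theta τ l * theta τ v * (deriv (theta τ) u * theta τ (v - u - l) +
        theta τ u * deriv (theta τ) (v - u - l)) +
      theta τ u * theta τ (v - u - l) *
        (deriv (theta τ) l * theta τ v - deriv (theta τ) v * theta τ l) =
    theta τ (v - l) * (theta τ (u + l) * theta τ (v - u)) := by
    intro l hl
    have hdense := (theta_ne_zero_dense_comp τ (Homeomorph.refl ℂ)).inter_of_isOpen_left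
        (theta_ne_zero_dense_comp τ (Homeomorph.addRight l)) (theta_ne_zero_isOpen_comp τ _)
    refine congrFun (Continuous.ext_on hdense ?_ ?_ fun v hv => key v l hv.1 hl hv.2)
    · fun_prop
    · fun_prop
  refine congrFun (Continuous.ext_on (theta_ne_zero_dense τ) ?_ ?_ fun l hl => key2 l hl v) l
  · fun_prop
  · fun_prop

lemma theta_deriv_deriv_hasDerivAt (τ : ℍ) (x : ℂ) :
    HasDerivAt (deriv (deriv (theta τ))) (deriv (deriv (deriv (theta τ))) x) x :=
  (theta_analyticAt τ x).deriv.deriv.differentiableAt.hasDerivAt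

/-- `θ(u + l) θ(u - l)` in terms of `θ² (log θ)''`. -/
lemma theta_mul_theta (τ : ℍ) (u l : ℂ) : theta τ (u + l) * theta τ (u - l) =
    theta τ l ^ 2 * (theta τ u * deriv (deriv (theta τ)) u - deriv (theta τ) u ^ 2) -
      theta τ u ^ 2 * (theta τ l * deriv (deriv (theta τ)) l - deriv (theta τ) l ^ 2) := by
  -- At `v = u` the factor `θ(v - u)` vanishes to first order, so the `v`-derivative of
  -- `theta_addition` there leaves `θ(u + l) θ(u - l)` on the right.
  have e0 := theta_hasDerivAt τ u
  have e1 := theta_deriv_hasDerivAt τ u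
  have e2 : HasDerivAt (fun v => theta τ (v - u - l)) (deriv (theta τ) (u - u - l)) u :=
    (theta_hasDerivAt τ (u - u - l)).comp_of_eq u
      (((hasDerivAt_id u).sub_const u).sub_const l) rfl |>.congr_deriv (mul_one _)
  have e3 : HasDerivAt (fun v => deriv (theta τ) (v - u - l))
      (deriv (deriv (theta τ)) (u - u - l)) u :=
    (theta_deriv_hasDerivAt τ (u - u - l)).comp_of_eq u
      (((hasDerivAt_id u).sub_const u).sub_const l) rfl |>.congr_deriv (mul_one _)
  have e4 : HasDerivAt (fun v => theta τ (v - l)) (deriv (theta τ) (u - l)) u :=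
    HasDerivAt.comp_sub_const u l (theta_hasDerivAt τ (u - l))
  have e5 : HasDerivAt (fun v => theta τ (v - u)) (deriv (theta τ) (u - u)) u :=
    HasDerivAt.comp_sub_const u u (theta_hasDerivAt τ (u - u))
  have h1 := ((e0.const_mul (theta τ l)).fun_mul
    ((e2.const_mul (deriv (theta τ) u)).fun_add (e3.const_mul (theta τ u)))).fun_add
    ((e2.const_mul (theta τ u)).fun_mul
      ((e0.const_mul (deriv (theta τ) l)).fun_sub (e1.mul_const (theta τ l))))
  have h2 := e4.fun_mul (e5.const_mul (theta τ (u + l)))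
  have h := h1.unique (h2.congr_of_eventuallyEq
    (Eventually.of_forall fun v => theta_addition τ u v l))
  simp only [sub_self, zero_sub, theta_neg, theta_deriv_neg, theta_deriv_deriv_neg, theta_zero,
    theta_deriv_zero] at h
  linear_combination -h

/-- The addition theorem for three arguments `u`, `-v`, `w` with sum zero. -/
lemma theta_addition_three (τ : ℍ) (u v w : ℂ) (hw : w = v - u) :
    deriv (deriv (theta τ)) u * theta τ v * theta τ w +
      theta τ u * deriv (deriv (theta τ)) v * theta τ w +
      theta τ u * theta τ v * deriv (deriv (theta τ)) w
      - 2 * deriv (theta τ) u * deriv (theta τ) v * theta τ w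
      + 2 * deriv (theta τ) u * theta τ v * deriv (theta τ) w
      - 2 * theta τ u * deriv (theta τ) v * deriv (theta τ) w =
    deriv (deriv (deriv (theta τ))) 0 * theta τ u * theta τ v * theta τ w := by
  have d0 := theta_hasDerivAt τ
  have d1 := theta_deriv_hasDerivAt τ
  have d2 := theta_deriv_deriv_hasDerivAt τ
  have a0 : ∀ l, HasDerivAt (fun l => theta τ (w - l)) (-deriv (theta τ) (w - l)) l :=
    fun l => HasDerivAt.comp_const_sub w l (d0 (w - l))
  have a1 : ∀ l, HasDerivAt (fun l => deriv (theta τ) (w - l))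
      (-deriv (deriv (theta τ)) (w - l)) l :=
    fun l => HasDerivAt.comp_const_sub w l (d1 (w - l))
  have a2 : ∀ l, HasDerivAt (fun l => deriv (deriv (theta τ)) (w - l))
      (-deriv (deriv (deriv (theta τ))) (w - l)) l :=
    fun l => HasDerivAt.comp_const_sub w l (d2 (w - l))
  have b0 : ∀ l, HasDerivAt (fun l => theta τ (v - l)) (-deriv (theta τ) (v - l)) l :=
    fun l => HasDerivAt.comp_const_sub v l (d0 (v - l))
  have b1 : ∀ l, HasDerivAt (fun l => deriv (theta τ) (v - l))
      (-deriv (deriv (theta τ)) (v - l)) l :=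
    fun l => HasDerivAt.comp_const_sub v l (d1 (v - l))
  have c0 : ∀ l, HasDerivAt (fun l => theta τ (u + l)) (deriv (theta τ) (u + l)) l :=
    fun l => HasDerivAt.comp_const_add u l (d0 (u + l))
  have c1 : ∀ l, HasDerivAt (fun l => deriv (theta τ) (u + l))
      (deriv (deriv (theta τ)) (u + l)) l :=
    fun l => HasDerivAt.comp_const_add u l (d1 (u + l))
  -- The claim is the second `l`-derivative of `theta_addition` at `l = 0`. The first derivative is
  -- recorded for all `l`, so that it can be differentiated again.
  have h1 : ∀ l, deriv (theta τ) l * theta τ v *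
        (deriv (theta τ) u * theta τ (w - l) + theta τ u * deriv (theta τ) (w - l)) -
      theta τ l * theta τ v *
        (deriv (theta τ) u * deriv (theta τ) (w - l) + theta τ u * deriv (deriv (theta τ)) (w - l)) -
      theta τ u * deriv (theta τ) (w - l) *
        (deriv (theta τ) l * theta τ v - deriv (theta τ) v * theta τ l) +
      theta τ u * theta τ (w - l) *
        (deriv (deriv (theta τ)) l * theta τ v - deriv (theta τ) v * deriv (theta τ) l) =
      theta τ w * (theta τ (v - l) * deriv (theta τ) (u + l) -
        deriv (theta τ) (v - l) * theta τ (u + l)) := by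
    intro l
    have h1 := (((d0 l).mul_const (theta τ v)).fun_mul
      (((a0 l).const_mul (deriv (theta τ) u)).fun_add ((a1 l).const_mul (theta τ u)))).fun_add
      (((a0 l).const_mul (theta τ u)).fun_mul
        (((d1 l).mul_const (theta τ v)).fun_sub ((d0 l).const_mul (deriv (theta τ) v))))
    have h2 := (b0 l).fun_mul ((c0 l).mul_const (theta τ w))
    have h := h1.unique (h2.congr_of_eventuallyEq
      (Eventually.of_forall fun l => by rw [hw]; exact theta_addition τ u v l))
    linear_combination h
  have k1 := (((((d1 0).mul_const (theta τ v)).fun_mul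
      (((a0 0).const_mul (deriv (theta τ) u)).fun_add ((a1 0).const_mul (theta τ u)))).fun_sub
      (((d0 0).mul_const (theta τ v)).fun_mul
      (((a1 0).const_mul (deriv (theta τ) u)).fun_add ((a2 0).const_mul (theta τ u))))).fun_sub
      (((a1 0).const_mul (theta τ u)).fun_mul
        (((d1 0).mul_const (theta τ v)).fun_sub ((d0 0).const_mul (deriv (theta τ) v))))).fun_add
      (((a0 0).const_mul (theta τ u)).fun_mul
        (((d2 0).mul_const (theta τ v)).fun_sub ((d1 0).const_mul (deriv (theta τ) v))))
  have k2 := (((b0 0).fun_mul (c1 0)).fun_sub ((b1 0).fun_mul (c0 0))).const_mul (theta τ w)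
  have k := k1.unique (k2.congr_of_eventuallyEq (Eventually.of_forall h1))
  have hz : deriv (deriv (theta τ)) 0 = 0 := by
    have := theta_deriv_deriv_neg τ 0
    rw [neg_zero] at this
    exact self_eq_neg.1 this
  simp only [sub_zero, add_zero, theta_zero, theta_deriv_zero, hz] at k
  linear_combination -k

end EllipticBethe
namespace EllipticBethe

/-! ### Identities for `ρ`, `σ`, `φ`, `η` -/

lemma sigma_neg_neg (τ : ℍ) (x w : ℂ) : sigma τ (-x) (-w) = -sigma τ x w := by
  rw [sigma, sigma, ← neg_add, theta_neg, theta_neg, theta_neg, neg_mul_neg, neg_div]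

lemma rho_neg (τ : ℍ) (x : ℂ) : rho τ (-x) = -rho τ x := by
  rw [rho, rho, theta_neg, theta_deriv_neg, div_neg]

lemma rho_deriv_neg (τ : ℍ) (x : ℂ) : deriv (rho τ) (-x) = deriv (rho τ) x := by
  have h : (fun y => rho τ (-y)) = fun y => -rho τ y := funext (rho_neg τ)
  have h1 := congrFun (congrArg deriv h) x
  rw [deriv_comp_neg, deriv.fun_neg] at h1
  exact neg_injective h1

lemma rho_hasDerivAt (τ : ℍ) {x : ℂ} (hx : theta τ x ≠ 0) : HasDerivAt (rho τ)
    ((deriv (deriv (theta τ)) x * theta τ x - deriv (theta τ) x * deriv (theta τ) x) /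
      theta τ x ^ 2) x :=
  (theta_deriv_hasDerivAt τ x).fun_div (theta_hasDerivAt τ x) hx

/-- From `(θ'/θ)' = θ''/θ - (θ'/θ)²`. In this form `η` has only simple poles, and the oddness of
`θ''` removes the one at `0`. -/
lemma rho_sq_add_deriv (τ : ℍ) {x : ℂ} (hx : theta τ x ≠ 0) :
    rho τ x ^ 2 + deriv (rho τ) x = deriv (deriv (theta τ)) x / theta τ x := by
  rw [(rho_hasDerivAt τ hx).deriv, rho]
  field_simp
  ring

lemma eta_of_theta_ne_zero (τ : ℍ) {x : ℂ} (hx : theta τ x ≠ 0) :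
    eta τ x = deriv (deriv (theta τ)) x / theta τ x := by
  have h0 : x ≠ 0 := by rintro rfl; exact hx (theta_zero τ)
  rw [eta, if_neg h0, rho_sq_add_deriv τ hx]

lemma theta_deriv_deriv_zero (τ : ℍ) : deriv (deriv (theta τ)) 0 = 0 := by
  have := theta_deriv_deriv_neg τ 0
  rw [neg_zero] at this
  exact self_eq_neg.1 this

/-- Near `0`, `θ''/θ` is the quotient of the slopes of `θ''` and `θ`, both of which vanish at `0`;
the limit is `θ'''(0) / θ'(0)` with `θ'(0) = 1`. -/
lemma eta_zero (τ : ℍ) : eta τ 0 = deriv (deriv (deriv (theta τ))) 0 := by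
  rw [eta, if_pos rfl]
  have h0 := theta_hasDerivAt τ 0
  rw [theta_deriv_zero] at h0
  have h1 := (theta_deriv_deriv_hasDerivAt τ 0).tendsto_slope.div h0.tendsto_slope one_ne_zero
  rw [div_one] at h1
  refine Tendsto.limUnder_eq (h1.congr' ?_)
  filter_upwards [h0.eventually_ne (c := 0) one_ne_zero, self_mem_nhdsWithin] with y hy hy0
  rw [rho_sq_add_deriv τ hy]
  have h2 : y ≠ 0 := hy0
  simp only [Pi.div_apply, slope_def_field, theta_zero, theta_deriv_deriv_zero, sub_zero]
  rw [div_div_div_cancel_right₀ h2]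

/-- This is `theta_addition_three` divided by `2 θ(u) θ(v) θ(v - u)`. With `u = x - z_s` and `v = x
- z_p` the difference `v - u` does not involve `x`, and each remaining product containing `x`
depends on just one of the two poles. -/
lemma rho_mul_rho (τ : ℍ) {u v : ℂ} (hu : theta τ u ≠ 0) (hv : theta τ v ≠ 0)
    (hw : theta τ (v - u) ≠ 0) :
    rho τ u * rho τ v = 1 / 2 * eta τ (v - u) + (rho τ u - rho τ v) * rho τ (v - u) +
      1 / 2 * (rho τ u ^ 2 + deriv (rho τ) u) + 1 / 2 * (rho τ v ^ 2 + deriv (rho τ) v) -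
      1 / 2 * eta τ 0 := by
  have h := theta_addition_three τ u v (v - u) rfl
  rw [eta_of_theta_ne_zero τ hw, rho_sq_add_deriv τ hu, rho_sq_add_deriv τ hv, eta_zero, rho, rho,
    rho]
  generalize v - u = w at *
  field_simp
  linear_combination -h

/-- The coincident case `v = u` of the product formula for `σ`, where `sigma_mul_sigma` has a pole;
it is `theta_mul_theta` divided by `-θ(u)² θ(l)²`. -/
lemma sigma_mul_sigma_neg (τ : ℍ) {u l : ℂ} (hu : theta τ u ≠ 0) (hl : theta τ l ≠ 0) :
    sigma τ u l * sigma τ u (-l) = deriv (rho τ) l - deriv (rho τ) u := by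
  have h := theta_mul_theta τ u l
  rw [sigma, sigma, (rho_hasDerivAt τ hu).deriv, (rho_hasDerivAt τ hl).deriv, theta_neg,
    ← sub_eq_add_neg]
  field_simp
  linear_combination -h

lemma phi_of_theta_ne_zero (τ : ℍ) {l w : ℂ} (hl : theta τ l ≠ 0) (hw : w ≠ 0) :
    phi τ l w = (deriv (theta τ) (w - l) * theta τ l + theta τ (w - l) * deriv (theta τ) l) /
      (theta τ w * theta τ l ^ 2) := by
  rw [phi, if_neg hw]
  have h1 : HasDerivAt (fun y => theta τ (w - y)) (-deriv (theta τ) (w - l)) l :=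
    HasDerivAt.comp_const_sub w l (theta_hasDerivAt τ (w - l))
  have h2 := (h1.fun_div (theta_hasDerivAt τ l) hl).const_mul (-(theta τ w)⁻¹)
  have h3 : (fun y => sigma τ w (-y)) = fun y => -(theta τ w)⁻¹ * (theta τ (w - y) / theta τ y) := by
    funext y
    rw [sigma, theta_neg, ← sub_eq_add_neg, mul_neg, div_neg, div_eq_mul_inv, mul_inv,
      div_eq_mul_inv]
    ring
  rw [h3, h2.deriv]
  simp only [div_eq_mul_inv, mul_inv]
  ring

/-- Up to sign, this is `theta_addition` divided by `θ(u) θ(v) θ(l)² θ(v - u)`. The dependence on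
the spectral parameter is reduced to a difference of two `ρ`'s, and `φ` is the part free of it. -/
lemma sigma_mul_sigma (τ : ℍ) {u v l : ℂ} (hu : theta τ u ≠ 0) (hv : theta τ v ≠ 0)
    (hw : theta τ (v - u) ≠ 0) (hl : theta τ l ≠ 0) :
    sigma τ u l * sigma τ v (-l) =
      sigma τ (v - u) (-l) * (rho τ u - rho τ v) - phi τ l (v - u) := by
  have h0 : v - u ≠ 0 := by intro h; rw [h] at hw; exact hw (theta_zero τ)
  have h := theta_addition τ u v l
  rw [phi_of_theta_ne_zero τ hl h0, sigma, sigma, sigma, rho, rho, theta_neg, ← sub_eq_add_neg,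
    ← sub_eq_add_neg]
  generalize theta τ (v - u - l) = c at *
  generalize deriv (theta τ) (v - u - l) = c' at *
  generalize theta τ (v - u) = w at *
  field_simp
  linear_combination h

end EllipticBethe
namespace EllipticBethe

/-! ### Calculus of multiplication and derivation operators on meromorphic functions -/

section MeromorphicOperators

variable {G F : Type} [NormedAddCommGroup G] [NormedSpace ℂ G]
  [NormedAddCommGroup F] [NormedSpace ℂ F] {ι : G → F} {v : F}

lemma IsMer.dense_analytic (hι : ∀ p, AnalyticAt ℂ ι p) {f : F → ℂ} (hf : IsMer ι v f) :
    Dense (interior {p : G | ∀ᶠ y in 𝓝 (ι p), AnalyticAt ℂ f y}) := by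
  rw [dense_iff_closure_eq, Set.eq_univ_iff_forall]
  intro p
  obtain ⟨g, h, hg, hh, hn, he⟩ := hf.1 p
  rw [mem_closure_iff_frequently]
  have hc := (hι p).continuousAt
  have e1 := hc.eventually he.eventually_nhds
  have e2 := hc.eventually hg.eventually_analyticAt
  have e3 := hc.eventually hh.eventually_analyticAt
  refine (hn.and_eventually (e1.and (e2.and e3))).mono fun q hq => ?_
  obtain ⟨h0, hq1, hq2, hq3⟩ := hq
  have hfa : AnalyticAt ℂ f (ι q) := by
    refine (hq2.div hq3 h0).congr ?_
    filter_upwards [hq1, hq3.continuousAt.eventually_ne h0] with w hw hw0 using (hw hw0).symm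
  rw [mem_interior_iff_mem_nhds]
  have := (hι q).continuousAt.eventually hfa.eventually_analyticAt
  filter_upwards [this] with r hr
  exact hr.eventually_analyticAt

lemma isNull_of_dense {f : F → ℂ} {A : G → Prop} (hA : Dense (interior {p | A p}))
    (h : ∀ p, A p → ∀ᶠ y in 𝓝 (ι p), f y = 0) : IsNull ι f :=
  hA.mono (interior_mono h)

lemma fderiv_eq_zero_of_invariant {f : F → ℂ} {u : F} (hf : ∀ y (c : ℂ), f (y + c • u) = f y)
    (y : F) : fderiv ℂ f y u = 0 := by
  by_cases hd : DifferentiableAt ℂ f y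
  · rw [← hd.lineDeriv_eq_fderiv, lineDeriv]
    simp only [hf, deriv_const]
  -- At points of non-differentiability the derivative is `0` by convention, so the conclusion holds
  -- everywhere.
  · rw [fderiv_zero_of_not_differentiableAt hd]
    simp

variable (hι : ∀ p, AnalyticAt ℂ ι p)

lemma Mer.mulOp_mk (f : F → ℂ) (hf : IsMer ι v f) (g : merPre ι v hι) :
    Mer.mulOp hι f hf (Mer.mk hι g) = Mer.mk hι ⟨fun y => f y * g.1 y, hf.mul hι g.2⟩ := rfl

lemma Mer.derivOp_mk (u : F) (g : merPre ι v hι) :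
    Mer.derivOp hι u (Mer.mk hι g) = Mer.mk hι ⟨fun y => fderiv ℂ g.1 y u, g.2.dirDeriv hι u⟩ := rfl

lemma Mer.end_ext {M : Type*} [AddCommMonoid M] [Module ℂ M] {S T : Mer ι v hι →ₗ[ℂ] M}
    (h : ∀ g : merPre ι v hι, S (Mer.mk hι g) = T (Mer.mk hι g)) : S = T := by
  ext x
  obtain ⟨g, rfl⟩ := Mer.mk_surjective hι x
  exact h g

lemma Mer.mulOp_mul (f g : F → ℂ) (hf : IsMer ι v f) (hg : IsMer ι v g) :
    Mer.mulOp hι f hf * Mer.mulOp hι g hg = Mer.mulOp hι (fun y => f y * g y) (hf.mul hι hg) :=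
  Mer.end_ext hι fun _ => congrArg (Mer.mk hι) (Subtype.ext (funext fun _ => (mul_assoc _ _ _).symm))

lemma Mer.mulOp_add (f g : F → ℂ) (hf : IsMer ι v f) (hg : IsMer ι v g) :
    Mer.mulOp hι f hf + Mer.mulOp hι g hg = Mer.mulOp hι (fun y => f y + g y) (hf.add hι hg) :=
  Mer.end_ext hι fun k => by
    rw [LinearMap.add_apply, Mer.mulOp_mk, Mer.mulOp_mk, Mer.mulOp_mk, ← map_add]
    exact congrArg (Mer.mk hι) (Subtype.ext (funext fun _ => (add_mul _ _ _).symm))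

lemma Mer.mulOp_const (c : ℂ) (hc : IsMer ι v fun _ => c) :
    Mer.mulOp hι (fun _ => c) hc = c • (1 : Module.End ℂ (Mer ι v hι)) :=
  Mer.end_ext hι fun k => by
    rw [LinearMap.smul_apply, Mer.mulOp_mk, Module.End.one_apply, ← map_smul]
    rfl

lemma Mer.mulOp_congr (f g : F → ℂ) (hf : IsMer ι v f) (hg : IsMer ι v g)
    (h : IsNull ι (fun y => f y - g y)) : Mer.mulOp hι f hf = Mer.mulOp hι g hg :=
  Mer.end_ext hι fun k => by
    rw [Mer.mulOp_mk, Mer.mulOp_mk, Mer.mk_eq_mk]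
    refine isNull_of_one h fun p hp => ?_
    filter_upwards [hp] with y hy
    simp only [Pi.sub_apply]
    rw [← sub_mul, hy, zero_mul]

lemma Mer.mulOp_congr' {f g : F → ℂ} (h : f = g) (hf : IsMer ι v f) (hg : IsMer ι v g) :
    Mer.mulOp hι f hf = Mer.mulOp hι g hg := by
  subst h; rfl

/-- The Leibniz rule. -/
lemma Mer.derivOp_mul_mulOp (u : F) (f : F → ℂ) (hf : IsMer ι v f) :
    Mer.derivOp hι u * Mer.mulOp hι f hf = Mer.mulOp hι f hf * Mer.derivOp hι u +
      Mer.mulOp hι (fun y => fderiv ℂ f y u) (hf.dirDeriv hι u) :=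
  Mer.end_ext hι fun k => by
    rw [LinearMap.add_apply, Module.End.mul_apply, Module.End.mul_apply, Mer.mulOp_mk,
      Mer.mulOp_mk, Mer.derivOp_mk, Mer.derivOp_mk, Mer.mulOp_mk, ← map_add, Mer.mk_eq_mk]
    -- Representatives are arbitrary on their polar sets, so the Leibniz rule is available only
    -- where both factors are differentiable; this happens over a dense open set, which is all that
    -- equality in `Mer` asks for.
    have hA := Dense.inter_of_isOpen_left (hf.dense_differentiable hι)
      (IsMer.dense_differentiable hι (show IsMer ι v k.1 from k.2)) isOpen_interior
    rw [← interior_inter] at hA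
    refine isNull_of_dense hA fun p hp => ?_
    filter_upwards [hp.1, hp.2] with y h1 h2
    have := congrArg (fun L => L u) (fderiv_fun_mul h1 h2)
    simp only [Pi.sub_apply, Submodule.coe_add, Pi.add_apply]
    rw [this]
    simp only [add_apply, smul_apply, smul_eq_mul]
    ring

/-- Symmetry of the second derivative at points of analyticity. Differentiability of the
representative would not suffice, which is why `IsMer.dense_analytic` is needed. -/
lemma Mer.derivOp_comm (u w : F) :
    Mer.derivOp (v := v) hι u * Mer.derivOp hι w = Mer.derivOp hι w * Mer.derivOp hι u :=
  Mer.end_ext hι fun k => by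
    rw [Module.End.mul_apply, Module.End.mul_apply, Mer.derivOp_mk, Mer.derivOp_mk,
      Mer.derivOp_mk, Mer.derivOp_mk, Mer.mk_eq_mk]
    refine isNull_of_dense (IsMer.dense_analytic hι (show IsMer ι v k.1 from k.2)) fun p hp => ?_
    filter_upwards [hp] with y hy
    have hs : IsSymmSndFDerivAt ℂ k.1 y :=
      hy.contDiffAt.isSymmSndFDerivAt (n := ⊤) (by simp)
    have hd : DifferentiableAt ℂ (fderiv ℂ k.1) y := hy.fderiv.differentiableAt
    have h1 : ∀ a b : F, fderiv ℂ (fun y => fderiv ℂ k.1 y a) y b =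
        fderiv ℂ (fderiv ℂ k.1) y b a := fun a b => by
      rw [fderiv_clm_apply hd (differentiableAt_const a)]
      simp
    simp only [Pi.sub_apply]
    rw [h1, h1, hs.eq, sub_self]

lemma Mer.derivOp_add (u w : F) :
    Mer.derivOp (v := v) hι (u + w) = Mer.derivOp hι u + Mer.derivOp hι w :=
  Mer.end_ext hι fun k => by
    rw [LinearMap.add_apply, Mer.derivOp_mk, Mer.derivOp_mk, Mer.derivOp_mk, ← map_add]
    exact congrArg (Mer.mk hι) (Subtype.ext (funext fun _ => map_add _ _ _))

lemma Mer.derivOp_eq_zero_of_eq {u : F} (hu : u = v) : Mer.derivOp (v := v) hι u = 0 :=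
  Mer.end_ext hι fun k => by
    rw [Mer.derivOp_mk, LinearMap.zero_apply]
    refine Mer.mk_eq_zero hι ?_
    have : (fun y => fderiv ℂ k.1 y u) = fun _ => 0 := funext fun y =>
      fderiv_eq_zero_of_invariant (hu ▸ (show IsMer ι v k.1 from k.2).2) y
    simp only [this]
    exact isNull_zero ι

lemma Mer.derivOp_zero : Mer.derivOp (v := v) hι 0 = 0 := by
  have h := Mer.derivOp_add (v := v) hι 0 0
  rwa [add_zero, left_eq_add] at h

lemma Mer.derivOp_sum {α : Type*} (s : Finset α) (u : α → F) :
    Mer.derivOp (v := v) hι (∑ i ∈ s, u i) = ∑ i ∈ s, Mer.derivOp hι (u i) := by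
  classical
  induction s using Finset.induction_on with
  | empty => simpa using Mer.derivOp_zero hι
  | insert a s ha ih => rw [Finset.sum_insert ha, Finset.sum_insert ha, Mer.derivOp_add, ih]

end MeromorphicOperators

/-! ### Restriction to `x' = x`, and divided powers of `x' - x` -/

section Slices

variable (N : ℕ) (x : ℂ)

/-- The sum is the derivative along `(1, …, 1)`, a direction in which functions of the differences
`λ_j - λ_l` are invariant. -/
lemma sum_derivOp_lam :
    ∑ k : Fin N, Mer.derivOp (v := fun _ => 1) (id_analytic N) (Pi.single k 1 : Cartan N) = 0 := by
  rw [← Mer.derivOp_sum]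
  refine Mer.derivOp_eq_zero_of_eq _ ?_
  exact Finset.univ_sum_single (fun _ : Fin N => (1 : ℂ))

lemma evalX_mk (f : merPre (slice N x) ((0 : ℂ), fun _ => (1 : ℂ)) (slice_analytic N x)) :
    ∃ h, evalX N x (Mer.mk _ f) = Mer.mk (id_analytic N) ⟨fun p => f.1 (slice N x p), h⟩ := ⟨_, rfl⟩

lemma constX_mk (f : merPre (id : Cartan N → Cartan N) (fun _ => 1) (id_analytic N)) :
    ∃ h, constX N x (Mer.mk _ f) = Mer.mk (slice_analytic N x) ⟨fun y => f.1 y.2, h⟩ := ⟨_, rfl⟩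

lemma evalX_comp_constX : evalX N x ∘ₗ constX N x = LinearMap.id :=
  Mer.end_ext _ fun _ => rfl

lemma evalX_comp_mulOp {f : ℂ × Cartan N → ℂ} {f' : Cartan N → ℂ} (hf) (hf')
    (h : ∀ p, f (x, p) = f' p) :
    evalX N x ∘ₗ Mer.mulOp (slice_analytic N x) f hf =
      Mer.mulOp (id_analytic N) f' hf' ∘ₗ evalX N x := by
  obtain rfl : f' = fun p => f (x, p) := funext fun p => (h p).symm
  exact Mer.end_ext _ fun _ => rfl

/-- Derivatives in `λ` are tangent to the slice and therefore commute with restriction. The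
derivative in `x'` does not, and has to be carried out before restricting. -/
lemma evalX_comp_derivOp (u : Cartan N) :
    evalX N x ∘ₗ Mer.derivOp (slice_analytic N x) ((0 : ℂ), u) =
      Mer.derivOp (id_analytic N) u ∘ₗ evalX N x := by
  refine Mer.end_ext _ fun g => ?_
  rw [LinearMap.comp_apply, LinearMap.comp_apply, Mer.derivOp_mk]
  obtain ⟨h1, e1⟩ := evalX_mk N x g
  obtain ⟨h2, e2⟩ := evalX_mk N x ⟨fun y => fderiv ℂ g.1 y ((0 : ℂ), u),
    IsMer.dirDeriv (slice_analytic N x) g.2 _⟩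
  rw [e1, e2, Mer.derivOp_mk, Mer.mk_eq_mk]
  refine isNull_of_dense (A := fun p : Cartan N => ∀ᶠ y in 𝓝 (slice N x p), DifferentiableAt ℂ g.1 y)
    (IsMer.dense_differentiable (slice_analytic N x) (show IsMer _ _ g.1 from g.2)) fun p hp => ?_
  filter_upwards [(slice_analytic N x p).continuousAt.eventually hp] with q hq
  have hs : HasFDerivAt (slice N x) (ContinuousLinearMap.inr ℂ ℂ (Cartan N)) q :=
    hasFDerivAt_prodMk_right x q
  have := (hq.hasFDerivAt.comp q hs).fderiv
  simp only [Pi.sub_apply]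
  refine sub_eq_zero.2 ?_
  exact (congrArg (fun L => L u) this).symm

lemma derivOp_comp_constX (u : Cartan N) :
    Mer.derivOp (slice_analytic N x) ((0 : ℂ), u) ∘ₗ constX N x =
      constX N x ∘ₗ Mer.derivOp (id_analytic N) u := by
  refine Mer.end_ext _ fun g => ?_
  rw [LinearMap.comp_apply, LinearMap.comp_apply, Mer.derivOp_mk]
  obtain ⟨h1, e1⟩ := constX_mk N x g
  obtain ⟨h2, e2⟩ := constX_mk N x ⟨fun y => fderiv ℂ g.1 y u,
    IsMer.dirDeriv (id_analytic N) g.2 _⟩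
  rw [e1, e2, Mer.derivOp_mk, Mer.mk_eq_mk]
  refine isNull_of_dense (A := fun p : Cartan N => ∀ᶠ y in 𝓝 (id p), DifferentiableAt ℂ g.1 y)
    (IsMer.dense_differentiable (id_analytic N) (show IsMer _ _ g.1 from g.2)) fun p hp => ?_
  filter_upwards [(continuousAt_snd (p := slice N x p)).eventually hp] with y hq
  have hs : HasFDerivAt (Prod.snd : ℂ × Cartan N → Cartan N)
    (ContinuousLinearMap.snd ℂ ℂ (Cartan N)) y := hasFDerivAt_snd
  have := (hq.hasFDerivAt.comp y hs).fderiv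
  simp only [Pi.sub_apply]
  refine sub_eq_zero.2 ?_
  exact (congrArg (fun L => L ((0 : ℂ), u)) this)

lemma derivOp_x_comp_constX :
    Mer.derivOp (slice_analytic N x) ((1 : ℂ), (0 : Cartan N)) ∘ₗ constX N x = 0 := by
  refine Mer.end_ext _ fun g => ?_
  obtain ⟨h1, e1⟩ := constX_mk N x g
  rw [LinearMap.comp_apply, e1, Mer.derivOp_mk, LinearMap.zero_apply]
  refine Mer.mk_eq_zero _ ?_
  have : (fun y : ℂ × Cartan N => fderiv ℂ (fun y : ℂ × Cartan N => g.1 y.2) y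
      ((1 : ℂ), (0 : Cartan N))) = fun _ => 0 := funext fun y =>
    fderiv_eq_zero_of_invariant (fun y c => by simp) y
  simp only [this]
  exact isNull_zero _

/-- Multiplication by `(x' - x) ^ k / k!`. -/
noncomputable abbrev monomialOp (k : ℕ) : Module.End ℂ (MerX N x) :=
  Mer.mulOp (slice_analytic N x) _ (monomial_x N x k)

lemma monomialOp_zero : monomialOp N x 0 = 1 := by
  refine Mer.end_ext _ fun g => ?_
  refine (Mer.mulOp_mk _ _ _ g).trans (congrArg _ (Subtype.ext (funext fun y => ?_)))
  simp

lemma evalX_comp_monomialOp (k : ℕ) : evalX N x ∘ₗ monomialOp N x (k + 1) = 0 := by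
  rw [monomialOp, evalX_comp_mulOp N x (f' := fun _ => 0) _ (IsMer.const 0) (by simp),
    Mer.mulOp_const, zero_smul, LinearMap.zero_comp]

lemma derivOp_lam_mul_monomialOp (u : Cartan N) (k : ℕ) :
    Mer.derivOp (slice_analytic N x) ((0 : ℂ), u) * monomialOp N x k =
      monomialOp N x k * Mer.derivOp (slice_analytic N x) ((0 : ℂ), u) := by
  rw [monomialOp, Mer.derivOp_mul_mulOp, add_eq_left,
    Mer.mulOp_congr' _ (g := fun _ => 0) ?_ _ (IsMer.const 0), Mer.mulOp_const, zero_smul]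
  exact funext fun y => fderiv_eq_zero_of_invariant (fun y c => by simp) y

lemma fderiv_comp_fst {N : ℕ} {r : ℂ → ℂ} {r' : ℂ} {y : ℂ × Cartan N} (h : HasDerivAt r r' y.1) :
    fderiv ℂ (fun y : ℂ × Cartan N => r y.1) y ((1 : ℂ), (0 : Cartan N)) = r' := by
  have := (h.hasFDerivAt.comp y (hasFDerivAt_fst (𝕜 := ℂ) (E := ℂ) (F := Cartan N))).fderiv
  refine (congrArg (fun L => L ((1 : ℂ), (0 : Cartan N))) this).trans ?_
  simp

/-- Dividing by `k!` makes the commutator with `∂_x` a pure index shift without numerical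
coefficient. -/
lemma derivOp_x_mul_monomialOp_succ (k : ℕ) :
    Mer.derivOp (slice_analytic N x) ((1 : ℂ), (0 : Cartan N)) * monomialOp N x (k + 1) =
      monomialOp N x (k + 1) * Mer.derivOp (slice_analytic N x) ((1 : ℂ), (0 : Cartan N)) +
        monomialOp N x k := by
  rw [monomialOp, Mer.derivOp_mul_mulOp, add_right_inj]
  refine Mer.mulOp_congr' _ (funext fun y => ?_) _ _
  refine fderiv_comp_fst (r := fun t => (t - x) ^ (k + 1) / ((k + 1).factorial : ℂ)) ?_
  have := (((hasDerivAt_id y.1).sub_const x).fun_pow (k + 1)).div_const ((k + 1).factorial : ℂ)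
  refine this.congr_deriv ?_
  have h1 : ((k : ℂ) + 1) ≠ 0 := Nat.cast_add_one_ne_zero k
  have h2 : (k.factorial : ℂ) ≠ 0 := Nat.cast_ne_zero.2 k.factorial_ne_zero
  rw [Nat.factorial_succ]
  push_cast
  simp only [id]
  field_simp

end Slices

end EllipticBethe
namespace EllipticBethe

/-! ### Coefficients of `cdet(X + t)` over a noncommutative ring -/

section ColumnDeterminant

open Polynomial

variable {R : Type*} [Ring R]

/-- The linear polynomial `c + X` or `c`. -/
noncomputable def linPoly (c : R) (b : Prop) [Decidable b] : R[X] := C c + if b then X else 0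

lemma linPoly_mul_coeff_zero (c : R) (b : Prop) [Decidable b] (Q : R[X]) :
    (linPoly c b * Q).coeff 0 = c * Q.coeff 0 := by
  unfold linPoly
  split_ifs <;> simp [add_mul]

lemma linPoly_mul_coeff_succ (c : R) (b : Prop) [Decidable b] (Q : R[X]) (k : ℕ) :
    (linPoly c b * Q).coeff (k + 1) = c * Q.coeff (k + 1) + if b then Q.coeff k else 0 := by
  unfold linPoly
  split_ifs <;> simp [add_mul]

lemma prod_linPoly_succ {N : ℕ} (c : Fin (N + 1) → R) (b : Fin (N + 1) → Prop) [DecidablePred b] :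
    ((List.finRange (N + 1)).map fun m => linPoly (c m) (b m)).prod = linPoly (c 0) (b 0) *
      ((List.finRange N).map fun m => linPoly (c m.succ) (b m.succ)).prod := by
  rw [List.finRange_succ, List.map_cons, List.prod_cons, List.map_map]
  rfl

lemma prod_linPoly_coeff_of_lt {N : ℕ} (c : Fin N → R) (b : Fin N → Prop) [DecidablePred b]
    {k : ℕ} (hk : N < k) : ((List.finRange N).map fun m => linPoly (c m) (b m)).prod.coeff k = 0 := by
  induction N generalizing k with
  | zero => simp [coeff_one, hk.ne']
  | succ N ih =>
    obtain ⟨k, rfl⟩ : ∃ j, k = j + 1 := ⟨k - 1, by omega⟩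
    rw [prod_linPoly_succ, linPoly_mul_coeff_succ, ih _ _ (by omega), ih _ _ (by omega)]
    simp

lemma prod_linPoly_coeff_top {N : ℕ} (c : Fin N → R) (b : Fin N → Prop) [DecidablePred b] :
    ((List.finRange N).map fun m => linPoly (c m) (b m)).prod.coeff N =
      if ∀ m, b m then 1 else 0 := by
  induction N with
  | zero => simp
  | succ N ih =>
    rw [prod_linPoly_succ, linPoly_mul_coeff_succ, ih, prod_linPoly_coeff_of_lt _ _ (by omega)]
    simp only [mul_zero, zero_add, Fin.forall_fin_succ, ite_and]

lemma prod_linPoly_coeff_pred {N k : ℕ} (hk : k + 1 = N) (c : Fin N → R) (b : Fin N → Prop)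
    [DecidablePred b] :
    ((List.finRange N).map fun m => linPoly (c m) (b m)).prod.coeff k =
      ∑ i, if ∀ m, m ≠ i → b m then c i else 0 := by
  induction N generalizing k with
  | zero => omega
  | succ N ih =>
    obtain rfl : k = N := by omega
    rw [prod_linPoly_succ, Fin.sum_univ_succ]
    simp only [Fin.forall_fin_succ, Fin.succ_ne_zero, ne_eq, not_true_eq_false, not_false_eq_true,
      false_implies, true_and, true_implies, Fin.succ_inj, (Fin.succ_ne_zero _).symm]
    cases k with
    | zero => rw [linPoly_mul_coeff_zero]; simp
    | succ k =>
      rw [linPoly_mul_coeff_succ, prod_linPoly_coeff_top, ih rfl]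
      simp only [ite_and, mul_ite, mul_one, mul_zero]
      congr 1
      split_ifs <;> simp

/-- To reach degree `N - 2`, all factors but two must supply the variable. The condition `i < j`
keeps the two constants in the order of the product, which matters in a noncommutative ring. -/
lemma prod_linPoly_coeff_pred_pred {N k : ℕ} (hk : k + 2 = N) (c : Fin N → R) (b : Fin N → Prop)
    [DecidablePred b] :
    ((List.finRange N).map fun m => linPoly (c m) (b m)).prod.coeff k =
      ∑ i, ∑ j, if i < j ∧ ∀ m, m ≠ i → m ≠ j → b m then c i * c j else 0 := by
  induction N generalizing k with
  | zero => omega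
  | succ N ih =>
    rw [prod_linPoly_succ, Fin.sum_univ_succ]
    simp only [Fin.sum_univ_succ (n := N)]
    simp only [Fin.forall_fin_succ, Fin.succ_ne_zero, ne_eq, not_true_eq_false, not_false_eq_true,
      false_implies, true_and, true_implies, Fin.succ_inj, (Fin.succ_ne_zero _).symm, lt_self_iff_false,
      false_and, if_false, zero_add, Fin.succ_pos, Fin.not_lt_zero, Fin.succ_lt_succ_iff]
    cases k with
    | zero =>
      obtain rfl : N = 1 := by omega
      rw [linPoly_mul_coeff_zero, List.finRange_succ]
      simp only [List.map_cons, List.prod_cons, linPoly_mul_coeff_zero]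
      simp
    | succ k =>
      rw [linPoly_mul_coeff_succ, prod_linPoly_coeff_pred (by omega), ih (by omega)]
      rw [Finset.mul_sum]
      simp only [mul_ite, mul_zero]
      congr 1
      by_cases hb : b 0 <;> simp [hb]

lemma sum_perm_fix_pair {N : ℕ} {i j : Fin N} (hij : i ≠ j) {M : Type*} [AddCommGroup M]
    (f : Equiv.Perm (Fin N) → M) :
    (∑ π : Equiv.Perm (Fin N), if ∀ m, m ≠ i → m ≠ j → π m = m then f π else 0) =
      f 1 + f (Equiv.swap i j) := by
  have h1 : (1 : Equiv.Perm (Fin N)) ≠ Equiv.swap i j := fun h => by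
    have := congrArg (fun π => π i) h
    simp [hij] at this
  rw [← Finset.sum_pair h1, ← Finset.sum_filter]
  congr 1
  ext π
  simp only [Finset.mem_filter, Finset.mem_univ, true_and, Finset.mem_insert, Finset.mem_singleton]
  constructor
  · intro h
    have hi : π i = i ∨ π i = j := by
      by_contra! hc
      exact hc.1 (π.injective (h _ hc.1 hc.2))
    have hj : π j = i ∨ π j = j := by
      by_contra! hc
      exact hc.2 (π.injective (h _ hc.1 hc.2))
    rcases hi with hi | hi
    · left
      have hj' : π j = j := hj.resolve_left fun h' => hij (π.injective (hi.trans h'.symm))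
      ext m
      by_cases hmi : m = i
      · subst hmi; simp [hi]
      · by_cases hmj : m = j
        · subst hmj; simp [hj']
        · simp [h m hmi hmj]
    · right
      have hj' : π j = i := hj.resolve_right fun h' => hij (π.injective (hi.trans h'.symm))
      ext m
      by_cases hmi : m = i
      · subst hmi; simp [hi]
      · by_cases hmj : m = j
        · subst hmj; simp [hj']
        · simp [h m hmi hmj, Equiv.swap_apply_of_ne_of_ne hmi hmj]
  · rintro (rfl | rfl) m hmi hmj
    · rfl
    · exact Equiv.swap_apply_of_ne_of_ne hmi hmj

/-- The column determinant of `X + t`, with a central variable `t`. -/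
noncomputable def cdetPoly {N : ℕ} (X : Fin N → Fin N → R) : R[X] :=
  cdet fun j l => linPoly (X j l) (j = l)

lemma cdetPoly_coeff {N : ℕ} (X : Fin N → Fin N → R) (k : ℕ) :
    (cdetPoly X).coeff k = ∑ π : Equiv.Perm (Fin N), (Equiv.Perm.sign π : ℤ) •
      ((List.finRange N).map fun m => linPoly (X (π m) m) (π m = m)).prod.coeff k := by
  unfold cdetPoly cdet
  rw [finsetSum_coeff]
  exact Finset.sum_congr rfl fun π _ => coeff_smul _ _ _

/-- The variable sits on the diagonal only, so the contributing permutations fix all indices except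
possibly `i` and `j`: the identity gives the first product, and the transposition the second with
sign `-1`. The factors stand in the order of their columns. -/
lemma cdetPoly_coeff_pred_pred {N k : ℕ} (hk : k + 2 = N) (X : Fin N → Fin N → R) :
    (cdetPoly X).coeff k = ∑ i, ∑ j ∈ Finset.univ.filter (fun j => i < j),
      (X i i * X j j - X j i * X i j) := by
  rw [cdetPoly_coeff]
  simp_rw [prod_linPoly_coeff_pred_pred hk, Finset.smul_sum]
  rw [Finset.sum_comm]
  refine Finset.sum_congr rfl fun i _ => ?_
  rw [Finset.sum_comm, Finset.sum_filter]
  refine Finset.sum_congr rfl fun j _ => ?_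
  split_ifs with hij
  · have := sum_perm_fix_pair hij.ne
      (fun π => (Equiv.Perm.sign π : ℤ) • (X (π i) i * X (π j) j))
    simp only [hij, true_and, smul_ite, smul_zero]
    rw [this, Equiv.Perm.sign_swap hij.ne]
    simp [sub_eq_add_neg]
  · simp [hij]

lemma cdetPoly_two_coeff_one (X : Fin 2 → Fin 2 → R) :
    (cdetPoly X).coeff 1 = X 0 0 + X 1 1 := by
  rw [cdetPoly_coeff]
  simp_rw [prod_linPoly_coeff_pred (rfl : 1 + 1 = 2)]
  have h : (Finset.univ : Finset (Equiv.Perm (Fin 2))) = {1, Equiv.swap 0 1} := by decide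
  rw [h, Finset.sum_pair (by decide)]
  simp [Fin.sum_univ_two, Fin.forall_fin_two]

/-- A word in operators `Y` with `[Y, P_{k+1}] = P_k` or `0`, applied to `P_k`. -/
lemma list_prod_mul_divided_power {α : Type*} (P : ℕ → R) (Y : α → R) (b : α → Prop)
    [DecidablePred b] (h0 : ∀ a, Y a * P 0 = P 0 * Y a)
    (hs : ∀ a k, Y a * P (k + 1) = P (k + 1) * Y a + if b a then P k else 0) (L : List α) (k : ℕ) :
    (L.map Y).prod * P k = ∑ p ∈ Finset.HasAntidiagonal.antidiagonal k,
      P p.1 * ((L.map fun a => linPoly (Y a) (b a)).prod.coeff p.2) := by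
  induction L generalizing k with
  | nil =>
    rw [List.map_nil, List.prod_nil, one_mul, List.map_nil, List.prod_nil,
      Finset.sum_eq_single (k, 0)]
    · simp
    · rintro ⟨i, j⟩ hp hne
      have hj : j ≠ 0 := by
        rintro rfl
        simp only [Finset.HasAntidiagonal.mem_antidiagonal] at hp
        exact hne (by simp [← hp])
      simp [coeff_one, hj]
    · simp
  | cons a L ih =>
    simp only [List.map_cons, List.prod_cons]
    rw [mul_assoc, ih, Finset.mul_sum]
    cases k with
    | zero =>
      simp only [Finset.HasAntidiagonal.antidiagonal_zero, Finset.sum_singleton, linPoly_mul_coeff_zero]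
      rw [← mul_assoc, h0, mul_assoc]
    | succ k =>
      -- Choosing the variable raises the degree `p.2`, while a commutator lowers the index `p.1`.
      -- The two effects match because `p.2 = 0` is split off here and `p.1 = 0` below, leaving the
      -- same sum over the antidiagonal of `k`.
      have e1 : ∀ Q : R[X], ∑ p ∈ Finset.HasAntidiagonal.antidiagonal (k + 1), P p.1 * (linPoly (Y a) (b a) * Q).coeff p.2 =
          ∑ p ∈ Finset.HasAntidiagonal.antidiagonal (k + 1), P p.1 * (Y a * Q.coeff p.2) +
          ∑ p ∈ Finset.HasAntidiagonal.antidiagonal k, if b a then P p.1 * Q.coeff p.2 else 0 := by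
        intro Q
        rw [Finset.Nat.sum_antidiagonal_succ', Finset.Nat.sum_antidiagonal_succ', add_assoc,
          ← Finset.sum_add_distrib]
        simp only [linPoly_mul_coeff_zero, linPoly_mul_coeff_succ]
        congr 1
        refine Finset.sum_congr rfl fun p _ => ?_
        split_ifs <;> simp [mul_add]
      rw [e1, Finset.Nat.sum_antidiagonal_succ, Finset.Nat.sum_antidiagonal_succ, add_assoc,
        ← Finset.sum_add_distrib, ← mul_assoc, h0, mul_assoc]
      congr 1
      refine Finset.sum_congr rfl fun p _ => ?_
      rw [← mul_assoc, hs, add_mul, mul_assoc]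
      split_ifs <;> simp

/-- Each diagonal entry passing `P_k` may lower the index by one, just as it may supply the central
variable `t` in `cdet(X + t)`. The coefficients of a differential operator in `x` thus become
polynomial coefficients, without bringing the operator to normal form. -/
lemma cdet_mul_divided_power {N : ℕ} (P : ℕ → R) (X : Fin N → Fin N → R)
    (h0 : ∀ i j, X i j * P 0 = P 0 * X i j)
    (hs : ∀ i j k, X i j * P (k + 1) = P (k + 1) * X i j + if i = j then P k else 0) (k : ℕ) :
    cdet X * P k = ∑ p ∈ Finset.HasAntidiagonal.antidiagonal k, P p.1 * (cdetPoly X).coeff p.2 := by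
  simp_rw [cdetPoly_coeff, Finset.mul_sum]
  rw [Finset.sum_comm]
  unfold cdet
  rw [Finset.sum_mul]
  refine Finset.sum_congr rfl fun π _ => ?_
  rw [smul_mul_assoc, list_prod_mul_divided_power P (fun m => X (π m) m) (fun m => π m = m)
    (fun m => h0 _ _) (fun m k => hs _ _ k), Finset.smul_sum]
  exact Finset.sum_congr rfl fun p _ => (mul_smul_comm _ _ _).symm

end ColumnDeterminant

end EllipticBethe
namespace EllipticBethe

/-! ### The coefficients of the RST operator on zero-weight functions -/

section RSTCoefficients

universe u

variable {N n : ℕ} (V : Fin n → Type u) [∀ s, AddCommGroup (V s)] [∀ s, Module ℂ (V s)]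

lemma tmap_apply_apply {M M' M'' W W' W'' : Type*} [AddCommGroup M] [AddCommGroup M']
    [AddCommGroup M''] [AddCommGroup W] [AddCommGroup W'] [AddCommGroup W'']
    [Module ℂ M] [Module ℂ M'] [Module ℂ M''] [Module ℂ W] [Module ℂ W'] [Module ℂ W'']
    (f : M' →ₗ[ℂ] M'') (g : M →ₗ[ℂ] M') (A : W' →ₗ[ℂ] W'') (B : W →ₗ[ℂ] W') (y : M ⊗[ℂ] W) :
    TensorProduct.map f A (TensorProduct.map g B y) = TensorProduct.map (f ∘ₗ g) (A ∘ₗ B) y := by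
  rw [TensorProduct.map_comp]; rfl

variable (x : ℂ)

/-- Restriction of `V`-valued functions to `x' = x`. -/
noncomputable abbrev evalXT (N : ℕ) (x : ℂ) (W : Type*) [AddCommGroup W] [Module ℂ W] :
    MerX N x ⊗[ℂ] W →ₗ[ℂ] MerLam N ⊗[ℂ] W := (evalX N x).rTensor W

/-- `V`-valued functions of `λ` as functions of `x', λ`. -/
noncomputable abbrev constXT (N : ℕ) (x : ℂ) (W : Type*) [AddCommGroup W] [Module ℂ W] :
    MerLam N ⊗[ℂ] W →ₗ[ℂ] MerX N x ⊗[ℂ] W := (constX N x).rTensor W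

/-- `∂_{x'}` on `V`-valued functions. -/
noncomputable abbrev derivXT (N : ℕ) (x : ℂ) (W : Type*) [AddCommGroup W] [Module ℂ W] :
    Module.End ℂ (MerX N x ⊗[ℂ] W) :=
  (Mer.derivOp (slice_analytic N x) ((1 : ℂ), (0 : Cartan N))).rTensor W

variable {W : Type*} [AddCommGroup W] [Module ℂ W]

lemma evalXT_map_mulOp {f : ℂ × Cartan N → ℂ} {f' : Cartan N → ℂ} (hf) (hf')
    (h : ∀ p, f (x, p) = f' p) (A : Module.End ℂ W) (w : MerX N x ⊗[ℂ] W) :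
    evalXT N x W (TensorProduct.map (Mer.mulOp (slice_analytic N x) f hf) A w) =
      TensorProduct.map (Mer.mulOp (id_analytic N) f' hf') A (evalXT N x W w) := by
  rw [evalXT, LinearMap.rTensor, tmap_apply_apply, tmap_apply_apply,
    evalX_comp_mulOp N x hf hf' h]
  rfl

lemma evalXT_derivOp (u : Cartan N) (w : MerX N x ⊗[ℂ] W) :
    evalXT N x W ((Mer.derivOp (slice_analytic N x) ((0 : ℂ), u)).rTensor W w) =
      (Mer.derivOp (id_analytic N) u).rTensor W (evalXT N x W w) := by
  rw [evalXT, ← LinearMap.rTensor_comp_apply, ← LinearMap.rTensor_comp_apply, evalX_comp_derivOp]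

lemma derivXT_constXT (ψ : MerLam N ⊗[ℂ] W) : derivXT N x W (constXT N x W ψ) = 0 := by
  rw [derivXT, constXT, ← LinearMap.rTensor_comp_apply, derivOp_x_comp_constX]
  simp

lemma derivOp_constXT (u : Cartan N) (ψ : MerLam N ⊗[ℂ] W) :
    (Mer.derivOp (slice_analytic N x) ((0 : ℂ), u)).rTensor W (constXT N x W ψ) =
      constXT N x W ((Mer.derivOp (id_analytic N) u).rTensor W ψ) := by
  rw [constXT, ← LinearMap.rTensor_comp_apply, ← LinearMap.rTensor_comp_apply,
    derivOp_comp_constX]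

lemma evalXT_constXT (ψ : MerLam N ⊗[ℂ] W) : evalXT N x W (constXT N x W ψ) = ψ := by
  rw [evalXT, constXT, ← LinearMap.rTensor_comp_apply, evalX_comp_constX]
  simp

lemma lTensor_constXT (A : Module.End ℂ W) (ψ : MerLam N ⊗[ℂ] W) :
    A.lTensor _ (constXT N x W ψ) = constXT N x W (A.lTensor _ ψ) := by
  rw [constXT, ← LinearMap.comp_apply, ← LinearMap.comp_apply, LinearMap.lTensor_comp_rTensor,
    LinearMap.rTensor_comp_lTensor]

lemma map_eq_zero_of_lTensor {M : Type*} [AddCommGroup M] [Module ℂ M] (f : Module.End ℂ M)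
    {A : Module.End ℂ W} {w : M ⊗[ℂ] W} (h : A.lTensor M w = 0) : TensorProduct.map f A w = 0 := by
  have : TensorProduct.map f A w = f.rTensor W (A.lTensor M w) := by
    rw [LinearMap.rTensor, LinearMap.lTensor, tmap_apply_apply]
    rfl
  rw [this, h, map_zero]

lemma derivXT_map_mulOp {f : ℂ × Cartan N → ℂ} (hf) (A : Module.End ℂ W) (w : MerX N x ⊗[ℂ] W) :
    derivXT N x W (TensorProduct.map (Mer.mulOp (slice_analytic N x) f hf) A w) =
      TensorProduct.map (Mer.mulOp (slice_analytic N x) f hf) A (derivXT N x W w) +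
      TensorProduct.map (Mer.mulOp (slice_analytic N x) _
        (hf.dirDeriv (slice_analytic N x) ((1 : ℂ), (0 : Cartan N)))) A w := by
  rw [derivXT, LinearMap.rTensor, tmap_apply_apply, tmap_apply_apply]
  have := Mer.derivOp_mul_mulOp (slice_analytic N x) ((1 : ℂ), (0 : Cartan N)) f hf
  rw [Module.End.mul_eq_comp, Module.End.mul_eq_comp] at this
  rw [this, TensorProduct.map_add_left]
  rfl

variable [∀ s, LieRingModule (Matrix (Fin N) (Fin N) ℂ) (V s)]
  [∀ s, LieModule ℂ (Matrix (Fin N) (Fin N) ℂ) (V s)]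

lemma Lmat_mul_monomialOp (τ : ℍ) (z : Fin n → ℂ) (x : Reg τ z) (j l : Fin N) (k : ℕ) :
    Lmat V τ z x j l * (monomialOp N x.1 k).rTensor _ =
      (monomialOp N x.1 k).rTensor _ * Lmat V τ z x j l := by
  have h : ∀ (f : ℂ × Cartan N → ℂ) (hf) (A : Module.End ℂ (⨂[ℂ] s, V s)),
      Commute (TensorProduct.map (Mer.mulOp (slice_analytic N x.1) f hf) A)
        ((monomialOp N x.1 k).rTensor _) := by
    intro f hf A
    have h1 : Mer.mulOp (slice_analytic N x.1) f hf * monomialOp N x.1 k =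
        monomialOp N x.1 k * Mer.mulOp (slice_analytic N x.1) f hf := by
      rw [monomialOp, Mer.mulOp_mul, Mer.mulOp_mul]
      exact Mer.mulOp_congr' _ (funext fun y => mul_comm _ _) _ _
    rw [Module.End.mul_eq_comp, Module.End.mul_eq_comp] at h1
    rw [commute_iff_eq, LinearMap.rTensor, Module.End.mul_eq_comp, Module.End.mul_eq_comp,
      ← TensorProduct.map_comp, ← TensorProduct.map_comp, h1]
    rfl
  unfold Lmat
  split_ifs
  · exact (Commute.sum_left _ _ _ fun k _ => h _ _ _).add_left
      (Commute.sum_left _ _ _ fun k _ => h _ _ _)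
  · exact Commute.sum_left _ _ _ fun k _ => h _ _ _

/-- `S_j(x)` through the coefficients of `cdet (X + t)`. -/
lemma rstCoeffAux_eq (τ : ℍ) (z : Fin n → ℂ) (x : Reg τ z) (k : ℕ)
    (ψ : MerLam N ⊗[ℂ] (⨂[ℂ] s, V s)) :
    rstCoeffAux V τ z x k ψ = evalXT N x.1 _ ((cdetPoly (Xmat V τ z x)).coeff k
      (constXT N x.1 _ ψ)) := by
  have h0 : (monomialOp N x.1 0).rTensor (⨂[ℂ] s, V s) = 1 := by
    rw [monomialOp_zero]
    exact LinearMap.rTensor_id _ _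
  have key := cdet_mul_divided_power (fun k => (monomialOp N x.1 k).rTensor (⨂[ℂ] s, V s))
    (Xmat V τ z x) (fun i j => by rw [h0, mul_one, one_mul]) (fun i j k => by
      unfold Xmat
      rw [add_mul, mul_add, Lmat_mul_monomialOp, add_right_comm]
      congr 1
      split_ifs with hij
      · rw [← LinearMap.rTensor_mul, ← LinearMap.rTensor_mul, ← LinearMap.rTensor_add, sub_mul,
          mul_sub, derivOp_lam_mul_monomialOp, derivOp_x_mul_monomialOp_succ, sub_add_eq_add_sub]
      · simp) k
  have e1 : rstCoeffAux V τ z x k ψ = evalXT N x.1 _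
      ((cdet (Xmat V τ z x) * (monomialOp N x.1 k).rTensor (⨂[ℂ] s, V s) :
        Module.End ℂ (MerX N x.1 ⊗[ℂ] (⨂[ℂ] s, V s))) (constXT N x.1 _ ψ)) := rfl
  -- Positive powers of `x' - x` vanish on restriction to `x' = x`, so only the term with index `0`
  -- remains.
  rw [e1, key, LinearMap.sum_apply, map_sum, Finset.sum_eq_single (0, k)]
  · rw [h0, one_mul]
  · rintro ⟨i, j⟩ hp hne
    cases i with
    | zero =>
      refine absurd ?_ hne
      simp only [Finset.HasAntidiagonal.mem_antidiagonal, zero_add] at hp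
      rw [hp]
    | succ i =>
      rw [Module.End.mul_apply, evalXT, ← LinearMap.rTensor_comp_apply, evalX_comp_monomialOp]
      simp
  · simp

/-- `-∂_{λ_a} + ∑_s ρ(x - z_s) e_{aa}^{(s)}`. -/
noncomputable def diagOp (τ : ℍ) (z : Fin n → ℂ) (x : ℂ) (a : Fin N) :
    Module.End ℂ (MerLam N ⊗[ℂ] (⨂[ℂ] s, V s)) :=
  (-1 : ℂ) • (Mer.derivOp (id_analytic N) (Pi.single a 1 : Cartan N)).rTensor _ +
    ∑ s, rho τ (x - z s) • (e V a a s).lTensor (MerLam N)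

/-- The dynamical terms `ρ(λ_am) e_mm` contain the total weight operators, which kill `w`. -/
lemma Xmat_diag_apply (τ : ℍ) (z : Fin n → ℂ) (x : Reg τ z) (a : Fin N)
    {w : MerX N x.1 ⊗[ℂ] (⨂[ℂ] s, V s)} (hw : ∀ m : Fin N, (eTot V m).lTensor _ w = 0) :
    Xmat V τ z x a a w = derivXT N x.1 _ w -
      (Mer.derivOp (slice_analytic N x.1) ((0 : ℂ), (Pi.single a 1 : Cartan N))).rTensor _ w +
      ∑ s, TensorProduct.map (Mer.mulOp _ _ (rho_x N τ (x.2 s))) (e V a a s) w := by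
  unfold Xmat Lmat
  rw [if_pos rfl, if_pos rfl, LinearMap.add_apply, LinearMap.add_apply, LinearMap.rTensor_sub,
    LinearMap.sub_apply, LinearMap.sum_apply, LinearMap.sum_apply,
    Finset.sum_eq_zero (s := Finset.univ.filter fun m => m ≠ a), add_zero]
  exact fun m _ => map_eq_zero_of_lTensor _ (hw m)

lemma map_mulOp_const (c : ℂ) (hc : IsMer (id : Cartan N → Cartan N) (fun _ => 1) fun _ => c)
    (A : Module.End ℂ W) : TensorProduct.map (Mer.mulOp (id_analytic N) (fun _ => c) hc) A =
      c • A.lTensor (MerLam N) := by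
  rw [Mer.mulOp_const, TensorProduct.map_smul_left]
  rfl

lemma evalXT_Xmat_diag (τ : ℍ) (z : Fin n → ℂ) (x : Reg τ z) (a : Fin N)
    {w : MerX N x.1 ⊗[ℂ] (⨂[ℂ] s, V s)} (hw : ∀ m : Fin N, (eTot V m).lTensor _ w = 0) :
    evalXT N x.1 _ (Xmat V τ z x a a w) = evalXT N x.1 _ (derivXT N x.1 _ w) +
      diagOp V τ z x.1 a (evalXT N x.1 _ w) := by
  rw [Xmat_diag_apply V τ z x a hw, map_add, map_sub, evalXT_derivOp, map_sum, diagOp,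
    LinearMap.add_apply, LinearMap.smul_apply, neg_one_smul, LinearMap.sum_apply, sub_add, sub_eq_add_neg,
    neg_sub', sub_neg_eq_add]
  congr 2
  refine Finset.sum_congr rfl fun s _ => ?_
  rw [evalXT_map_mulOp x.1 _ (IsMer.const (rho τ (x.1 - z s))) (fun p => rfl), map_mulOp_const]

/-- The function is constant in `x'`, so the only surviving effect of `∂_x` is that of the left
factor on the coefficients `ρ(x' - z_s)` of the right one. Weight-zero entries preserve the
zero-weight condition, so the dynamical terms drop out at both stages. -/
lemma evalXT_Xmat_diag_diag (τ : ℍ) (z : Fin n → ℂ) (x : Reg τ z) (a b : Fin N)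
    {ψ : MerLam N ⊗[ℂ] (⨂[ℂ] s, V s)} (hψ : ψ ∈ FunZero N V) :
    evalXT N x.1 _ ((Xmat V τ z x a a * Xmat V τ z x b b) (constXT N x.1 _ ψ)) =
      diagOp V τ z x.1 a (diagOp V τ z x.1 b ψ) +
        ∑ s, deriv (rho τ) (x.1 - z s) • (e V b b s).lTensor (MerLam N) ψ := by
  have h0 : ∀ m, (eTot V m).lTensor _ (constXT N x.1 _ ψ) = 0 := fun m => by
    simp only [FunZero, Submodule.mem_iInf, LinearMap.mem_ker] at hψ
    rw [lTensor_constXT, hψ m, map_zero]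
  have h1 : ∀ m, (eTot V m).lTensor _ (Xmat V τ z x b b (constXT N x.1 _ ψ)) = 0 := fun m => by
    have := LinearMap.congr_fun (Xmat_wt (V := V) τ z x b b m) (constXT N x.1 _ ψ)
    simpa [h0] using this
  rw [Module.End.mul_apply, evalXT_Xmat_diag V τ z x a h1, evalXT_Xmat_diag V τ z x b h0,
    derivXT_constXT, map_zero, zero_add, evalXT_constXT, add_comm, Xmat_diag_apply V τ z x b h0,
    derivXT_constXT, zero_sub, map_add, map_neg, derivOp_constXT, derivXT_constXT, neg_zero,
    zero_add, map_sum, map_sum]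
  congr 1
  refine Finset.sum_congr rfl fun s _ => ?_
  rw [derivXT_map_mulOp, derivXT_constXT, map_zero, zero_add,
    evalXT_map_mulOp x.1 _ (IsMer.const (deriv (rho τ) (x.1 - z s))) (fun p => ?_),
    map_mulOp_const, evalXT_constXT]
  · rfl
  · refine fderiv_comp_fst (r := fun t => rho τ (t - z s)) ?_
    have h := rho_hasDerivAt τ (theta_ne_zero τ (x.2 s))
    rw [← h.deriv] at h
    exact HasDerivAt.comp_sub_const x.1 (z s) h

lemma sigma_lam_pos (N : ℕ) (τ : ℍ) (a : ℂ) (j l : Fin N) :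
    IsMer (id : Cartan N → Cartan N) (fun _ => 1) (fun p => sigma τ a (p j - p l)) :=
  IsMer.comp_lam (sigma_mer τ a) j l

lemma evalXT_Xmat_offdiag (τ : ℍ) (z : Fin n → ℂ) (x : Reg τ z) {a b : Fin N} (hab : a ≠ b)
    (w : MerX N x.1 ⊗[ℂ] (⨂[ℂ] s, V s)) :
    evalXT N x.1 _ (Xmat V τ z x b a w) = ∑ s, TensorProduct.map
      (Mer.mulOp _ _ (sigma_lam_pos N τ (x.1 - z s) a b)) (e V a b s) (evalXT N x.1 _ w) := by
  unfold Xmat Lmat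
  rw [if_neg hab.symm, if_neg hab.symm, zero_add, LinearMap.sum_apply, map_sum]
  refine Finset.sum_congr rfl fun s _ => ?_
  exact evalXT_map_mulOp x.1 _ _ (fun p => rfl) _ _

lemma evalXT_Xmat_offdiag_offdiag (τ : ℍ) (z : Fin n → ℂ) (x : Reg τ z) {a b : Fin N}
    (hab : a ≠ b) (ψ : MerLam N ⊗[ℂ] (⨂[ℂ] s, V s)) :
    evalXT N x.1 _ ((Xmat V τ z x b a * Xmat V τ z x a b) (constXT N x.1 _ ψ)) =
      ∑ s, ∑ p, TensorProduct.map (Mer.mulOp _ _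
        ((sigma_lam_pos N τ (x.1 - z s) a b).mul (id_analytic N)
          (sigma_lam_pos N τ (x.1 - z p) b a))) (Om V a b s p) ψ := by
  rw [Module.End.mul_apply, evalXT_Xmat_offdiag V τ z x hab, evalXT_Xmat_offdiag V τ z x hab.symm,
    evalXT_constXT]
  refine Finset.sum_congr rfl fun s _ => ?_
  rw [map_sum]
  refine Finset.sum_congr rfl fun p _ => ?_
  rw [tmap_apply_apply, ← Mer.mulOp_mul]
  rfl

/-- The explicit form of `S_2(x)` on `V[0]`-valued functions. -/
lemma rstCoeffAux_pred_pred (τ : ℍ) (z : Fin n → ℂ) (x : Reg τ z) {k : ℕ} (hk : k + 2 = N)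
    {ψ : MerLam N ⊗[ℂ] (⨂[ℂ] s, V s)} (hψ : ψ ∈ FunZero N V) :
    rstCoeffAux V τ z x k ψ = ∑ a, ∑ b ∈ Finset.univ.filter (fun b => a < b),
      (diagOp V τ z x.1 a (diagOp V τ z x.1 b ψ) +
        ∑ s, deriv (rho τ) (x.1 - z s) • (e V b b s).lTensor (MerLam N) ψ -
        ∑ s, ∑ p, TensorProduct.map (Mer.mulOp _ _
          ((sigma_lam_pos N τ (x.1 - z s) a b).mul (id_analytic N)
            (sigma_lam_pos N τ (x.1 - z p) b a))) (Om V a b s p) ψ) := by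
  rw [rstCoeffAux_eq, cdetPoly_coeff_pred_pred hk, LinearMap.sum_apply, map_sum]
  refine Finset.sum_congr rfl fun a _ => ?_
  rw [LinearMap.sum_apply, map_sum]
  refine Finset.sum_congr rfl fun b hb => ?_
  have hab : a < b := (Finset.mem_filter.1 hb).2
  rw [LinearMap.sub_apply, map_sub, evalXT_Xmat_diag_diag V τ z x a b hψ,
    evalXT_Xmat_offdiag_offdiag V τ z x hab.ne]

end RSTCoefficients

end EllipticBethe
namespace EllipticBethe

/-! ### Symmetrization of double sums -/

section DoubleSums

variable {U : Type*} [AddCommGroup U]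

lemma sum_sum_eq_diag_add_lt {N : ℕ} (f : Fin N → Fin N → U) :
    ∑ a, ∑ b, f a b = ∑ a, f a a + ∑ a, ∑ b ∈ Finset.univ.filter (fun b => a < b),
      (f a b + f b a) := by
  have h : ∀ a b, f a b = (if b = a then f a b else 0) + ((if a < b then f a b else 0) +
      (if b < a then f a b else 0)) := by
    intro a b
    rcases lt_trichotomy a b with h | h | h
    · simp [h, h.ne', h.not_gt]
    · simp [h]
    · simp [h, h.ne, h.not_gt]
  have h2 : ∑ a, ∑ b, (if b < a then f a b else 0) = ∑ a, ∑ b, if a < b then f b a else 0 :=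
    Finset.sum_comm
  conv_lhs => enter [2, a, 2, b]; rw [h a b]
  simp only [Finset.sum_add_distrib, Finset.sum_filter, h2]
  simp

lemma sum_ne_eq_lt {N : ℕ} (f : Fin N → Fin N → U) :
    ∑ a, ∑ b ∈ Finset.univ.filter (fun b => b ≠ a), f a b =
      ∑ a, ∑ b ∈ Finset.univ.filter (fun b => a < b), (f a b + f b a) := by
  have h := sum_sum_eq_diag_add_lt fun a b => if b ≠ a then f a b else 0
  simp only [ne_eq, not_true_eq_false, if_false, Finset.sum_const_zero, zero_add] at h
  simp only [Finset.sum_filter, ne_eq] at h ⊢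
  rw [h]
  refine Finset.sum_congr rfl fun a _ => Finset.sum_congr rfl fun b _ => ?_
  by_cases hab : a < b
  · simp [hab, hab.ne, hab.ne']
  · simp [hab]

lemma sum_comm_four {α β γ δ : Type*} (A : Finset α) (B : α → Finset β) (C : Finset γ)
    (D : γ → Finset δ) (f : α → β → γ → δ → U) :
    ∑ a ∈ A, ∑ b ∈ B a, ∑ c ∈ C, ∑ d ∈ D c, f a b c d =
      ∑ c ∈ C, ∑ d ∈ D c, ∑ a ∈ A, ∑ b ∈ B a, f a b c d := by
  calc _ = ∑ a ∈ A, ∑ c ∈ C, ∑ b ∈ B a, ∑ d ∈ D c, f a b c d :=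
        Finset.sum_congr rfl fun a _ => Finset.sum_comm
    _ = ∑ c ∈ C, ∑ a ∈ A, ∑ b ∈ B a, ∑ d ∈ D c, f a b c d := Finset.sum_comm
    _ = ∑ c ∈ C, ∑ a ∈ A, ∑ d ∈ D c, ∑ b ∈ B a, f a b c d :=
        Finset.sum_congr rfl fun c _ => Finset.sum_congr rfl fun a _ => Finset.sum_comm
    _ = _ := Finset.sum_congr rfl fun c _ => Finset.sum_comm

variable [Module ℂ U]

/-- The contribution of `Ω_0` to the second coefficient. -/
lemma sum_mul_smul_of_three_term {n : ℕ} (r r' : Fin n → ℂ) (h e : Fin n → Fin n → ℂ) (e0 : ℂ)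
    (w : Fin n → Fin n → U)
    (hr : ∀ s p, s ≠ p → r s * r p = 1 / 2 * e s p + (r s - r p) * h s p +
      1 / 2 * (r s ^ 2 + r' s) + 1 / 2 * (r p ^ 2 + r' p) - 1 / 2 * e0)
    (he : ∀ s, e s s = e0) (hh : ∀ s p, h p s = -h s p) (hw : ∀ s p, w s p = w p s)
    (hw0 : ∀ s, ∑ p, w s p = 0) :
    ∑ s, ∑ p, (r s * r p) • w s p = ∑ s, ∑ p, (1 / 2 * e s p) • w s p +
      (2 : ℂ) • ∑ s, r s • ∑ p ∈ Finset.univ.filter (fun p => p ≠ s), h s p • w s p -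
      ∑ s, r' s • w s s := by
  have h0 : ∀ s, h s s = 0 := fun s => self_eq_neg.1 (hh s s)
  have hfil : ∀ s, ∑ p ∈ Finset.univ.filter (fun p => p ≠ s), h s p • w s p =
      ∑ p, h s p • w s p := by
    intro s
    rw [Finset.sum_filter]
    refine Finset.sum_congr rfl fun p _ => ?_
    split_ifs with hp
    · rfl
    · rw [not_not.1 hp, h0, zero_smul]
  -- The three-term relation is assumed only for `s ≠ p`. On the diagonal its right side would be
  -- `r_s² + r'_s` instead of `r_s²`; the last term corrects this and is the source of the `r'`
  -- contribution.
  have key : ∀ s p, (r s * r p) • w s p = (1 / 2 * e s p) • w s p + (r s * h s p) • w s p +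
      (r p * h p s) • w p s + (1 / 2 * (r s ^ 2 + r' s) - 1 / 2 * e0) • w s p +
      (1 / 2 * (r p ^ 2 + r' p)) • w p s - if s = p then r' s • w s s else 0 := by
    intro s p
    rw [hw p s, hh s p]
    by_cases hsp : s = p
    · subst hsp
      rw [if_pos rfl, h0, he]
      module
    · rw [if_neg hsp, hr s p hsp]
      module
  -- Coefficients depending on a single index contribute nothing, since the row sums of `w` vanish.
  have c1 : ∀ g : Fin n → ℂ, ∑ s, ∑ p, g s • w s p = 0 := fun g =>
    Finset.sum_eq_zero fun s _ => by rw [← Finset.smul_sum, hw0, smul_zero]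
  have c2 : ∀ g : Fin n → ℂ, ∑ s, ∑ p, g p • w p s = 0 := fun g => by
    rw [Finset.sum_comm, c1]
  have c3 : ∑ s, ∑ p, (r p * h p s) • w p s = ∑ s, ∑ p, (r s * h s p) • w s p := Finset.sum_comm
  conv_lhs => enter [2, s, 2, p]; rw [key s p]
  simp only [Finset.sum_add_distrib, Finset.sum_sub_distrib]
  rw [c1 fun s => 1 / 2 * (r s ^ 2 + r' s) - 1 / 2 * e0, c2 fun p => 1 / 2 * (r p ^ 2 + r' p), c3]
  simp only [hfil, Finset.smul_sum, smul_smul, Finset.sum_ite_eq, Finset.mem_univ, if_true]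
  rw [add_zero, add_zero, add_assoc, ← Finset.sum_add_distrib]
  congr 2
  refine Finset.sum_congr rfl fun s _ => ?_
  rw [← Finset.sum_add_distrib]
  refine Finset.sum_congr rfl fun p _ => ?_
  module

/-- The contribution of `Ω_{ab}`, `a ≠ b`, to the second coefficient. -/
lemma sum_offdiag_of_relations {N n : ℕ} (r r' : Fin n → ℂ) (K S F : Fin N → Fin N → Fin n → Fin n → U)
    (O : Fin N → Fin N → Fin n → U)
    (hK : ∀ a b s p, a ≠ b → s ≠ p → K a b s p = (r s - r p) • S a b s p - F a b s p)
    (hKd : ∀ a b s, a ≠ b → K a b s s = -F a b s s - r' s • O a b s)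
    (hKs : ∀ a b s p, a ≠ b → s ≠ p → K b a p s = K a b s p)
    (hS : ∀ a b s p, a ≠ b → s ≠ p → S b a p s = -S a b s p)
    (hF : ∀ a b, a ≠ b → ∑ s, F a b s s = ∑ s, F b a s s) :
    (2 : ℂ) • ∑ a, ∑ b ∈ Finset.univ.filter (fun b => a < b), ∑ s, ∑ p, K a b s p =
      (2 : ℂ) • ∑ s, r s • ∑ p ∈ Finset.univ.filter (fun p => p ≠ s),
        ∑ a, ∑ b ∈ Finset.univ.filter (fun b => b ≠ a), S a b s p -
      ∑ s, ∑ p, ∑ a, ∑ b ∈ Finset.univ.filter (fun b => b ≠ a), F a b s p -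
      (2 : ℂ) • ∑ a, ∑ b ∈ Finset.univ.filter (fun b => a < b), ∑ s, r' s • O a b s := by
  have hpair : ∀ a b, a < b → (2 : ℂ) • ∑ s, ∑ p, K a b s p =
      (2 : ℂ) • (∑ s, ∑ p ∈ Finset.univ.filter (fun p => p ≠ s), r s • S a b s p +
        ∑ s, ∑ p ∈ Finset.univ.filter (fun p => p ≠ s), r s • S b a s p) -
      (∑ s, ∑ p, F a b s p + ∑ s, ∑ p, F b a s p) - (2 : ℂ) • ∑ s, r' s • O a b s := by
    intro a b hab
    -- The terms for `(a, b, s, p)` and `(b, a, p, s)` are equal, so twice one is their sum; this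
    -- turns the coefficient `r_s - r_p` into `r_s` and `r_p` on matching terms. The discrepancy on
    -- the diagonal is `F b a s s - F a b s s`, which vanishes after summation over `s`.
    have key : ∀ s p, (2 : ℂ) • K a b s p = (2 : ℂ) • (if p ≠ s then r s • S a b s p else 0) +
        (2 : ℂ) • (if s ≠ p then r p • S b a p s else 0) - F a b s p - F b a p s +
        if s = p then (F b a s s - F a b s s - (2 : ℂ) • r' s • O a b s) else 0 := by
      intro s p
      by_cases hsp : s = p
      · subst hsp
        simp only [ne_eq, not_true_eq_false, if_false, if_true]
        rw [hKd a b s hab.ne]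
        module
      · simp only [ne_eq, hsp, Ne.symm hsp, not_false_eq_true, if_false, if_true]
        have h2 : (2 : ℂ) • K a b s p = K a b s p + K b a p s := by
          rw [hKs a b s p hab.ne hsp, two_smul]
        rw [h2, hK a b s p hab.ne hsp, hK b a p s hab.ne' (Ne.symm hsp), hS a b s p hab.ne hsp]
        module
    have c1 : ∑ s, ∑ p, (2 : ℂ) • (if s ≠ p then r p • S b a p s else 0) =
        ∑ s, ∑ p, (2 : ℂ) • (if p ≠ s then r s • S b a s p else 0) := Finset.sum_comm
    have c2 : ∑ s, ∑ p, F b a p s = ∑ s, ∑ p, F b a s p := Finset.sum_comm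
    simp only [Finset.smul_sum]
    conv_lhs => enter [2, s, 2, p]; rw [key s p]
    simp only [Finset.sum_add_distrib, Finset.sum_sub_distrib, Finset.sum_ite_eq, Finset.mem_univ,
      if_true]
    rw [c1, c2, hF a b hab.ne]
    simp only [Finset.sum_filter, smul_add, Finset.smul_sum]
    abel
  have e1 : ∑ s, r s • ∑ p ∈ Finset.univ.filter (fun p => p ≠ s),
        ∑ a, ∑ b ∈ Finset.univ.filter (fun b => b ≠ a), S a b s p =
      ∑ a, ∑ b ∈ Finset.univ.filter (fun b => a < b),
        (∑ s, ∑ p ∈ Finset.univ.filter (fun p => p ≠ s), r s • S a b s p +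
          ∑ s, ∑ p ∈ Finset.univ.filter (fun p => p ≠ s), r s • S b a s p) := by
    rw [← sum_ne_eq_lt fun a b =>
      ∑ s, ∑ p ∈ Finset.univ.filter (fun p => p ≠ s), r s • S a b s p, ← sum_comm_four]
    simp only [Finset.smul_sum]
  have e2 : ∑ s, ∑ p, ∑ a, ∑ b ∈ Finset.univ.filter (fun b => b ≠ a), F a b s p =
      ∑ a, ∑ b ∈ Finset.univ.filter (fun b => a < b),
        (∑ s, ∑ p, F a b s p + ∑ s, ∑ p, F b a s p) := by
    rw [← sum_ne_eq_lt fun a b => ∑ s, ∑ p, F a b s p, ← sum_comm_four]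
  rw [e1, e2]
  simp only [Finset.smul_sum (r := (2 : ℂ)), ← Finset.sum_sub_distrib]
  refine Finset.sum_congr rfl fun a _ => Finset.sum_congr rfl fun b hb => ?_
  have := hpair a b (Finset.mem_filter.1 hb).2
  simpa only [Finset.smul_sum (r := (2 : ℂ))] using this

/-- The second elementary symmetric function of commuting elements with sum zero. -/
lemma two_smul_sum_lt_mul {N : ℕ} {R : Type*} [Ring R] [Module ℂ R] (A : Fin N → R)
    (hc : ∀ a b, A a * A b = A b * A a) (h0 : ∑ a, A a = 0) :
    (2 : ℂ) • ∑ a, ∑ b ∈ Finset.univ.filter (fun b => a < b), A a * A b + ∑ a, A a * A a = 0 := by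
  have h := sum_sum_eq_diag_add_lt fun a b => A a * A b
  simp only [← Finset.mul_sum, h0, mul_zero, Finset.sum_const_zero] at h
  rw [add_comm, h]
  simp only [Finset.smul_sum, two_smul]
  congr 1
  exact Finset.sum_congr rfl fun a _ => Finset.sum_congr rfl fun b _ => by rw [hc b a]

end DoubleSums

end EllipticBethe
namespace EllipticBethe

/-! ### The commuting diagonal operators and the quadratic central element -/

section SecondCoefficient

universe u

variable {N n : ℕ} (V : Fin n → Type u) [∀ s, AddCommGroup (V s)] [∀ s, Module ℂ (V s)]
  [∀ s, LieRingModule (Matrix (Fin N) (Fin N) ℂ) (V s)]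
  [∀ s, LieModule ℂ (Matrix (Fin N) (Fin N) ℂ) (V s)]

lemma gl_commutator (a b : Fin N) (s : Fin n) :
    gl V a b s * gl V b a s = gl V b a s * gl V a b s + (gl V a a s - gl V b b s) := by
  have h1 : gl V a b s * gl V b a s - gl V b a s * gl V a b s =
      LieModule.toEnd ℂ (Matrix (Fin N) (Fin N) ℂ) (V s)
        ⁅Matrix.single a b (1 : ℂ), Matrix.single b a (1 : ℂ)⁆ := by
    rw [LieHom.map_lie]; rfl
  have h2 : ⁅Matrix.single a b (1 : ℂ), Matrix.single b a (1 : ℂ)⁆ =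
      Matrix.single a a 1 - Matrix.single b b 1 := by
    rw [Ring.lie_def]; simp
  rw [h2, map_sub] at h1
  rw [← sub_eq_iff_eq_add', h1]
  rfl

lemma gl_diag_comm (a b : Fin N) (s : Fin n) :
    gl V a a s * gl V b b s = gl V b b s * gl V a a s := by
  have h1 : gl V a a s * gl V b b s - gl V b b s * gl V a a s =
      LieModule.toEnd ℂ (Matrix (Fin N) (Fin N) ℂ) (V s)
        ⁅Matrix.single a a (1 : ℂ), Matrix.single b b (1 : ℂ)⁆ := by
    rw [LieHom.map_lie]; rfl
  have h2 : ⁅Matrix.single a a (1 : ℂ), Matrix.single b b (1 : ℂ)⁆ = 0 := by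
    rw [Ring.lie_def]
    by_cases h : a = b
    · subst h; simp
    · simp [h, Ne.symm h]
  rw [h2, map_zero] at h1
  exact sub_eq_zero.1 h1

lemma site_sub (k : Fin n) (A B : Module.End ℂ (V k)) :
    site V k (A - B) = site V k A - site V k B := by
  let f : Module.End ℂ (V k) →ₗ[ℂ] Module.End ℂ (⨂[ℂ] s, V s) :=
    { toFun := site V k, map_add' := site_add V k, map_smul' := site_smul V k }
  exact map_sub f A B

lemma e_commutator (a b : Fin N) (s : Fin n) :
    e V a b s * e V b a s = e V b a s * e V a b s + (e V a a s - e V b b s) := by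
  unfold e
  rw [site_mul_same, site_mul_same, gl_commutator V, site_add, site_sub]

lemma e_diag_comm (a b : Fin N) (s p : Fin n) : e V a a s * e V b b p = e V b b p * e V a a s := by
  by_cases h : s = p
  · subst h
    unfold e
    rw [site_mul_same, site_mul_same, gl_diag_comm]
  · exact site_comm V h _ _

lemma Om_comm {s p : Fin n} (hsp : s ≠ p) (a b : Fin N) : Om V b a p s = Om V a b s p :=
  site_comm V hsp.symm _ _

lemma Om0_comm (s p : Fin n) : Om0 N V s p = Om0 N V p s :=
  Finset.sum_congr rfl fun k _ => e_diag_comm V k k s p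

variable {V}

/-- The matrix units on the diagonal add up to the identity matrix, which acts by zero on an
`sl_N`-module extended to `gl_N`. -/
lemma sum_e_diag (hV : ∀ (s : Fin n) (v : V s), ⁅(1 : Matrix (Fin N) (Fin N) ℂ), v⁆ = 0)
    (s : Fin n) : ∑ a : Fin N, e V a a s = 0 := by
  let f : Module.End ℂ (V s) →ₗ[ℂ] Module.End ℂ (⨂[ℂ] s, V s) :=
    { toFun := site V s, map_add' := site_add V s, map_smul' := site_smul V s }
  have h : ∑ a : Fin N, gl V a a s = 0 := by
    unfold gl
    rw [← map_sum]
    have : ∑ a : Fin N, Matrix.single a a (1 : ℂ) = 1 := by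
      exact Matrix.sum_single_one
    rw [this]
    exact LinearMap.ext fun v => hV s v
  have := congrArg f h
  rw [map_sum, map_zero] at this
  exact this

/-- The terms with `ρ'(x - z_s)` combine to the quadratic central element. -/
lemma two_smul_casimir (hV : ∀ (s : Fin n) (v : V s), ⁅(1 : Matrix (Fin N) (Fin N) ℂ), v⁆ = 0)
    (s : Fin n) :
    (2 : ℂ) • ∑ a : Fin N, ∑ b ∈ Finset.univ.filter (fun b => a < b), (e V b b s + Om V a b s s) +
      Om0 N V s s = -((2 : ℂ) • casimir N V s) := by
  have h1 := two_smul_sum_lt_mul (fun a : Fin N => e V a a s)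
    (fun a b => e_diag_comm V a b s s) (sum_e_diag hV s)
  -- The linear terms leave `∑_{a<b} (e_aa + e_bb)`, a multiple of `∑_a e_aa`, hence zero.
  have h2 := sum_sum_eq_diag_add_lt fun a _ : Fin N => e V a a s
  rw [Finset.sum_comm] at h2
  simp only [sum_e_diag hV s, Finset.sum_const_zero, zero_add] at h2
  rw [casimir_eq]
  have h3 : Om0 N V s s = ∑ a, e V a a s * e V a a s := rfl
  rw [h3, eq_neg_of_add_eq_zero_right h1, ← sub_eq_zero]
  calc _ = (2 : ℂ) • ∑ a : Fin N, ∑ b ∈ Finset.univ.filter (fun b => a < b),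
        (e V a a s + e V b b s) := by
        simp only [Finset.smul_sum, ← Finset.sum_sub_distrib, ← Finset.sum_add_distrib,
          ← Finset.sum_neg_distrib]
        refine Finset.sum_congr rfl fun a _ => Finset.sum_congr rfl fun b _ => ?_
        rw [Om]
        module
    _ = 0 := by rw [← h2, smul_zero]

lemma sum_diagOp (hV : ∀ (s : Fin n) (v : V s), ⁅(1 : Matrix (Fin N) (Fin N) ℂ), v⁆ = 0)
    (τ : ℍ) (z : Fin n → ℂ) (x : ℂ) : ∑ a : Fin N, diagOp V τ z x a = 0 := by
  unfold diagOp
  rw [Finset.sum_add_distrib, ← Finset.smul_sum, Finset.sum_comm]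
  have h1 : ∑ a : Fin N, (Mer.derivOp (v := fun _ => (1 : ℂ)) (id_analytic N)
      (Pi.single a 1 : Cartan N)).rTensor (⨂[ℂ] s, V s) = 0 := by
    have := congrArg (LinearMap.rTensorHom (⨂[ℂ] s, V s)) (sum_derivOp_lam N)
    rw [map_sum, map_zero] at this
    exact this
  have h2 : ∀ s, ∑ a : Fin N, rho τ (x - z s) • (e V a a s).lTensor (MerLam N) = 0 := fun s => by
    have := congrArg (LinearMap.lTensorHom (R := ℂ) (MerLam N)) (sum_e_diag hV s)
    rw [map_sum, map_zero] at this
    rw [← Finset.smul_sum]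
    exact (congrArg _ this).trans (smul_zero _)
  rw [h1, smul_zero, zero_add]
  exact Finset.sum_eq_zero fun s _ => h2 s

variable (V) in
lemma diagOp_comm (τ : ℍ) (z : Fin n → ℂ) (x : ℂ) (a b : Fin N) :
    diagOp V τ z x a * diagOp V τ z x b = diagOp V τ z x b * diagOp V τ z x a := by
  have hd : ∀ a b, Commute ((Mer.derivOp (v := fun _ => (1 : ℂ)) (id_analytic N)
      (Pi.single a 1 : Cartan N)).rTensor (⨂[ℂ] s, V s)) ((Mer.derivOp (id_analytic N)
      (Pi.single b 1 : Cartan N)).rTensor (⨂[ℂ] s, V s)) := fun a b => by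
    rw [commute_iff_eq, ← LinearMap.rTensor_mul, ← LinearMap.rTensor_mul, Mer.derivOp_comm]
  have hde : ∀ (f : Module.End ℂ (MerLam N)) (A : Module.End ℂ (⨂[ℂ] s, V s)),
      Commute (f.rTensor (⨂[ℂ] s, V s)) (A.lTensor (MerLam N)) := fun f A => by
    rw [commute_iff_eq, Module.End.mul_eq_comp, Module.End.mul_eq_comp,
      LinearMap.rTensor_comp_lTensor, LinearMap.lTensor_comp_rTensor]
  have he : ∀ (a b : Fin N) (s p : Fin n), Commute ((e V a a s).lTensor (MerLam N)) ((e V b b p).lTensor (MerLam N)) :=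
    fun a b s p => by
      rw [commute_iff_eq, ← LinearMap.lTensor_mul, ← LinearMap.lTensor_mul, e_diag_comm]
  have hs : ∀ a b : Fin N, Commute ((Mer.derivOp (v := fun _ => (1 : ℂ)) (id_analytic N)
      (Pi.single a 1 : Cartan N)).rTensor (⨂[ℂ] s, V s))
      (∑ s, rho τ (x - z s) • (e V b b s).lTensor (MerLam N)) := fun a b =>
    Commute.sum_right _ _ _ fun s _ => (hde _ _).smul_right _
  have hss : Commute (∑ s, rho τ (x - z s) • (e V a a s).lTensor (MerLam N))
      (∑ s, rho τ (x - z s) • (e V b b s).lTensor (MerLam N)) :=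
    Commute.sum_right _ _ _ fun s _ => Commute.sum_left _ _ _ fun p _ =>
      ((he a b p s).smul_right _).smul_left _
  exact (((hd a b).smul_right _).smul_left _ |>.add_right ((hs a b).smul_left _)).add_left
    (((hs b a).symm.smul_right _).add_right hss)

variable (V) in
-- Derivatives in `λ` commute with `ρ(x - z_s) e_aa^(s)`, so the square has no derivative terms of
-- the coefficients. Summed over `a`, the cross terms become the first-order parts of the `H_s`, and
-- the quadratic ones the products with `Ω_0`.
lemma diagOp_sq (τ : ℍ) (z : Fin n → ℂ) (x : ℂ) (a : Fin N) :
    diagOp V τ z x a * diagOp V τ z x a + (2 : ℂ) • ∑ s, rho τ (x - z s) • TensorProduct.map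
        (Mer.derivOp (id_analytic N) (Pi.single a 1 : Cartan N)) (e V a a s) =
      (Mer.derivOp (id_analytic N) (Pi.single a 1 : Cartan N) ^ 2).rTensor _ +
      ∑ s, ∑ p, (rho τ (x - z s) * rho τ (x - z p)) • (Om V a a s p).lTensor (MerLam N) := by
  have h1 : ∀ (f : Module.End ℂ (MerLam N)) (A : Module.End ℂ (⨂[ℂ] s, V s)),
      f.rTensor (⨂[ℂ] s, V s) * A.lTensor (MerLam N) = TensorProduct.map f A := fun f A => by
    rw [Module.End.mul_eq_comp, LinearMap.rTensor_comp_lTensor]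
  have h2 : ∀ (f : Module.End ℂ (MerLam N)) (A : Module.End ℂ (⨂[ℂ] s, V s)),
      A.lTensor (MerLam N) * f.rTensor (⨂[ℂ] s, V s) = TensorProduct.map f A := fun f A => by
    rw [Module.End.mul_eq_comp, LinearMap.lTensor_comp_rTensor]
  have hEE : (∑ s, rho τ (x - z s) • (e V a a s).lTensor (MerLam N)) *
      (∑ s, rho τ (x - z s) • (e V a a s).lTensor (MerLam N)) =
      ∑ s, ∑ p, (rho τ (x - z s) * rho τ (x - z p)) • (Om V a a s p).lTensor (MerLam N) := by
    rw [Finset.sum_mul_sum]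
    refine Finset.sum_congr rfl fun s _ => Finset.sum_congr rfl fun p _ => ?_
    rw [smul_mul_smul_comm, ← LinearMap.lTensor_mul]
    rfl
  unfold diagOp
  rw [add_mul, mul_add, mul_add, pow_two, LinearMap.rTensor_mul, hEE, Finset.mul_sum,
    Finset.sum_mul]
  simp only [smul_mul_assoc, mul_smul_comm, h1, h2]
  simp only [smul_comm _ (-1 : ℂ), ← Finset.smul_sum]
  module

end SecondCoefficient

end EllipticBethe
namespace EllipticBethe

/-! ### The second coefficient through the KZB operators -/

section PartOne

universe u

/-- For `a ≠ b` the map `λ ↦ λ_a - λ_b` is open and surjective, so the complement of the poles is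
dense and open. Pointwise theta identities thereby become identities of operators. -/
lemma isNull_lam {N : ℕ} (τ : ℍ) {a b : Fin N} (hab : a ≠ b) {f g : Cartan N → ℂ}
    (h : ∀ p : Cartan N, theta τ (p a - p b) ≠ 0 → f p = g p) :
    IsNull (id : Cartan N → Cartan N) (fun p => f p - g p) := by
  let L : Cartan N →L[ℂ] ℂ := ContinuousLinearMap.proj (R := ℂ) (φ := fun _ : Fin N => ℂ) a -
    ContinuousLinearMap.proj (R := ℂ) (φ := fun _ : Fin N => ℂ) b
  have hL : Function.Surjective L := fun w => ⟨Pi.single a w, by simp [L, hab.symm]⟩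
  have hd : Dense (L ⁻¹' {w | theta τ w ≠ 0}) :=
    (theta_ne_zero_dense τ).preimage (L.isOpenMap hL)
  have ho : IsOpen (L ⁻¹' {w | theta τ w ≠ 0}) := (theta_ne_zero_isOpen τ).preimage L.continuous
  rw [← ho.interior_eq] at hd
  refine isNull_of_dense (A := fun p => p ∈ L ⁻¹' {w | theta τ w ≠ 0}) hd fun p hp => ?_
  filter_upwards [ho.mem_nhds hp] with q hq
  rw [h q hq, sub_self]

lemma Mer.mulOp_const_mul {G F : Type} [NormedAddCommGroup G] [NormedSpace ℂ G]
    [NormedAddCommGroup F] [NormedSpace ℂ F] {ι : G → F} {v : F} (hι : ∀ p, AnalyticAt ℂ ι p)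
    (c : ℂ) (f : F → ℂ) (hf : IsMer ι v f) (hcf : IsMer ι v fun y => c * f y) :
    Mer.mulOp hι (fun y => c * f y) hcf = c • Mer.mulOp hι f hf := by
  rw [← Mer.mulOp_mul hι (fun _ => c) f (IsMer.const c) hf, Mer.mulOp_const, smul_mul_assoc, one_mul]

variable {N n : ℕ} (V : Fin n → Type u) [∀ s, AddCommGroup (V s)] [∀ s, Module ℂ (V s)]
  [∀ s, LieRingModule (Matrix (Fin N) (Fin N) ℂ) (V s)]
  [∀ s, LieModule ℂ (Matrix (Fin N) (Fin N) ℂ) (V s)]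

/-- `σ(x - z_s, λ_{ab}) σ(x - z_p, λ_{ba}) Ω_{ab}^{(s,p)} ψ`. -/
noncomputable def sigmaSigmaOm (τ : ℍ) (z : Fin n → ℂ) (x : ℂ) (ψ : MerLam N ⊗[ℂ] (⨂[ℂ] s, V s))
    (a b : Fin N) (s p : Fin n) : MerLam N ⊗[ℂ] (⨂[ℂ] s, V s) :=
  TensorProduct.map (Mer.mulOp _ _ ((sigma_lam_pos N τ (x - z s) a b).mul (id_analytic N)
    (sigma_lam_pos N τ (x - z p) b a))) (Om V a b s p) ψ

/-- `σ(z_s - z_p, -λ_{ab}) Ω_{ab}^{(s,p)} ψ`. -/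
noncomputable def sigmaOm (τ : ℍ) (z : Fin n → ℂ) (ψ : MerLam N ⊗[ℂ] (⨂[ℂ] s, V s))
    (a b : Fin N) (s p : Fin n) : MerLam N ⊗[ℂ] (⨂[ℂ] s, V s) :=
  TensorProduct.map (Mer.mulOp _ _ (sigma_lam N τ (z s - z p) a b)) (Om V a b s p) ψ

/-- `φ(λ_{ab}, z_s - z_p) Ω_{ab}^{(s,p)} ψ`. -/
noncomputable def phiOm (τ : ℍ) (z : Fin n → ℂ) (ψ : MerLam N ⊗[ℂ] (⨂[ℂ] s, V s))
    (a b : Fin N) (s p : Fin n) : MerLam N ⊗[ℂ] (⨂[ℂ] s, V s) :=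
  TensorProduct.map (Mer.mulOp _ _ (phi_lam N τ (z s - z p) a b)) (Om V a b s p) ψ

variable {V} {τ : ℍ} {z : Fin n → ℂ} (ψ : MerLam N ⊗[ℂ] (⨂[ℂ] s, V s))

/-- `sigma_mul_sigma` with `u = x - z_s`, `v = x - z_p`, `l = λ_ab`; then `v - u = z_s - z_p`, as in
the KZB operators. -/
lemma sigmaSigmaOm_eq (hz : ∀ s p : Fin n, s ≠ p → z s - z p ∉ lattice τ) (x : Reg τ z)
    {a b : Fin N} {s p : Fin n} (hab : a ≠ b) (hsp : s ≠ p) :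
    sigmaSigmaOm V τ z x.1 ψ a b s p =
      (rho τ (x.1 - z s) - rho τ (x.1 - z p)) • sigmaOm V τ z ψ a b s p - phiOm V τ z ψ a b s p := by
  rw [eq_sub_iff_add_eq]
  unfold sigmaSigmaOm sigmaOm phiOm
  rw [← LinearMap.add_apply, ← LinearMap.smul_apply, ← TensorProduct.map_add_left,
    ← TensorProduct.map_smul_left, Mer.mulOp_add, ← Mer.mulOp_const_mul _ _ _ _
      ((IsMer.const (rho τ (x.1 - z s) - rho τ (x.1 - z p))).mul (id_analytic N)
        (sigma_lam N τ (z s - z p) a b))]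
  congr 2
  refine Mer.mulOp_congr _ _ _ _ _ (isNull_lam τ hab fun q hq => ?_)
  have h := sigma_mul_sigma τ (theta_ne_zero τ (x.2 s)) (theta_ne_zero τ (x.2 p))
    (by rw [sub_sub_sub_cancel_left]; exact theta_ne_zero τ (hz s p hsp)) hq
  rw [sub_sub_sub_cancel_left, neg_sub] at h
  rw [h, neg_sub]
  ring

/-- Here the value of `φ` at the removable singularity enters: `-φ(λ_ab, 0) = ρ'(λ_ab)` is the first
term in `sigma_mul_sigma_neg`. -/
lemma sigmaSigmaOm_self (x : Reg τ z) {a b : Fin N} {s : Fin n} (hab : a ≠ b) :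
    sigmaSigmaOm V τ z x.1 ψ a b s s =
      -phiOm V τ z ψ a b s s - deriv (rho τ) (x.1 - z s) • (Om V a b s s).lTensor (MerLam N) ψ := by
  have h : sigmaSigmaOm V τ z x.1 ψ a b s s + phiOm V τ z ψ a b s s =
      (-deriv (rho τ) (x.1 - z s)) • (Om V a b s s).lTensor (MerLam N) ψ := by
    rw [← LinearMap.smul_apply, ← map_mulOp_const _ (IsMer.const _)]
    unfold sigmaSigmaOm phiOm
    rw [← LinearMap.add_apply, ← TensorProduct.map_add_left, Mer.mulOp_add]
    congr 2
    refine Mer.mulOp_congr _ _ _ _ _ (isNull_lam τ hab fun q hq => ?_)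
    have h := sigma_mul_sigma_neg τ (theta_ne_zero τ (x.2 s)) hq
    rw [neg_sub] at h
    rw [mul_comm, phi, if_pos (sub_self _), mul_comm, h]
    ring
  rw [eq_sub_of_add_eq h, neg_smul]
  abel

lemma sigmaSigmaOm_comm (x : ℂ) {a b : Fin N} {s p : Fin n} (hsp : s ≠ p) :
    sigmaSigmaOm V τ z x ψ b a p s = sigmaSigmaOm V τ z x ψ a b s p := by
  unfold sigmaSigmaOm
  rw [Om_comm V hsp]
  congr 2
  exact Mer.mulOp_congr' _ (funext fun y => mul_comm _ _) _ _

lemma sigmaOm_comm {a b : Fin N} {s p : Fin n} (hsp : s ≠ p) :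
    sigmaOm V τ z ψ b a p s = -sigmaOm V τ z ψ a b s p := by
  unfold sigmaOm
  rw [Om_comm V hsp, ← neg_one_smul ℂ, ← LinearMap.smul_apply, ← TensorProduct.map_smul_left,
    ← Mer.mulOp_const_mul _ _ _ _ ((IsMer.const (-1)).mul (id_analytic N)
        (sigma_lam N τ (z s - z p) a b))]
  congr 2
  refine Mer.mulOp_congr' _ (funext fun y => ?_) _ _
  rw [neg_one_mul, ← sigma_neg_neg]
  congr 1 <;> ring

lemma lTensor_eTot (hψ : ψ ∈ FunZero N V) (m : Fin N) : (eTot V m).lTensor (MerLam N) ψ = 0 := by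
  simp only [FunZero, Submodule.mem_iInf, LinearMap.mem_ker] at hψ
  exact hψ m

lemma sum_Om_self (a b : Fin N) :
    ∑ s, Om V a b s s + eTot V b = ∑ s, Om V b a s s + eTot V a := by
  unfold eTot Om
  rw [← Finset.sum_add_distrib, ← Finset.sum_add_distrib]
  refine Finset.sum_congr rfl fun s _ => ?_
  rw [e_commutator]
  abel

/-- `φ(λ_ab, 0)` is symmetric in `a` and `b` because `ρ'` is even. Exchanging `e_ab` and `e_ba`
costs `e_aa - e_bb`, whose sum over all sites is a total weight and kills `ψ`; single sites do not
satisfy the identity in general. -/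
lemma sum_phiOm_self (hψ : ψ ∈ FunZero N V) (a b : Fin N) :
    ∑ s, phiOm V τ z ψ a b s s = ∑ s, phiOm V τ z ψ b a s s := by
  have h1 : ∀ a b : Fin N, ∑ s, phiOm V τ z ψ a b s s = TensorProduct.map
      (Mer.mulOp _ _ (phi_lam N τ 0 a b)) (∑ s, Om V a b s s) ψ := by
    intro a b
    have : ∀ s, phiOm V τ z ψ a b s s = TensorProduct.map
      (Mer.mulOp _ _ (phi_lam N τ 0 a b)) (Om V a b s s) ψ := fun s => by
      unfold phiOm
      rw [Mer.mulOp_congr' _ (g := fun p : Cartan N => phi τ (p a - p b) 0) (by rw [sub_self]) _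
        (phi_lam N τ 0 a b)]
    rw [Finset.sum_congr rfl fun s _ => this s]
    have h := map_sum (TensorProduct.mapBilinear (RingHom.id ℂ) (MerLam N) (⨂[ℂ] s, V s) (MerLam N)
      (⨂[ℂ] s, V s) (Mer.mulOp _ _ (phi_lam N τ 0 a b))) (fun s => Om V a b s s) Finset.univ
    simp only [TensorProduct.mapBilinear_apply] at h
    rw [h, LinearMap.sum_apply]
  have h2 : Mer.mulOp (id_analytic N) _ (phi_lam N τ 0 a b) =
      Mer.mulOp (id_analytic N) _ (phi_lam N τ 0 b a) := by
    refine Mer.mulOp_congr' _ (funext fun p => ?_) _ _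
    rw [phi, phi, if_pos rfl, if_pos rfl, ← rho_deriv_neg, neg_sub]
  have h3 := congrArg (fun A => TensorProduct.map (Mer.mulOp _ _ (phi_lam N τ 0 b a)) A ψ)
    (sum_Om_self (V := V) a b)
  simp only [TensorProduct.map_add_right, LinearMap.add_apply,
    map_eq_zero_of_lTensor _ (lTensor_eTot ψ hψ _), add_zero] at h3
  rw [h1, h1, h2, h3]

/-- Summing over `p` makes the right factor of `Ω_0` the total weight operator, which kills `ψ`.
This is what allows `sum_mul_smul_of_three_term` to discard the squares `ρ(x - z_s)²`. -/
lemma sum_Om0 (hψ : ψ ∈ FunZero N V) (s : Fin n) : ∑ p, (Om0 N V s p).lTensor (MerLam N) ψ = 0 := by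
  have h : ∑ p, Om0 N V s p = ∑ k : Fin N, e V k k s * eTot V k := by
    unfold Om0 Om eTot
    rw [Finset.sum_comm]
    simp only [Finset.mul_sum]
  have h2 := congrArg (fun A => LinearMap.lTensorHom (R := ℂ) (MerLam N) A ψ) h
  simp only [map_sum, LinearMap.sum_apply, LinearMap.coe_lTensorHom, LinearMap.lTensor_mul,
    Module.End.mul_apply, lTensor_eTot ψ hψ, map_zero, Finset.sum_const_zero] at h2
  exact h2

/-- The commuting operators `A_a = diagOp V τ z x a` have sum zero, so `2 ∑_{a<b} A_a A_b = -∑_a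
A_a²`, and the squares are expanded by `diagOp_sq`. -/
lemma two_smul_sum_diagOp (hV : ∀ (s : Fin n) (v : V s), ⁅(1 : Matrix (Fin N) (Fin N) ℂ), v⁆ = 0)
    (x : ℂ) :
    (2 : ℂ) • ∑ a : Fin N, ∑ b ∈ Finset.univ.filter (fun b => a < b), diagOp V τ z x a (diagOp V τ z x b ψ) =
      (2 : ℂ) • ∑ s, rho τ (x - z s) • ∑ a : Fin N, TensorProduct.map
        (Mer.derivOp (id_analytic N) (Pi.single a 1 : Cartan N)) (e V a a s) ψ -
      ∑ a : Fin N, (Mer.derivOp (id_analytic N) (Pi.single a 1 : Cartan N) ^ 2).rTensor _ ψ -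
      ∑ s, ∑ p, (rho τ (x - z s) * rho τ (x - z p)) • (Om0 N V s p).lTensor (MerLam N) ψ := by
  have h1 := LinearMap.congr_fun (two_smul_sum_lt_mul (fun a : Fin N => diagOp V τ z x a)
    (diagOp_comm V τ z x) (sum_diagOp hV τ z x)) ψ
  have h2 := fun a : Fin N => LinearMap.congr_fun (diagOp_sq V τ z x a) ψ
  simp only [LinearMap.add_apply, LinearMap.smul_apply, LinearMap.sum_apply, Module.End.mul_apply,
    LinearMap.zero_apply] at h1 h2
  have h3 := Finset.sum_congr rfl fun (a : Fin N) (_ : a ∈ Finset.univ) => h2 a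
  rw [Finset.sum_add_distrib, Finset.sum_add_distrib, ← Finset.smul_sum] at h3
  have h4 : ∑ a : Fin N, ∑ s, ∑ p, (rho τ (x - z s) * rho τ (x - z p)) •
      (Om V a a s p).lTensor (MerLam N) ψ =
      ∑ s, ∑ p, (rho τ (x - z s) * rho τ (x - z p)) • (Om0 N V s p).lTensor (MerLam N) ψ := by
    rw [Finset.sum_comm]
    refine Finset.sum_congr rfl fun s _ => ?_
    rw [Finset.sum_comm]
    refine Finset.sum_congr rfl fun p _ => ?_
    rw [← Finset.smul_sum]
    have := congrArg (fun A => A ψ) (map_sum (LinearMap.lTensorHom (R := ℂ) (MerLam N))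
      (fun k : Fin N => Om V k k s p) Finset.univ)
    simp only [LinearMap.coe_lTensorHom, LinearMap.sum_apply] at this
    rw [← this]
    rfl
  have h5 : ∑ a : Fin N, ∑ s, rho τ (x - z s) • TensorProduct.map
        (Mer.derivOp (id_analytic N) (Pi.single a 1 : Cartan N)) (e V a a s) ψ =
      ∑ s, rho τ (x - z s) • ∑ a : Fin N, TensorProduct.map
        (Mer.derivOp (id_analytic N) (Pi.single a 1 : Cartan N)) (e V a a s) ψ := by
    rw [Finset.sum_comm]
    simp only [Finset.smul_sum]
  rw [h4, h5] at h3
  rw [eq_sub_of_add_eq h3] at h1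
  rw [eq_neg_of_add_eq_zero_left h1]
  abel

lemma sum_lt_smul_e_add_Om (hV : ∀ (s : Fin n) (v : V s), ⁅(1 : Matrix (Fin N) (Fin N) ℂ), v⁆ = 0)
    (r' : Fin n → ℂ) :
    (2 : ℂ) • ∑ a : Fin N, ∑ b ∈ Finset.univ.filter (fun b => a < b), ∑ s,
        r' s • (e V b b s).lTensor (MerLam N) ψ +
      (2 : ℂ) • ∑ a : Fin N, ∑ b ∈ Finset.univ.filter (fun b => a < b), ∑ s,
        r' s • (Om V a b s s).lTensor (MerLam N) ψ +
      ∑ s, r' s • (Om0 N V s s).lTensor (MerLam N) ψ =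
      -((2 : ℂ) • ∑ s, r' s • (casimir N V s).lTensor (MerLam N) ψ) := by
  have h1 : ∀ s, (2 : ℂ) • ∑ a : Fin N, ∑ b ∈ Finset.univ.filter (fun b => a < b),
      ((e V b b s).lTensor (MerLam N) ψ + (Om V a b s s).lTensor (MerLam N) ψ) +
      (Om0 N V s s).lTensor (MerLam N) ψ = -((2 : ℂ) • (casimir N V s).lTensor (MerLam N) ψ) := by
    intro s
    have h := congrArg (fun A => LinearMap.lTensorHom (R := ℂ) (MerLam N) A ψ) (two_smul_casimir hV s)
    simp only [map_sum, map_add, map_neg, map_smul, LinearMap.sum_apply, LinearMap.add_apply,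
      LinearMap.smul_apply, LinearMap.neg_apply, LinearMap.coe_lTensorHom] at h
    exact h
  have h2 : ∀ f : Fin N → Fin N → Fin n → MerLam N ⊗[ℂ] (⨂[ℂ] s, V s),
      ∑ a, ∑ b ∈ Finset.univ.filter (fun b => a < b), ∑ s, r' s • f a b s =
      ∑ s, r' s • ∑ a, ∑ b ∈ Finset.univ.filter (fun b => a < b), f a b s := by
    intro f
    simp only [Finset.smul_sum]
    exact (Finset.sum_congr rfl fun a _ => Finset.sum_comm).trans Finset.sum_comm
  rw [h2 fun _ b s => (e V b b s).lTensor (MerLam N) ψ,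
    h2 fun a b s => (Om V a b s s).lTensor (MerLam N) ψ]
  simp only [Finset.smul_sum (r := (2 : ℂ)), ← Finset.sum_add_distrib, ← Finset.sum_neg_distrib]
  refine Finset.sum_congr rfl fun s _ => ?_
  have h3 := congrArg (fun y => r' s • y) (h1 s)
  simp only [Finset.sum_add_distrib] at h3
  linear_combination (norm := module) h3

variable (V) in
/-- The second coefficient of the RST operator in terms of the KZB operators. -/
theorem rstCoeffAux_eq_kzb (τ : ℍ) (z : Fin n → ℂ)
    (hz : ∀ s p : Fin n, s ≠ p → z s - z p ∉ lattice τ)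
    (hV : ∀ (s : Fin n) (v : V s), ⁅(1 : Matrix (Fin N) (Fin N) ℂ), v⁆ = 0)
    (x : Reg τ z) {k : ℕ} (hk : k + 2 = N) {ψ : MerLam N ⊗[ℂ] (⨂[ℂ] s, V s)}
    (hψ : ψ ∈ FunZero N V) :
    rstCoeffAux V τ z x k ψ = -((2 * Real.pi * Complex.I : ℂ) • kzbZeroAux V τ z ψ) -
      ∑ s, (rho τ (x.1 - z s) • kzbAux V τ z s ψ +
        deriv (rho τ) (x.1 - z s) • (casimir N V s).lTensor (MerLam N) ψ) := by
  have hQ := two_smul_sum_diagOp (τ := τ) (z := z) ψ hV x.1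
  have hK := sum_offdiag_of_relations (fun s => rho τ (x.1 - z s))
    (fun s => deriv (rho τ) (x.1 - z s)) (sigmaSigmaOm V τ z x.1 ψ) (sigmaOm V τ z ψ)
    (phiOm V τ z ψ) (fun a b s => (Om V a b s s).lTensor (MerLam N) ψ)
    (fun a b s p hab hsp => sigmaSigmaOm_eq ψ hz x hab hsp)
    (fun a b s hab => sigmaSigmaOm_self ψ x hab)
    (fun a b s p _ hsp => sigmaSigmaOm_comm ψ x.1 hsp)
    (fun a b s p _ hsp => sigmaOm_comm ψ hsp)
    (fun a b _ => sum_phiOm_self ψ hψ a b)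
  have hW := sum_mul_smul_of_three_term (fun s => rho τ (x.1 - z s))
    (fun s => deriv (rho τ) (x.1 - z s)) (fun s p => rho τ (z s - z p))
    (fun s p => eta τ (z s - z p)) (eta τ 0)
    (fun s p => (Om0 N V s p).lTensor (MerLam N) ψ)
    (fun s p hsp => by
      have h := rho_mul_rho τ (theta_ne_zero τ (x.2 s)) (theta_ne_zero τ (x.2 p))
        (by rw [sub_sub_sub_cancel_left]; exact theta_ne_zero τ (hz s p hsp))
      rwa [sub_sub_sub_cancel_left] at h)
    (fun s => by rw [sub_self]) (fun s p => by rw [← rho_neg, neg_sub])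
    (fun s p => by rw [Om0_comm]) (fun s => sum_Om0 ψ hψ s)
  have hC := sum_lt_smul_e_add_Om ψ hV fun s => deriv (rho τ) (x.1 - z s)
  have hH0 : kzbZeroAux V τ z ψ = (1 / (4 * Real.pi * Complex.I) : ℂ) •
      ((∑ a : Fin N, (Mer.derivOp (id_analytic N) (Pi.single a 1 : Cartan N) ^ 2).rTensor _ ψ) +
        (∑ s, ∑ p, (1 / 2 * eta τ (z s - z p)) • (Om0 N V s p).lTensor (MerLam N) ψ -
        ∑ s, ∑ p, ∑ a, ∑ b ∈ Finset.univ.filter (fun b => b ≠ a), phiOm V τ z ψ a b s p)) := by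
    unfold kzbZeroAux
    simp only [LinearMap.add_apply, LinearMap.smul_apply, LinearMap.sum_apply, LinearMap.sub_apply,
      Finset.sum_sub_distrib]
    rw [smul_add]
    rfl
  have hH : ∑ s, rho τ (x.1 - z s) • kzbAux V τ z s ψ =
      -∑ s, rho τ (x.1 - z s) • ∑ a : Fin N, TensorProduct.map
        (Mer.derivOp (id_analytic N) (Pi.single a 1 : Cartan N)) (e V a a s) ψ +
      ∑ s, rho τ (x.1 - z s) • ∑ p ∈ Finset.univ.filter (fun p => p ≠ s),
        rho τ (z s - z p) • (Om0 N V s p).lTensor (MerLam N) ψ +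
      ∑ s, rho τ (x.1 - z s) • ∑ p ∈ Finset.univ.filter (fun p => p ≠ s),
        ∑ a, ∑ b ∈ Finset.univ.filter (fun b => b ≠ a), sigmaOm V τ z ψ a b s p := by
    rw [← Finset.sum_neg_distrib, ← Finset.sum_add_distrib, ← Finset.sum_add_distrib]
    refine Finset.sum_congr rfl fun s _ => ?_
    unfold kzbAux
    simp only [LinearMap.add_apply, LinearMap.neg_apply, LinearMap.smul_apply, LinearMap.sum_apply,
      Finset.sum_add_distrib, smul_add, smul_neg]
    rw [add_assoc]
    rfl
  have hS : rstCoeffAux V τ z x k ψ =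
      ∑ a, ∑ b ∈ Finset.univ.filter (fun b => a < b), diagOp V τ z x.1 a (diagOp V τ z x.1 b ψ) +
      ∑ a : Fin N, ∑ b ∈ Finset.univ.filter (fun b => a < b), ∑ s,
        deriv (rho τ) (x.1 - z s) • (e V b b s).lTensor (MerLam N) ψ -
      ∑ a, ∑ b ∈ Finset.univ.filter (fun b => a < b), ∑ s, ∑ p,
        sigmaSigmaOm V τ z x.1 ψ a b s p := by
    rw [rstCoeffAux_pred_pred V τ z x hk hψ]
    simp only [Finset.sum_add_distrib, Finset.sum_sub_distrib]
    rfl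
  -- Linearizing `ρ(x - z_s) ρ(x - z_p)` yields the `η` terms of `H_0`, the `ρ(z_s - z_p) Ω_0` terms
  -- of the `H_s`, and a term with `ρ'(x - z_s) Ω_0^(s,s)` that goes into `c_2^(s)`.
  rw [hW] at hQ
  rw [hS, hH0, Finset.sum_add_distrib, hH, smul_smul]
  have hc : (2 * Real.pi * Complex.I : ℂ) * (1 / (4 * Real.pi * Complex.I)) = 1 / 2 := by
    have : (Real.pi : ℂ) ≠ 0 := by exact_mod_cast Real.pi_ne_zero
    have := Complex.I_ne_zero
    field_simp
    norm_num
  rw [hc]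
  -- All three sum identities were stated in doubled form to avoid halves under symmetrization. The
  -- sign of `hK` is that of the transpositions in the determinant.
  linear_combination (norm := module) (1 / 2 : ℂ) • hQ - (1 / 2 : ℂ) • hK + (1 / 2 : ℂ) • hC

end PartOne

end EllipticBethe
-- Schur's lemma in countable dimension
section SchurLemma

variable {M : Type*} [AddCommGroup M] [Module ℂ M]

/-- Over `ℂ` the polynomial is a nonzero constant times a product of factors `X - μ`, each of which
is invertible at `c`. -/
lemma isUnit_aeval_of_spectrum_eq_empty {A : Type*} [Ring A] [Algebra ℂ A] {c : A}
    (hc : spectrum ℂ c = ∅) {p : Polynomial ℂ} (hp : p ≠ 0) : IsUnit (Polynomial.aeval c p) := by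
  have h : IsUnit (Polynomial.aeval c (Multiset.map (fun x => Polynomial.X - Polynomial.C x)
      p.roots).prod) := by
    by_contra h
    obtain ⟨k, hk, -⟩ := spectrum.exists_mem_of_not_isUnit_aeval_prod h
    rw [hc] at hk
    exact hk
  rw [(IsAlgClosed.splits p).eq_prod_roots, map_mul, Polynomial.aeval_C]
  exact ((IsUnit.mk0 _ (Polynomial.leadingCoeff_ne_zero.2 hp)).map (algebraMap ℂ A)).mul h

/-- The resolvents of an operator with empty spectrum are linearly independent. -/
lemma linearIndependent_resolvent_apply {c : Module.End ℂ M} (hc : spectrum ℂ c = ∅) {v : M}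
    (hv : v ≠ 0) : LinearIndependent ℂ fun μ : ℂ =>
      (Ring.inverse (c - algebraMap ℂ (Module.End ℂ M) μ) : Module.End ℂ M) v := by
  rw [linearIndependent_iff']
  intro s m hm i hi
  have hunit : ∀ μ, IsUnit (c - algebraMap ℂ (Module.End ℂ M) μ) := fun μ => by
    have := isUnit_aeval_of_spectrum_eq_empty hc (Polynomial.X_sub_C_ne_zero μ)
    simpa using this
  -- Clearing denominators turns a linear relation between resolvents into a polynomial `p` in `c`
  -- that kills `v`.
  have h1 : ∀ j ∈ s, Polynomial.aeval c (∏ k ∈ s, (Polynomial.X - Polynomial.C k)) *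
      Ring.inverse (c - algebraMap ℂ (Module.End ℂ M) j) =
      Polynomial.aeval c (∏ k ∈ s.erase j, (Polynomial.X - Polynomial.C k)) := fun j hj => by
    rw [← Finset.prod_erase_mul s _ hj, map_mul, map_sub, Polynomial.aeval_X, Polynomial.aeval_C,
      mul_assoc, Ring.mul_inverse_cancel _ (hunit j), mul_one]
  set p : Polynomial ℂ := ∑ j ∈ s, m j • ∏ k ∈ s.erase j, (Polynomial.X - Polynomial.C k) with hp
  have h2 : Polynomial.aeval c p v = 0 := by
    have := congrArg (Polynomial.aeval c (∏ k ∈ s, (Polynomial.X - Polynomial.C k))) hm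
    rw [map_zero, map_sum] at this
    rw [hp, map_sum, LinearMap.sum_apply, ← this]
    refine Finset.sum_congr rfl fun j hj => ?_
    rw [map_smul, map_smul, LinearMap.smul_apply, ← h1 j hj]
    rfl
  -- A nonzero polynomial in `c` is invertible and cannot kill `v ≠ 0`. Evaluating `p` at the root
  -- `i` then leaves only the summand with coefficient `m i`.
  have h3 : p = 0 := by
    by_contra h
    have hinj := ((Module.End.isUnit_iff _).1 (isUnit_aeval_of_spectrum_eq_empty hc h)).1
    exact hv (hinj (h2.trans (map_zero _).symm))
  have h4 := congrArg (Polynomial.eval i) h3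
  rw [hp, Polynomial.eval_finsetSum, Finset.sum_eq_single i] at h4
  · simp only [Polynomial.eval_smul, Polynomial.eval_prod, Polynomial.eval_sub, Polynomial.eval_X,
      Polynomial.eval_C, Polynomial.eval_zero, smul_eq_mul, mul_eq_zero] at h4
    refine h4.resolve_right (Finset.prod_ne_zero_iff.2 fun k hk => ?_)
    exact sub_ne_zero.2 (Finset.ne_of_mem_erase hk).symm
  · intro j hj hji
    rw [Polynomial.eval_smul, Polynomial.eval_prod, Finset.prod_eq_zero
      (Finset.mem_erase.2 ⟨hji.symm, hi⟩) (by simp), smul_zero]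
  · exact fun h => absurd hi h

/-- With empty spectrum the resolvents applied to a nonzero vector would be linearly independent and
indexed by all of `ℂ`, which is uncountable. -/
lemma spectrum_nonempty_of_rank_le_aleph0 [Nontrivial M] (hM : Module.rank ℂ M ≤ Cardinal.aleph0)
    (c : Module.End ℂ M) : (spectrum ℂ c).Nonempty := by
  by_contra h
  obtain ⟨v, hv⟩ := exists_ne (0 : M)
  have h1 := (linearIndependent_resolvent_apply (Set.not_nonempty_iff_eq_empty.1 h)
    hv).cardinal_lift_le_rank
  have h2 := h1.trans (Cardinal.lift_le.2 hM)
  rw [Cardinal.mk_complex, Cardinal.lift_continuum, Cardinal.lift_aleph0] at h2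
  exact absurd h2 (not_le.2 Cardinal.aleph0_lt_continuum)

variable {L : Type*} [LieRing L] [LieAlgebra ℂ L] [LieRingModule L M] [LieModule ℂ L M]

/-- The words in a finite basis of `L`, applied to one nonzero vector, are countable in number;
their span is stable under `L`, hence is the whole module. -/
lemma rank_le_aleph0_of_isIrreducible [Module.Finite ℂ L] [LieModule.IsIrreducible ℂ L M] :
    Module.rank ℂ M ≤ Cardinal.aleph0 := by
  have := LieModule.nontrivial_of_isIrreducible ℂ L M
  obtain ⟨v, hv⟩ := exists_ne (0 : M)
  let b := Module.finBasis ℂ L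
  let f : List (Fin (Module.finrank ℂ L)) → M := fun l =>
    (l.map fun i => LieModule.toEnd ℂ L M (b i)).prod v
  let S : LieSubmodule ℂ L M :=
    { Submodule.span ℂ (Set.range f) with
      lie_mem := fun {x m} hm => by
        change m ∈ Submodule.span ℂ (Set.range f) at hm
        change ⁅x, m⁆ ∈ Submodule.span ℂ (Set.range f)
        induction hm using Submodule.span_induction with
        | mem y hy =>
          obtain ⟨l, rfl⟩ := hy
          rw [← b.sum_repr x, sum_lie]
          refine Submodule.sum_mem _ fun i _ => ?_
          rw [smul_lie]
          exact Submodule.smul_mem _ _ (Submodule.subset_span ⟨i :: l, by simp [f]⟩)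
        | zero => simp
        | add y y' _ _ h h' => rw [lie_add]; exact Submodule.add_mem _ h h'
        | smul a y _ h => rw [lie_smul]; exact Submodule.smul_mem _ _ h }
  have hS : S = ⊤ := by
    refine (IsSimpleOrder.eq_bot_or_eq_top S).resolve_left fun h => hv ?_
    have : v ∈ S := Submodule.subset_span (s := Set.range f) ⟨[], by simp [f]⟩
    rwa [h, LieSubmodule.mem_bot] at this
  have htop : Submodule.span ℂ (Set.range f) = ⊤ := by
    rw [eq_top_iff]
    intro m _
    have : m ∈ S := by rw [hS]; exact LieSubmodule.mem_top m
    exact this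
  rw [← rank_top, ← htop]
  exact (rank_span_le _).trans (Cardinal.le_aleph0_iff_set_countable.2 (Set.countable_range f))

/-- **Schur's lemma** for irreducible modules, of any dimension, over a finite-dimensional complex
Lie algebra. -/
theorem exists_eq_algebraMap_of_isIrreducible [Module.Finite ℂ L] [LieModule.IsIrreducible ℂ L M]
    (c : Module.End ℂ M) (hc : ∀ (x : L) (m : M), c ⁅x, m⁆ = ⁅x, c m⁆) :
    ∃ μ : ℂ, c = algebraMap ℂ (Module.End ℂ M) μ := by
  have := LieModule.nontrivial_of_isIrreducible ℂ L M
  obtain ⟨μ, hμ⟩ := spectrum_nonempty_of_rank_le_aleph0 (rank_le_aleph0_of_isIrreducible (L := L)) c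
  refine ⟨μ, ?_⟩
  let g : M →ₗ⁅ℂ, L⁆ M :=
    { toLinearMap := algebraMap ℂ (Module.End ℂ M) μ - c
      map_lie' := fun {x m} => by simp [hc] }
  have hg : ∀ m, g m = μ • m - c m := fun m => rfl
  rw [spectrum.mem_iff, Module.End.isUnit_iff] at hμ
  -- The intertwiner `μ - c` is not bijective, as `μ` lies in the spectrum. Its kernel and range are
  -- submodules of an irreducible module, so it must be zero.
  have hzero : ∀ m, g m = 0 := by
    rcases IsSimpleOrder.eq_bot_or_eq_top g.ker with h | h
    · rcases IsSimpleOrder.eq_bot_or_eq_top g.range with h' | h'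
      · intro m
        have : g m ∈ g.range := (LieModuleHom.mem_range _ _).2 ⟨m, rfl⟩
        rwa [h', LieSubmodule.mem_bot] at this
      · refine absurd ⟨?_, ?_⟩ hμ
        · exact (LieModuleHom.ker_eq_bot g).1 h
        · intro m
          have : m ∈ g.range := by rw [h']; exact LieSubmodule.mem_top m
          exact (LieModuleHom.mem_range _ _).1 this
    · intro m
      have : m ∈ g.ker := by rw [h]; exact LieSubmodule.mem_top m
      exact LieModuleHom.mem_ker.1 this
  refine LinearMap.ext fun m => ?_
  have := hzero m
  rw [hg, sub_eq_zero] at this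
  exact this.symm

end SchurLemma

namespace EllipticBethe

/-! ### The Bethe algebra for `N = 2` -/

section PartTwo

universe u

lemma reg_dense {n : ℕ} (τ : ℍ) (z : Fin n → ℂ) : Dense {x : ℂ | ∀ k, x - z k ∉ lattice τ} := by
  have h : {x : ℂ | ∀ k, x - z k ∉ lattice τ} = (⋃ k, (fun x => x - z k) ⁻¹' lattice τ)ᶜ := by
    ext x; simp
  rw [h]
  exact Set.Countable.dense_compl ℂ (Set.countable_iUnion fun k =>
    (lattice_countable τ).preimage (sub_left_injective))

/-- The functions `1, ρ(x - z_1), …, ρ(x - z_n)` are linearly independent. -/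
lemma eq_zero_of_add_sum_rho_eq_zero {n : ℕ} (τ : ℍ) {z : Fin n → ℂ}
    (hz : ∀ s p : Fin n, s ≠ p → z s - z p ∉ lattice τ) {a : ℂ} {b : Fin n → ℂ}
    (h : ∀ x : Reg τ z, a + ∑ s, rho τ (x.1 - z s) * b s = 0) : a = 0 ∧ ∀ s, b s = 0 := by
  have hb : ∀ t, b t = 0 := by
    intro t
    -- The relation is multiplied by `θ(x - z_t)`, which cancels the pole at `z_t`. The result is
    -- continuous there, its value is the residue `b t`, and it vanishes on the dense set of regular
    -- points.
    let F : ℂ → ℂ := fun x => a * theta τ (x - z t) +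
      (∑ s ∈ Finset.univ.erase t, deriv (theta τ) (x - z s) / theta τ (x - z s) * b s) *
        theta τ (x - z t) + deriv (theta τ) (x - z t) * b t
    have hθ : Continuous (theta τ) := (theta_differentiable τ).continuous
    have hθ' : Continuous (deriv (theta τ)) := (theta_deriv_differentiable τ).continuous
    have hF : ContinuousAt F (z t) := by
      have hsum : ContinuousAt (fun x => ∑ s ∈ Finset.univ.erase t,
          deriv (theta τ) (x - z s) / theta τ (x - z s) * b s) (z t) := by
        refine tendsto_finsetSum _ fun s hs => ?_
        have h1 : ContinuousAt (fun x => deriv (theta τ) (x - z s)) (z t) := by fun_prop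
        have h2 : ContinuousAt (fun x => theta τ (x - z s)) (z t) := by fun_prop
        exact (h1.div h2 (theta_ne_zero τ (hz t s (Finset.ne_of_mem_erase hs).symm))).mul_const _
      have h1 : ContinuousAt (fun x => theta τ (x - z t)) (z t) := by fun_prop
      have h2 : ContinuousAt (fun x => deriv (theta τ) (x - z t)) (z t) := by fun_prop
      exact ((h1.const_mul a).add (hsum.mul h1)).add (h2.mul_const _)
    have hF0 : F (z t) = b t := by
      simp only [F, sub_self, theta_zero, theta_deriv_zero]
      ring
    have hR : ∀ x ∈ {x : ℂ | ∀ k, x - z k ∉ lattice τ}, F x = 0 := by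
      intro x hx
      have h1 := h ⟨x, hx⟩
      rw [← Finset.sum_erase_add _ _ (Finset.mem_univ t)] at h1
      have hne := theta_ne_zero τ (hx t)
      have h2 : rho τ (x - z t) * theta τ (x - z t) = deriv (theta τ) (x - z t) :=
        div_mul_cancel₀ _ hne
      simp only [F]
      rw [← h2]
      have h3 := congrArg (fun y => y * theta τ (x - z t)) h1
      simp only [rho] at h3 ⊢
      linear_combination h3
    have := mem_closure_iff_nhdsWithin_neBot.1 (reg_dense τ z (z t))
    rw [← hF0]
    exact tendsto_nhds_unique (hF.tendsto.mono_left nhdsWithin_le_nhds)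
      (tendsto_const_nhds.congr' (eventually_nhdsWithin_of_forall fun x hx => (hR x hx).symm))
  refine ⟨?_, hb⟩
  obtain ⟨x, hx⟩ := (reg_dense τ z).nonempty
  simpa [hb] using h ⟨x, hx⟩

/-- Linear functionals on `E / B` reduce this to the scalar independence of `1` and the `ρ(x -
z_s)`; they separate the points of the quotient, which may be infinite-dimensional. -/
lemma mem_of_add_sum_rho_smul_mem {n : ℕ} (τ : ℍ) {z : Fin n → ℂ}
    (hz : ∀ s p : Fin n, s ≠ p → z s - z p ∉ lattice τ) {E : Type*} [AddCommGroup E] [Module ℂ E]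
    (B : Submodule ℂ E) {g : E} {h : Fin n → E}
    (hB : ∀ x : Reg τ z, g + ∑ s, rho τ (x.1 - z s) • h s ∈ B) : g ∈ B ∧ ∀ s, h s ∈ B := by
  have key : ∀ l : Module.Dual ℂ (E ⧸ B), l (B.mkQ g) = 0 ∧ ∀ s, l (B.mkQ (h s)) = 0 := by
    intro l
    refine eq_zero_of_add_sum_rho_eq_zero τ hz fun x => ?_
    have h1 : B.mkQ (g + ∑ s, rho τ (x.1 - z s) • h s) = 0 := by
      rw [Submodule.mkQ_apply, Submodule.Quotient.mk_eq_zero]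
      exact hB x
    have h2 := congrArg l h1
    simpa only [map_add, map_sum, map_smul, smul_eq_mul, map_zero] using h2
  refine ⟨?_, fun s => ?_⟩
  · rw [← Submodule.Quotient.mk_eq_zero, ← Submodule.mkQ_apply]
    exact (Module.forall_dual_apply_eq_zero_iff ℂ _).1 fun l => (key l).1
  · rw [← Submodule.Quotient.mk_eq_zero, ← Submodule.mkQ_apply]
    exact (Module.forall_dual_apply_eq_zero_iff ℂ _).1 fun l => (key l).2 s

/-- An algebra generated by `T(x) = -w h_0 - ∑_s (ρ(x - z_s) h_s + scalar)` contains `h_0` and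
all `h_s`. -/
lemma adjoin_eq_of_eq_rho_sum {n : ℕ} (τ : ℍ) {z : Fin n → ℂ}
    (hz : ∀ s p : Fin n, s ≠ p → z s - z p ∉ lattice τ) {A : Type*} [Ring A] [Algebra ℂ A]
    {T : Reg τ z → A} {w : ℂ} (hw : w ≠ 0) {h0 : A} {h : Fin n → A} {r : Reg τ z → Fin n → ℂ}
    {c : Fin n → A} (hc : ∀ s, ∃ μ : ℂ, c s = algebraMap ℂ A μ)
    (hT : ∀ x, T x = -(w • h0) - ∑ s, (rho τ (x.1 - z s) • h s + r x s • c s)) :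
    Algebra.adjoin ℂ (insert 0 (Set.range T)) = Algebra.adjoin ℂ (insert h0 (Set.range h)) := by
  have halg : ∀ (S : Subalgebra ℂ A) (s : Fin n) (a : ℂ), a • c s ∈ S := fun S s a => by
    obtain ⟨μ, hμ⟩ := hc s
    rw [hμ]
    exact S.smul_mem (S.algebraMap_mem _) _
  refine le_antisymm (Algebra.adjoin_le ?_) (Algebra.adjoin_le ?_)
  · rintro _ (rfl | ⟨x, rfl⟩)
    · exact Subalgebra.zero_mem _
    · rw [hT x]
      refine Subalgebra.sub_mem _ (Subalgebra.neg_mem _ (Subalgebra.smul_mem _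
        (Algebra.subset_adjoin (Set.mem_insert _ _)) _)) (Subalgebra.sum_mem _ fun s _ => ?_)
      exact Subalgebra.add_mem _ (Subalgebra.smul_mem _ (Algebra.subset_adjoin
        (Set.mem_insert_of_mem _ (Set.mem_range_self s))) _) (halg _ s _)
  -- After removal of the scalars, `-T x` is a combination of `w h_0` and the `h_s` with
  -- coefficients `1` and `ρ(x - z_s)` and lies in the algebra for every regular `x`; the algebra is
  -- regarded as a subspace.
  · have key := mem_of_add_sum_rho_smul_mem τ hz
      (Subalgebra.toSubmodule (Algebra.adjoin ℂ (insert 0 (Set.range T)))) (g := w • h0) (h := h)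
      (fun x => by
        have h1 : T x ∈ Algebra.adjoin ℂ (insert 0 (Set.range T)) :=
          Algebra.subset_adjoin (Set.mem_insert_of_mem _ (Set.mem_range_self x))
        have h2 : ∑ s, r x s • c s ∈ Algebra.adjoin ℂ (insert 0 (Set.range T)) :=
          Subalgebra.sum_mem _ fun s _ => halg _ s _
        have h3 := Subalgebra.sub_mem _ (Subalgebra.neg_mem _ h1) h2
        have h4 : -T x - ∑ s, r x s • c s = w • h0 + ∑ s, rho τ (x.1 - z s) • h s := by
          rw [hT x, Finset.sum_add_distrib]
          abel
        rwa [h4] at h3)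
    rintro _ (rfl | ⟨s, rfl⟩)
    · have := Subalgebra.smul_mem _ key.1 w⁻¹
      rwa [inv_smul_smul₀ hw] at this
    · exact key.2 s

/-- `h k - e f + h` is central in the enveloping algebra of `gl_2`. -/
lemma casimir_two_commute {R : Type*} [Ring R] {h k e f : R} (hk : h * k = k * h)
    (he : h * e = e * h + e) (ke : k * e = e * k - e) (hf : h * f = f * h - f)
    (kf : k * f = f * k + f) (ef : e * f = f * e + (h - k)) :
    Commute (h * k - e * f + h) h ∧ Commute (h * k - e * f + h) k ∧
      Commute (h * k - e * f + h) e ∧ Commute (h * k - e * f + h) f := by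
  simp only [commute_iff_eq]
  refine ⟨?_, ?_, ?_, ?_⟩
  · linear_combination (norm := noncomm_ring) (-1 : ℤ) • (h * hk) + he * f + e * hf
  · linear_combination (norm := noncomm_ring) hk * k + ke * f + e * kf + hk
  · linear_combination (norm := noncomm_ring) h * ke + he * k + e * ef
  · linear_combination (norm := noncomm_ring) h * kf + hf * k - ef * f + hf + kf

variable {n : ℕ} (V : Fin n → Type u) [∀ s, AddCommGroup (V s)] [∀ s, Module ℂ (V s)]
  [∀ s, LieRingModule (Matrix (Fin 2) (Fin 2) ℂ) (V s)]
  [∀ s, LieModule ℂ (Matrix (Fin 2) (Fin 2) ℂ) (V s)]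

lemma gl_mul_gl (a b c d : Fin 2) (s : Fin n) : gl V a b s * gl V c d s =
    gl V c d s * gl V a b s + ((if b = c then gl V a d s else 0) - if d = a then gl V c b s else 0) := by
  have h1 : gl V a b s * gl V c d s - gl V c d s * gl V a b s =
      LieModule.toEnd ℂ (Matrix (Fin 2) (Fin 2) ℂ) (V s)
        ⁅Matrix.single a b (1 : ℂ), Matrix.single c d (1 : ℂ)⁆ := by
    rw [LieHom.map_lie]; rfl
  rw [← sub_eq_iff_eq_add', h1, Ring.lie_def, map_sub]
  congr 1
  · split_ifs with h
    · subst h; simp [gl]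
    · simp [h]
  · split_ifs with h
    · subst h; simp [gl]
    · simp [h]

/-- The central element acts by a scalar on an irreducible module. -/
lemma exists_casimirOp_eq (s : Fin n)
    (hirr : LieModule.IsIrreducible ℂ (Matrix (Fin 2) (Fin 2) ℂ) (V s)) :
    ∃ μ : ℂ, casimirOp 2 V s = algebraMap ℂ _ μ := by
  have hk : gl V (0 : Fin 2) 0 s * gl V (1 : Fin 2) 1 s = gl V (1 : Fin 2) 1 s * gl V (0 : Fin 2) 0 s := by rw [gl_mul_gl]; simp
  have he : gl V (0 : Fin 2) 0 s * gl V (0 : Fin 2) 1 s = gl V (0 : Fin 2) 1 s * gl V (0 : Fin 2) 0 s + gl V (0 : Fin 2) 1 s := by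
    rw [gl_mul_gl]; simp
  have ke : gl V (1 : Fin 2) 1 s * gl V (0 : Fin 2) 1 s = gl V (0 : Fin 2) 1 s * gl V (1 : Fin 2) 1 s - gl V (0 : Fin 2) 1 s := by
    rw [gl_mul_gl]; simp [sub_eq_add_neg]
  have hf : gl V (0 : Fin 2) 0 s * gl V (1 : Fin 2) 0 s = gl V (1 : Fin 2) 0 s * gl V (0 : Fin 2) 0 s - gl V (1 : Fin 2) 0 s := by
    rw [gl_mul_gl]; simp [sub_eq_add_neg]
  have kf : gl V (1 : Fin 2) 1 s * gl V (1 : Fin 2) 0 s = gl V (1 : Fin 2) 0 s * gl V (1 : Fin 2) 1 s + gl V (1 : Fin 2) 0 s := by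
    rw [gl_mul_gl]; simp
  have ef : gl V (0 : Fin 2) 1 s * gl V (1 : Fin 2) 0 s = gl V (1 : Fin 2) 0 s * gl V (0 : Fin 2) 1 s + (gl V (0 : Fin 2) 0 s - gl V (1 : Fin 2) 1 s) := by
    rw [gl_mul_gl]; simp
  have hc := casimir_two_commute hk he ke hf kf ef
  set c : Module.End ℂ (V s) := gl V (0 : Fin 2) 0 s * gl V (1 : Fin 2) 1 s -
    gl V (0 : Fin 2) 1 s * gl V (1 : Fin 2) 0 s + gl V (0 : Fin 2) 0 s with hcdef
  have hcomm : ∀ a b : Fin 2, Commute c (gl V a b s) := by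
    simp only [Fin.forall_fin_two]
    exact ⟨⟨hc.1, hc.2.2.1⟩, hc.2.2.2, hc.2.1⟩
  obtain ⟨μ, hμ⟩ := exists_eq_algebraMap_of_isIrreducible
    (L := Matrix (Fin 2) (Fin 2) ℂ) c (fun x m => by
      have hx : Commute c (LieModule.toEnd ℂ (Matrix (Fin 2) (Fin 2) ℂ) (V s) x) := by
        -- The matrix units span, so commutation with the four operators `gl V a b s` is commutation
        -- with the whole Lie algebra, as Schur's lemma requires.
        have h1 : x = ∑ i, ∑ j, x i j • Matrix.single i j (1 : ℂ) := by
          conv_lhs => rw [Matrix.matrix_eq_sum_single x]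
          simp
        rw [h1, map_sum]
        refine Commute.sum_right _ _ _ fun i _ => ?_
        rw [map_sum]
        refine Commute.sum_right _ _ _ fun j _ => ?_
        rw [map_smul]
        exact (hcomm i j).smul_right _
      exact LinearMap.congr_fun hx m)
  refine ⟨μ, ?_⟩
  have h1 : casimir 2 V s = μ • 1 := by
    have h2 : casimir 2 V s = site V s c := by
      unfold casimir
      congr 1
      simp [Fin.sum_univ_two, Finset.sum_filter, hcdef]
    rw [h2, hμ, Algebra.algebraMap_eq_smul_one, site_smul]
    congr 1
    unfold site
    rw [Function.update_eq_self]
    exact PiTensorProduct.map_one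
  refine LinearMap.ext fun ψ => Subtype.ext ?_
  change (casimir 2 V s).lTensor (MerLam 2) ψ.1 = μ • ψ.1
  rw [h1, LinearMap.lTensor_smul]
  change μ • (LinearMap.lTensor _ LinearMap.id) ψ.1 = _
  rw [LinearMap.lTensor_id]
  rfl

variable {V}

/-- The coefficient of `t` is the trace `X_00 + X_11`. On zero-weight functions it becomes the sum
of the diagonal operators, which vanishes by `sum_diagOp`. -/
lemma rstCoeff_two_one (hV : ∀ (s : Fin n) (v : V s), ⁅(1 : Matrix (Fin 2) (Fin 2) ℂ), v⁆ = 0)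
    (τ : ℍ) (z : Fin n → ℂ) (x : Reg τ z) : rstCoeff 2 V τ z 1 x = 0 := by
  refine LinearMap.ext fun ψ => Subtype.ext ?_
  change rstCoeffAux V τ z x 1 ψ.1 = 0
  have h0 : ∀ m : Fin 2, (eTot V m).lTensor _ (constXT 2 x.1 _ ψ.1) = 0 := fun m => by
    rw [lTensor_constXT, lTensor_eTot _ ψ.2, map_zero]
  have hs := LinearMap.congr_fun (sum_diagOp hV τ z x.1) ψ.1
  rw [Fin.sum_univ_two, LinearMap.add_apply, LinearMap.zero_apply] at hs
  rw [rstCoeffAux_eq, cdetPoly_two_coeff_one, LinearMap.add_apply, map_add,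
    evalXT_Xmat_diag V τ z x 0 h0, evalXT_Xmat_diag V τ z x 1 h0, derivXT_constXT, map_zero,
    zero_add, zero_add, evalXT_constXT, hs]

end PartTwo

end EllipticBethe
-- Assembly of the two statements
theorem mainTheorem1 (N : ℕ) (hN : 2 ≤ N) (n : ℕ) (τ : UpperHalfPlane) (z : Fin n → ℂ)
    (hz : ∀ s p : Fin n, s ≠ p → z s - z p ∉ EllipticBethe.lattice τ)
    (V : Fin n → Type*) [∀ s, AddCommGroup (V s)] [∀ s, Module ℂ (V s)]
    [∀ s, LieRingModule (Matrix (Fin N) (Fin N) ℂ) (V s)]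
    [∀ s, LieModule ℂ (Matrix (Fin N) (Fin N) ℂ) (V s)]
    (hV : ∀ (s : Fin n) (v : V s), ⁅(1 : Matrix (Fin N) (Fin N) ℂ), v⁆ = 0) :
    (∀ x : EllipticBethe.Reg τ z,
      EllipticBethe.rstCoeff N V τ z 2 x =
        -((2 * Real.pi * Complex.I : ℂ) • EllipticBethe.kzbZero N V τ z) -
          ∑ s : Fin n,
            (EllipticBethe.rho τ (x.1 - z s) • EllipticBethe.kzb N V τ z s +
              deriv (EllipticBethe.rho τ) (x.1 - z s) • EllipticBethe.casimirOp N V s)) ∧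
    (N = 2 → (∀ s, LieModule.IsIrreducible ℂ (Matrix (Fin N) (Fin N) ℂ) (V s)) →
      EllipticBethe.betheAlgebra N V τ z =
        Algebra.adjoin ℂ
          (insert (EllipticBethe.kzbZero N V τ z) (Set.range (EllipticBethe.kzb N V τ z)))) := by
  have part1 : ∀ x : EllipticBethe.Reg τ z,
      EllipticBethe.rstCoeff N V τ z 2 x =
        -((2 * Real.pi * Complex.I : ℂ) • EllipticBethe.kzbZero N V τ z) -
          ∑ s : Fin n,
            (EllipticBethe.rho τ (x.1 - z s) • EllipticBethe.kzb N V τ z s +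
              deriv (EllipticBethe.rho τ) (x.1 - z s) • EllipticBethe.casimirOp N V s) := by
    intro x
    refine LinearMap.ext fun ψ => Subtype.ext ?_
    -- `S_2` is the coefficient of `∂_x^(N - 2)`; `2 ≤ N` ensures that the natural-number
    -- subtraction is not truncated.
    have h := EllipticBethe.rstCoeffAux_eq_kzb V τ z hz hV x (Nat.sub_add_cancel hN) ψ.2
    rw [LinearMap.sub_apply, LinearMap.neg_apply, LinearMap.sum_apply, Submodule.coe_sub,
      Submodule.coe_neg, Submodule.coe_sum]
    exact h
  refine ⟨part1, ?_⟩
  rintro rfl hirr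
  refine Eq.trans ?_ (EllipticBethe.adjoin_eq_of_eq_rho_sum τ hz (T := EllipticBethe.rstCoeff 2 V τ z 2)
    (h0 := EllipticBethe.kzbZero 2 V τ z) (h := EllipticBethe.kzb 2 V τ z)
    (r := fun x s => deriv (EllipticBethe.rho τ) (x.1 - z s))
    Complex.two_pi_I_ne_zero (fun s => EllipticBethe.exists_casimirOp_eq V s (hirr s)) part1)
  unfold EllipticBethe.betheAlgebra
  -- The generators are `S_1(x) = 0` and `S_2(x)`, matching the set `insert 0 (Set.range T)`. A
  -- regular point must exist for `0` to occur as some `S_1(x)`.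
  obtain ⟨x0, hx0⟩ := (EllipticBethe.reg_dense τ z).nonempty
  congr 1
  ext T
  constructor
  · rintro ⟨j, hj, x, rfl⟩
    obtain ⟨h1, h2⟩ := Finset.mem_Icc.1 hj
    interval_cases j
    · exact Or.inl (EllipticBethe.rstCoeff_two_one hV τ z x)
    · exact Or.inr ⟨x, rfl⟩
  · rintro (rfl | ⟨x, rfl⟩)
    · exact ⟨1, by simp, ⟨x0, hx0⟩, (EllipticBethe.rstCoeff_two_one hV τ z ⟨x0, hx0⟩).symm⟩
    · exact ⟨2, by simp, x, rfl⟩
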